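/- Let $n\ge 1$ and let $\rho=(a\,|\,b)=(a+1,1^b)$ be a hook, $n=a+b+1$. Let $\mathbf X=(x_{r,i})$, $r\in\mathbb N$, $1\le i\le n$, be a matrix of variables with first row $\mathbf x=(x_1,\dots,x_n)$, and let $\theta_1,\dots,\theta_n$ be further variables, of degree $0$. Let $\mathcal M_{(a|b)}\subseteq\mathbb Q[\mathbf X,\theta]$ be the smallest subspace that contains the $n\times n$ determinant $\det\big(\theta_i,\,1,\,x_i,\dots,\widehat{x_i^a},\dots,x_i^{n-1}\big)_{1\le i\le n}$ (the column of the $x_i^a$ is left out), and that is closed under all derivations $\partial/\partial x_{r,i}$ and under all polarizations $\sum_{i=1}^n x_{v,i}\,\partial^m/\partial x_{u,i}^m$ ($u,v\in\mathbb N$, $m\ge1$); put $\mathcal M_{(n|-1)}=0$. The symmetric group $\mathbb S_n$ permutes the columns of $\mathbf X$ together with the $\theta_i$, and $\mathcal M_{(a|b)}$ is graded by the degrees $\mathbf d=(d_0,d_1,\dots)$ in the rows of $\mathbf X$. Let $\mathcal M_{(a|b)}(\mathbf q;\mathbf z)=\sum_{\mathbf d}\mathbf q^{\mathbf d}\,\frac1{n!}\sum_{\sigma\in\mathbb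 S_n}\chi_{\mathbf d}(\sigma)\,p_{\lambda(\sigma)}(\mathbf z)$ be its graded Frobenius characteristic, where $\chi_{\mathbf d}$ is the character of the component of degree $\mathbf d$ and $\lambda(\sigma)$ is the cycle type of $\sigma$. Let $\Lambda$ be the ring of symmetric functions over $\mathbb Q$. Then there is exactly one $\mathcal S_\rho\in\Lambda\otimes\Lambda$ such that $$\mathcal S_\rho(\mathbf q;\mathbf z)=\mathcal M_{(a|b)}(\mathbf q;\mathbf z)-\mathcal M_{(a+1|b-1)}(\mathbf q;\mathbf z).$$ For a partition $\mu$ of $n$ let $\mathbf c_{\rho\mu}\in\Lambda$ be the coefficient of $s_\mu$ in $\mathcal S_\rho=\sum_{\mu\vdash n}\mathbf c_{\rho\mu}\otimes s_\mu$, and put $\mathcal A_\rho=\mathbf c_{\rho,1^n}$. Let $e_k^\perp$ be the adjoint of multiplication by $e_k$ for the Hall scalar product. Let $\mathcal T_\rho=\mathcal S_\rho[1+\mathbf q;\mathbf z]$ be obtained from $\mathcal S_\rho$ by the substitution $p_k\mapsto 1+p_k$ ($k\ge1$) in the left tensor factor. Assume the Hook Components Conjecture for $\rho$, that is, $\mathbf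 c_{\rho,(k|j)}=e_k^\perp\mathcal A_\rho$ for all $k,j\ge0$ with $k+j+1=n$. Then $\mathcal T_\rho$ has a unique expansion $\mathcal T_\rho=\sum_{\nu\vdash n}\mathbf d_{\rho\nu}\otimes e_\nu$ with $\mathbf d_{\rho\nu}\in\Lambda$; the coefficient of $e_n$ is $\mathbf d_{\rho,(n)}=\mathcal A_\rho$; and it is Schur positive, i.e. a linear combination of Schur functions with coefficients in $\mathbb N$. -/

import Mathlib

open scoped TensorProduct

namespace HookHarmonics

noncomputable section

/-! ### Symmetric functions over `ℚ` -/

/-- The ring of symmetric functions over `ℚ`, as the polynomial ring in the power sums: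
the variable of index `k : ℕ+` is `p_k`. -/
abbrev SymFun : Type := MvPolynomial ℕ+ ℚ

/-- The exponent vector of the monomial `p_λ = p_{λ₁} p_{λ₂} ⋯`, for a multiset of positive
integers. -/
def exponent (s : Multiset ℕ) : ℕ+ →₀ ℕ := Multiset.toFinsupp (s.map Nat.toPNat')

/-- The number `z_λ = ∏ₖ k ^ mₖ * mₖ!`, for the monomial `∏ₖ p_k ^ mₖ`. -/
def zee (m : ℕ+ →₀ ℕ) : ℚ := m.prod fun k r => (k : ℚ) ^ r * (r.factorial : ℚ)

/-- The power sum `p_λ`. -/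
def powerSum (s : Multiset ℕ) : SymFun := MvPolynomial.monomial (exponent s) 1

/-- The complete homogeneous symmetric function `h_k = ∑_{λ ⊢ k} p_λ / z_λ`. -/
def complete (k : ℕ) : SymFun :=
  ∑ l : k.Partition, (zee (exponent l.parts))⁻¹ • powerSum l.parts

/-- The elementary symmetric function `e_k = ∑_{λ ⊢ k} (-1) ^ (k - ℓ(λ)) p_λ / z_λ`. -/
def elementary (k : ℕ) : SymFun :=
  ∑ l : k.Partition,
    ((-1) ^ (k - Multiset.card l.parts) * (zee (exponent l.parts))⁻¹) • powerSum l.parts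

/-- `e_ν = e_{ν₁} e_{ν₂} ⋯`. -/
def elementaryProd {n : ℕ} (ν : n.Partition) : SymFun := (ν.parts.map elementary).prod

/-- `h_k` for an integer index, with `h_k = 0` for `k < 0`. -/
def completeInt (k : ℤ) : SymFun := if 0 ≤ k then complete k.toNat else 0

/-- The Schur function `s_μ = det (h_{μ_i - i + j})`, where `μ₁ ≥ μ₂ ≥ ⋯` are the parts. -/
def schur {n : ℕ} (μ : n.Partition) : SymFun :=
  Matrix.det (Matrix.of fun i j : Fin (μ.parts.sort (· ≥ ·)).length =>
    completeInt ((((μ.parts.sort (· ≥ ·)).get i : ℕ) : ℤ) - (i : ℤ) + (j : ℤ)))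

/-- The Hall scalar product: `⟨p_λ, p_μ⟩ = z_λ` if `λ = μ`, and `0` otherwise. -/
def hall : SymFun →ₗ[ℚ] SymFun →ₗ[ℚ] ℚ :=
  (MvPolynomial.basisMonomials ℕ+ ℚ).constr ℚ fun m => zee m • MvPolynomial.lcoeff ℚ m

/-- The operator `f^⊥`, adjoint to multiplication by `f` for the Hall scalar product
(see `hall_skew`). On power sums, `p_v^⊥ p_u = (z_u / z_{u - v}) p_{u - v}` if `p_v` divides
`p_u`, and `0` otherwise. -/
def skew (f : SymFun) : SymFun →ₗ[ℚ] SymFun :=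
  (MvPolynomial.basisMonomials ℕ+ ℚ).constr ℚ fun u =>
    ∑ v ∈ f.support,
      if v ≤ u then MvPolynomial.monomial (u - v) (f.coeff v * (zee u / zee (u - v))) else 0

theorem zee_ne_zero (m : ℕ+ →₀ ℕ) : zee m ≠ 0 := by
  unfold zee Finsupp.prod
  refine Finset.prod_ne_zero_iff.2 fun k _ => ?_
  have h1 : ((k : ℕ) : ℚ) ≠ 0 := by exact_mod_cast k.ne_zero
  have h2 : ((m k).factorial : ℚ) ≠ 0 := by exact_mod_cast Nat.factorial_ne_zero _
  exact mul_ne_zero (pow_ne_zero _ h1) h2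

theorem hall_monomial (m : ℕ+ →₀ ℕ) (c : ℚ) (G : SymFun) :
    hall (MvPolynomial.monomial m c) G = c * (zee m * G.coeff m) := by
  have h : MvPolynomial.monomial m c = c • (MvPolynomial.basisMonomials ℕ+ ℚ m) := by
    simp [MvPolynomial.smul_monomial]
  rw [h, map_smul, hall, Module.Basis.constr_basis]
  simp

/-- `f^⊥` is the adjoint of multiplication by `f`. -/
theorem hall_skew (f F G : SymFun) : hall (skew f F) G = hall F (f * G) := by
  suffices h : (hall.flip G) ∘ₗ (skew f) = hall.flip (f * G) from LinearMap.congr_fun h F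
  refine (MvPolynomial.basisMonomials ℕ+ ℚ).ext fun u => ?_
  have hr : hall (MvPolynomial.monomial u 1) (f * G)
      = ∑ v ∈ f.support, if v ≤ u then zee u * (f.coeff v * G.coeff (u - v)) else 0 := by
    rw [hall_monomial, one_mul]
    conv_lhs => rw [f.as_sum, Finset.sum_mul, MvPolynomial.coeff_sum, Finset.mul_sum]
    refine Finset.sum_congr rfl fun v _ => ?_
    rw [MvPolynomial.coeff_monomial_mul']
    split_ifs <;> simp
  rw [LinearMap.comp_apply, skew, Module.Basis.constr_basis, LinearMap.flip_apply,
    LinearMap.flip_apply, MvPolynomial.coe_basisMonomials, hr, map_sum, LinearMap.sum_apply]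
  refine Finset.sum_congr rfl fun v _ => ?_
  split_ifs
  · rw [hall_monomial]
    have := zee_ne_zero (u - v)
    field_simp
  · simp

/-- The plethystic evaluation `F ↦ F[1 + 𝐪]`, for which `p_k[1 + 𝐪] = 1 + p_k`. -/
def plethOneAdd : SymFun →ₐ[ℚ] SymFun := MvPolynomial.aeval fun k => 1 + MvPolynomial.X k

/-- The expansion of a symmetric function in the variables `q₀, q₁, q₂, …`, for which
`p_k ↦ q₀ ^ k + q₁ ^ k + q₂ ^ k + ⋯`. -/
def toSeries : SymFun →ₐ[ℚ] MvPowerSeries ℕ ℚ :=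
  MvPolynomial.aeval fun k => (fun d : ℕ →₀ ℕ =>
    open Classical in if ∃ i, d = Finsupp.single i (k : ℕ) then (1 : ℚ) else 0)

/-- A symmetric function is Schur positive if it is a (finite) linear combination of Schur
functions with coefficients in `ℕ`. -/
def SchurPositive (F : SymFun) : Prop :=
  ∃ c : (Σ m : ℕ, m.Partition) →₀ ℕ, F = c.sum fun l k => k • schur l.2

/-- The hook `(k | n - 1 - k)`, that is the partition `(k + 1, 1, …, 1)` of `n`. -/
def hook (n k : ℕ) (hk : k < n) : n.Partition where
  parts := (k + 1) ::ₘ Multiset.replicate (n - 1 - k) 1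
  parts_pos := by
    intro i hi
    rcases Multiset.mem_cons.1 hi with rfl | hi
    · omega
    · rw [Multiset.eq_of_mem_replicate hi]; exact one_pos
  parts_sum := by
    simp only [Multiset.sum_cons, Multiset.sum_replicate, smul_eq_mul, mul_one]
    omega

/-- The partition `1ⁿ = (1, …, 1)` of `n`. -/
def column (n : ℕ) : n.Partition where
  parts := Multiset.replicate n 1
  parts_pos := by
    intro i hi
    rw [Multiset.eq_of_mem_replicate hi]; exact one_pos
  parts_sum := by simp

/-! ### The modules `M_{(a|b)}` -/

/-- The variables: `Sum.inl (r, i)` is the entry in row `r` and column `i` of the matrix `𝐗` of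
infinitely many sets of `n` variables, and `Sum.inr i` is the inert variable `θ_i`. The row `0` is
the set `𝐱`. -/
abbrev Var (n : ℕ) : Type := (ℕ × Fin n) ⊕ Fin n

abbrev Poly (n : ℕ) : Type := MvPolynomial (Var n) ℚ

/-- The determinant `D_{(a|b)}(𝐱)`, with `n = a + b + 1`: the first column is `(θ_i)`, and the next
ones are the `(x_i ^ c)` for `c = 0, …, n - 1` in increasing order, with `c = a` left out. -/
def hookDet (n a : ℕ) : Poly n :=
  Matrix.det (Matrix.of fun i j : Fin n =>
    if (j : ℕ) = 0 then MvPolynomial.X (Sum.inr i)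
    else (MvPolynomial.X (Sum.inl (0, i)) : Poly n) ^ (if (j : ℕ) ≤ a then (j : ℕ) - 1 else j))

/-- The polarization operator `E_{𝐮𝐯}^{(r)} = ∑ᵢ vᵢ (∂/∂uᵢ)^r`, for the rows `u`, `v` of `𝐗`. -/
def polarize {n : ℕ} (u v r : ℕ) (F : Poly n) : Poly n :=
  ∑ i : Fin n,
    MvPolynomial.X (Sum.inl (v, i)) * (MvPolynomial.pderiv (Sum.inl (u, i)))^[r] F

/-- Closure under the derivations in all the variables except the `θ_i`, and under all
polarizations. -/
structure IsStable {n : ℕ} (N : Submodule ℚ (Poly n)) : Prop where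
  deriv_mem : ∀ (u : ℕ) (i : Fin n), ∀ F ∈ N, MvPolynomial.pderiv (Sum.inl (u, i)) F ∈ N
  polarize_mem : ∀ u v r : ℕ, 1 ≤ r → ∀ F ∈ N, polarize u v r F ∈ N

/-- The module `M_{(a|b)}`, with `n = a + b + 1`: the smallest space that is closed under
derivations and polarizations, and contains `D_{(a|b)}(𝐱)`. By convention `M_{(n|-1)} = 0`. -/
def hookModule (n a : ℕ) : Submodule ℚ (Poly n) :=
  if a < n then sInf {N | hookDet n a ∈ N ∧ IsStable N} else ⊥

/-- The action of `σ` on polynomials: it permutes the columns of `𝐗` and the `θ_i`. -/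
def permVar {n : ℕ} (σ : Equiv.Perm (Fin n)) : Var n → Var n :=
  Sum.map (Prod.map id σ) σ

def permute {n : ℕ} (σ : Equiv.Perm (Fin n)) : Poly n →ₐ[ℚ] Poly n :=
  MvPolynomial.rename (permVar σ)

/-- The `ℕ^∞`-grading by the degrees in the rows of `𝐗`; the `θ_i` have degree `0`. -/
def rowWeight (n : ℕ) : Var n → (ℕ →₀ ℕ) :=
  Sum.elim (fun x => Finsupp.single x.1 1) (fun _ => 0)

/-- The homogeneous component of degree `d` of `M_{(a|b)}`. -/
def component (n a : ℕ) (d : ℕ →₀ ℕ) : Submodule ℚ (Poly n) :=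
  hookModule n a ⊓ MvPolynomial.weightedHomogeneousSubmodule ℚ (rowWeight n) d

theorem permVar_injective {n : ℕ} (σ : Equiv.Perm (Fin n)) : Function.Injective (permVar σ) :=
  Function.Injective.sumMap (Function.Injective.prodMap Function.injective_id σ.injective)
    σ.injective

theorem permute_pderiv {n : ℕ} (σ : Equiv.Perm (Fin n)) (u : ℕ) (i : Fin n) (F : Poly n) :
    permute σ (MvPolynomial.pderiv (Sum.inl (u, i)) F)
      = MvPolynomial.pderiv (Sum.inl (u, σ i)) (permute σ F) :=
  (MvPolynomial.pderiv_rename (permVar_injective σ) (Sum.inl (u, i)) F).symm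

theorem permute_polarize {n : ℕ} (σ : Equiv.Perm (Fin n)) (u v r : ℕ) (F : Poly n) :
    permute σ (polarize u v r F) = polarize u v r (permute σ F) := by
  have hit : ∀ (i : Fin n) (r : ℕ),
      permute σ ((MvPolynomial.pderiv (Sum.inl (u, i)))^[r] F)
        = (MvPolynomial.pderiv (Sum.inl (u, σ i)))^[r] (permute σ F) := by
    intro i r
    induction r with
    | zero => rfl
    | succ r ih => rw [Function.iterate_succ_apply', permute_pderiv, ih,
        Function.iterate_succ_apply']
  unfold polarize
  rw [map_sum, ← Equiv.sum_comp σ (fun i => MvPolynomial.X (Sum.inl (v, i)) *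
    (MvPolynomial.pderiv (Sum.inl (u, i)))^[r] (permute σ F))]
  refine Finset.sum_congr rfl fun i _ => ?_
  rw [map_mul, hit]
  simp [permute, permVar]

theorem permute_hookDet {n : ℕ} (σ : Equiv.Perm (Fin n)) (a : ℕ) :
    permute σ (hookDet n a) = (Equiv.Perm.sign σ : ℤ) • hookDet n a := by
  unfold hookDet
  rw [AlgHom.map_det, zsmul_eq_mul, ← Matrix.det_permute]
  congr 1
  ext1 i j
  simp only [AlgHom.mapMatrix_apply, Matrix.map_apply, Matrix.of_apply, Matrix.submatrix_apply,
    id_eq]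
  split_ifs <;> simp [permute, permVar]

theorem permute_mem_hookModule {n : ℕ} (σ : Equiv.Perm (Fin n)) (a : ℕ) (F : Poly n)
    (hF : F ∈ hookModule n a) : permute σ F ∈ hookModule n a := by
  unfold hookModule at hF ⊢
  split_ifs at hF ⊢
  · rw [Submodule.mem_sInf] at hF ⊢
    rintro N ⟨hD, hN⟩
    refine hF (N.comap (permute σ).toLinearMap) ⟨?_, ⟨?_, ?_⟩⟩
    · change permute σ (hookDet n a) ∈ N
      rw [permute_hookDet]
      exact zsmul_mem hD _
    · intro u i G hG
      change permute σ _ ∈ N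
      rw [permute_pderiv]
      exact hN.deriv_mem u (σ i) _ hG
    · intro u v r hr G hG
      change permute σ _ ∈ N
      rw [permute_polarize]
      exact hN.polarize_mem u v r hr _ hG
  · rw [Submodule.mem_bot] at hF ⊢
    rw [hF, map_zero]

theorem permute_mem_component {n : ℕ} (σ : Equiv.Perm (Fin n)) (a : ℕ) (d : ℕ →₀ ℕ)
    (F : Poly n) (hF : F ∈ component n a d) :
    (permute σ).toLinearMap F ∈ component n a d := by
  refine ⟨permute_mem_hookModule σ a F hF.1, ?_⟩
  have h := (MvPolynomial.mem_weightedHomogeneousSubmodule ℚ (rowWeight n) d F).1 hF.2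
  refine (MvPolynomial.mem_weightedHomogeneousSubmodule ℚ (rowWeight n) d _).2 ?_
  have hw : rowWeight n ∘ permVar σ = rowWeight n := by
    funext x
    rcases x with x | x <;> rfl
  intro m hm
  obtain ⟨u, rfl, hu⟩ := MvPolynomial.coeff_rename_ne_zero _ _ _ hm
  rw [← h hu]
  conv_rhs => rw [← hw]
  simp [Finsupp.weight_apply, Finsupp.sum_mapDomain_index, add_smul]

/-- The character of the `𝕊ₙ`-module `component n a d`. -/
def character (n a : ℕ) (d : ℕ →₀ ℕ) (σ : Equiv.Perm (Fin n)) : ℚ :=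
  LinearMap.trace ℚ (component n a d)
    ((permute σ).toLinearMap.restrict (permute_mem_component σ a d))

/-- The Frobenius characteristic of the component of degree `d` of `M_{(a|b)}`, that is the
coefficient of `𝐪^d` in `M_{(a|b)}(𝐪; 𝐳)`: `(1 / n!) ∑_σ χ(σ) p_{λ(σ)}`, where `λ(σ)` is the
cycle type. -/
def frobenius (n a : ℕ) (d : ℕ →₀ ℕ) : SymFun :=
  (n.factorial : ℚ)⁻¹ • ∑ σ : Equiv.Perm (Fin n), character n a d σ • powerSum σ.partition.parts

/-! ### The tensor `S_ρ` -/

/-- The coefficient of `𝐪^d` in the expansion of a tensor: for `f ⊗ g` it is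
`(coefficient of 𝐪^d in f(𝐪)) • g(𝐳)`. -/
def qCoeff (d : ℕ →₀ ℕ) : SymFun ⊗[ℚ] SymFun →ₗ[ℚ] SymFun :=
  (TensorProduct.lid ℚ SymFun).toLinearMap ∘ₗ
    LinearMap.rTensor SymFun ((MvPowerSeries.coeff d) ∘ₗ toSeries.toLinearMap)

/-- `S` is `S_ρ` in tensor format, for `ρ = (a|b)` with `n = a + b + 1`:
`S(𝐪; 𝐳) = M_{(a|b)}(𝐪; 𝐳) - M_{(a+1|b-1)}(𝐪; 𝐳)`. -/
def IsHookCharacter (n a : ℕ) (S : SymFun ⊗[ℚ] SymFun) : Prop :=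
  ∀ d : ℕ →₀ ℕ, qCoeff d S = frobenius n a d - frobenius n (a + 1) d

/-- `c_{ρμ} = ⟨S_ρ, s_μ⟩`, where `⟨f ⊗ g, s_μ⟩ = ⟨g, s_μ⟩ f`. -/
def isotypic {n : ℕ} (S : SymFun ⊗[ℚ] SymFun) (μ : n.Partition) : SymFun :=
  TensorProduct.rid ℚ SymFun (LinearMap.lTensor SymFun (hall.flip (schur μ)) S)

/-- `A_ρ = c_{ρ,1ⁿ}`. -/
def alternant (n : ℕ) (S : SymFun ⊗[ℚ] SymFun) : SymFun := isotypic S (column n)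

/-- The Hook Components property of `S_ρ`: `c_{ρ,(k|j)} = e_k^⊥ A_ρ` whenever `k + j + 1 = n`. -/
def HookComponents (n : ℕ) (S : SymFun ⊗[ℚ] SymFun) : Prop :=
  ∀ (k : ℕ) (hk : k < n), isotypic S (hook n k hk) = skew (elementary k) (alternant n S)

/-- `T_ρ = S_ρ[1 + 𝐪; 𝐳]`. -/
def shifted (S : SymFun ⊗[ℚ] SymFun) : SymFun ⊗[ℚ] SymFun :=
  LinearMap.rTensor SymFun plethOneAdd.toLinearMap S

/-- `T = ∑_{ν ⊢ n} d_ν ⊗ e_ν`. -/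
def IsElementaryExpansion {n : ℕ} (T : SymFun ⊗[ℚ] SymFun) (d : n.Partition → SymFun) : Prop :=
  T = ∑ ν : n.Partition, d ν ⊗ₜ[ℚ] elementaryProd ν

end

end HookHarmonics

open HookHarmonics

open scoped TensorProduct

namespace HookHarmonics

noncomputable section

/-! The tensor exists because of polarization. Every monomial of the module contains exactly one
`θ_j`, no variable of column `j`, and has bounded degree (`exists_hookModule_le`). The elements that
are linear in each of `m` rows form a finite-dimensional space `hookTensors n a m`, acted on by the
column permutations and the row permutations. Identifying rows maps this space onto the component of
degree `d`. Full polarization goes back, up to the symmetrization over the row permutations that fix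
the labels. So the component is a space of coinvariants of a Young subgroup, and its character is a
coefficient of a Frobenius characteristic in `𝐪` (`sum_mixedTrace`, `coeff_ch_mixedTrace`). Finitely
many `m` suffice, so `hookTensor` is an honest tensor. It is the only one, since a symmetric
function is determined by its expansion in infinitely many variables (`eq_of_qCoeff`).

For the coefficient of `e_n`, the right factor is paired with `p_n`. As `p_n^⊥` is a derivation that
kills `e_i` for `i < n`, only `e_n` among the `e_ν` pairs non-trivially, with value `(-1)^(n+1)`. On
the other hand `p_n` is the alternating sum of the hook Schur functions, so the Hook Components
property turns the pairing into `(-1)^(n+1) ∑_{k<n} (-1)^k (e_k^⊥ A)[1 + 𝐪]`. Over all `k`, the sum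
`∑ (-1)^k e_k^⊥ A` is `A[𝐪 - 1]`, and the substitution `1 + 𝐪` undoes this (`sum_skew_elementary`).
The terms with `k ≥ n` vanish: antisymmetrizing `k` rows places two of them in one of the `n - 1`
columns that are left beside that of `θ` (`skew_elementary_ch_signRep`).

For positivity, `∑ ∂/∂x_i` sends `D_{(a|b)}` to a non-zero multiple of `D_{(a+1|b-1)}`, so the
modules are nested and `A` is the characteristic of a quotient of sign-isotypic parts. That its
Schur coefficients are natural numbers is shown without classifying irreducible representations. The
Jacobi-Trudi determinant makes `s_μ` a difference of two permutation modules. It has norm one, and a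
positive coefficient of `s_μ` fixes the sign. Cancelling common summands then leaves an honest
module, and homomorphisms out of it form a space that is monotone in the target
(`homDim_add_le_of_norm_one`). Orthonormality and the positive coefficient both come from `a_δ s_μ =
a_{μ+δ}` (`alternantSeries_staircase`). -/

/-! ### Coefficients of the complete and elementary symmetric functions -/

/-- The weight `∑ₖ k mₖ` of an exponent vector. -/
abbrev wt (u : ℕ+ →₀ ℕ) : ℕ := Finsupp.weight (fun k : ℕ+ => (k : ℕ)) u

/-- The symmetric functions that are homogeneous of degree `m`. -/
abbrev homog (m : ℕ) : Submodule ℚ SymFun :=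
  MvPolynomial.weightedHomogeneousSubmodule ℚ (fun k : ℕ+ => (k : ℕ)) m

theorem mem_homog {m : ℕ} {F : SymFun} : F ∈ homog m ↔ ∀ u, F.coeff u ≠ 0 → wt u = m := by
  rw [MvPolynomial.mem_weightedHomogeneousSubmodule]
  rfl

theorem wt_single (k : ℕ+) (r : ℕ) : wt (Finsupp.single k r) = r * k := by
  simp [wt, Finsupp.weight_single]

theorem exponent_zero : exponent 0 = 0 := by simp [exponent]

theorem exponent_add (s t : Multiset ℕ) : exponent (s + t) = exponent s + exponent t := by
  simp [exponent]

theorem exponent_cons (a : ℕ) (s : Multiset ℕ) :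
    exponent (a ::ₘ s) = Finsupp.single a.toPNat' 1 + exponent s := by
  rw [← Multiset.singleton_add, exponent_add]
  simp [exponent]

theorem wt_exponent (s : Multiset ℕ) (hs : ∀ i ∈ s, 0 < i) : wt (exponent s) = s.sum := by
  induction s using Multiset.induction with
  | empty => simp [exponent_zero]
  | cons a s ih =>
    have h := ih fun i hi => hs i (Multiset.mem_cons_of_mem hi)
    have ha := hs a (Multiset.mem_cons_self a s)
    rw [exponent_cons, wt, map_add, ← wt, ← wt, h, wt_single, Multiset.sum_cons, one_mul,
      Nat.toPNat'_coe, if_pos ha]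

theorem wt_exponent_parts {k : ℕ} (l : k.Partition) : wt (exponent l.parts) = k := by
  rw [wt_exponent _ fun i hi => l.parts_pos hi, l.parts_sum]

/-- The partition with a given exponent vector. -/
def partitionOf {k : ℕ} (u : ℕ+ →₀ ℕ) (h : wt u = k) : k.Partition where
  parts := (Finsupp.toMultiset u).map (fun i : ℕ+ => (i : ℕ))
  parts_pos := by
    intro i hi
    obtain ⟨j, -, rfl⟩ := Multiset.mem_map.1 hi
    exact j.pos
  parts_sum := by
    rw [← h, wt, Finsupp.weight_apply, Finsupp.toMultiset_apply, Finsupp.sum, Finsupp.sum,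
      ← Multiset.coe_mapAddMonoidHom, map_sum, ← Multiset.coe_sumAddMonoidHom, map_sum]
    simp [Multiset.map_nsmul, Multiset.sum_nsmul]

theorem exponent_partitionOf {k : ℕ} (u : ℕ+ →₀ ℕ) (h : wt u = k) :
    exponent (partitionOf u h).parts = u := by
  rw [exponent, partitionOf, Multiset.map_map]
  simp

theorem exponent_parts_injective {k : ℕ} :
    Function.Injective fun l : k.Partition => exponent l.parts := by
  intro l l' h
  have h1 : l.parts.map Nat.toPNat' = l'.parts.map Nat.toPNat' :=
    Multiset.toFinsupp.injective h
  have h2 : ∀ l : k.Partition, (l.parts.map Nat.toPNat').map (fun i : ℕ+ => (i : ℕ)) = l.parts := by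
    intro l
    rw [Multiset.map_map]
    conv_rhs => rw [← Multiset.map_id l.parts]
    refine Multiset.map_congr rfl fun i hi => ?_
    simp [l.parts_pos hi]
  exact Nat.Partition.ext (by rw [← h2 l, h1, h2])

theorem coeff_powerSum (s : Multiset ℕ) (u : ℕ+ →₀ ℕ) :
    (powerSum s).coeff u = if exponent s = u then 1 else 0 := by
  rw [powerSum, MvPolynomial.coeff_monomial]

theorem powerSum_add (s t : Multiset ℕ) : powerSum (s + t) = powerSum s * powerSum t := by
  simp [powerSum, exponent_add, MvPolynomial.monomial_mul]

theorem coeff_sum_powerSum {k : ℕ} (c : k.Partition → ℚ) (u : ℕ+ →₀ ℕ) :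
    (∑ l : k.Partition, c l • powerSum l.parts).coeff u
      = if h : wt u = k then c (partitionOf u h) else 0 := by
  rw [MvPolynomial.coeff_sum]
  split_ifs with h
  · rw [Finset.sum_eq_single (partitionOf u h)]
    · simp [coeff_powerSum, exponent_partitionOf]
    · intro l _ hl
      rw [MvPolynomial.coeff_smul, coeff_powerSum, if_neg, smul_zero]
      intro h1
      refine hl (exponent_parts_injective ?_)
      simp only [exponent_partitionOf, h1]
    · simp
  · refine Finset.sum_eq_zero fun l _ => ?_
    rw [MvPolynomial.coeff_smul, coeff_powerSum, if_neg, smul_zero]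
    rintro rfl
    exact h (wt_exponent_parts l)

theorem coeff_complete (k : ℕ) (u : ℕ+ →₀ ℕ) :
    (complete k).coeff u = if wt u = k then (zee u)⁻¹ else 0 := by
  rw [complete, coeff_sum_powerSum]
  split_ifs
  · rw [exponent_partitionOf]
  · rfl

theorem card_partitionOf {k : ℕ} (u : ℕ+ →₀ ℕ) (h : wt u = k) :
    Multiset.card (partitionOf u h).parts = u.degree := by
  rw [partitionOf, Multiset.card_map, Finsupp.card_toMultiset, Finsupp.degree_apply]
  rfl

theorem degree_le_wt (u : ℕ+ →₀ ℕ) : u.degree ≤ wt u := by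
  rw [Finsupp.degree_apply, wt, Finsupp.weight_apply, Finsupp.sum]
  exact Finset.sum_le_sum fun i _ => Nat.le_mul_of_pos_right _ i.pos

/-- The sign has exponent `k + u.degree`, of the same parity as the truncated difference in
`elementary` because of `degree_le_wt`, and easier to manipulate. -/
theorem coeff_elementary (k : ℕ) (u : ℕ+ →₀ ℕ) :
    (elementary k).coeff u = if wt u = k then (-1) ^ (k + u.degree) * (zee u)⁻¹ else 0 := by
  rw [elementary, coeff_sum_powerSum]
  split_ifs with h
  · rw [exponent_partitionOf, card_partitionOf]
    congr 1
    have h1 : u.degree ≤ k := h ▸ degree_le_wt u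
    rw [show k + u.degree = (k - u.degree) + 2 * u.degree by omega, pow_add, pow_mul]
    simp
  · rfl

theorem complete_mem_homog (k : ℕ) : complete k ∈ homog k := by
  rw [mem_homog]
  intro u hu
  rw [coeff_complete] at hu
  by_contra h
  exact hu (if_neg h)

theorem elementary_mem_homog (k : ℕ) : elementary k ∈ homog k := by
  rw [mem_homog]
  intro u hu
  rw [coeff_elementary] at hu
  by_contra h
  exact hu (if_neg h)

theorem powerSum_mem_homog {k : ℕ} (l : k.Partition) : powerSum l.parts ∈ homog k := by
  rw [mem_homog]
  intro u hu
  rw [coeff_powerSum] at hu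
  by_contra h
  refine hu (if_neg ?_)
  rintro rfl
  exact h (wt_exponent_parts l)

theorem wt_eq_zero {u : ℕ+ →₀ ℕ} : wt u = 0 ↔ u = 0 := by
  constructor
  · intro h
    have := degree_le_wt u
    exact (Finsupp.degree_eq_zero_iff u).1 (by omega)
  · rintro rfl; simp

theorem complete_zero : complete 0 = 1 := by
  ext u
  rw [coeff_complete, MvPolynomial.coeff_one]
  by_cases h : u = 0
  · subst h; simp [zee]
  · rw [if_neg (by rwa [wt_eq_zero]), if_neg (Ne.symm h)]

theorem elementary_zero : elementary 0 = 1 := by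
  ext u
  rw [coeff_elementary, MvPolynomial.coeff_one]
  by_cases h : u = 0
  · subst h; simp [zee]
  · rw [if_neg (by rwa [wt_eq_zero]), if_neg (Ne.symm h)]

/-! ### The derivations `k ∂ / ∂ p_k` -/

/-- This ratio is what makes `j ∂/∂p_j` the Hall adjoint of multiplication by `p_j`; see
`hall_X_mul`. -/
theorem zee_add_single (u : ℕ+ →₀ ℕ) (j : ℕ+) :
    zee (u + Finsupp.single j 1) = j * (u j + 1) * zee u := by
  classical
  have h : ∀ v : ℕ+ →₀ ℕ, v.support ⊆ insert j u.support →
      zee v = ∏ k ∈ insert j u.support, (k : ℚ) ^ v k * ((v k).factorial : ℚ) := by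
    intro v hv
    exact Finsupp.prod_of_support_subset v hv _ (by simp)
  rw [h u (Finset.subset_insert _ _), h (u + Finsupp.single j 1),
    ← Finset.mul_prod_erase _ _ (Finset.mem_insert_self j u.support),
    ← Finset.mul_prod_erase _ _ (Finset.mem_insert_self j u.support)]
  · have h2 : ∀ k ∈ (insert j u.support).erase j,
        ((k : ℕ) : ℚ) ^ (u + Finsupp.single j 1 : ℕ+ →₀ ℕ) k * (((u + Finsupp.single j 1 : ℕ+ →₀ ℕ) k).factorial : ℚ)
          = (k : ℚ) ^ u k * ((u k).factorial : ℚ) := by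
      intro k hk
      rw [Finsupp.add_apply, Finsupp.single_eq_of_ne (Finset.ne_of_mem_erase hk), add_zero]
    rw [Finset.prod_congr rfl h2]
    simp only [Finsupp.add_apply, Finsupp.single_eq_same, Nat.factorial_succ]
    push_cast
    ring
  · intro k hk
    by_cases hkj : k = j
    · simp [hkj]
    · rw [Finsupp.mem_support_iff, Finsupp.add_apply, Finsupp.single_eq_of_ne hkj] at hk
      simpa [hkj] using hk

/-- The derivation `j ∂ / ∂ p_j`. -/
def pderivScaled (j : ℕ+) : Derivation ℚ SymFun SymFun := (j : ℚ) • MvPolynomial.pderiv j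

theorem coeff_pderivScaled (j : ℕ+) (F : SymFun) (u : ℕ+ →₀ ℕ) :
    (pderivScaled j F).coeff u = j * (u j + 1) * F.coeff (u + Finsupp.single j 1) := by
  rw [pderivScaled, Derivation.smul_apply, MvPolynomial.coeff_smul, MvPolynomial.coeff_pderiv,
    smul_eq_mul]
  ring

theorem wt_add_single (u : ℕ+ →₀ ℕ) (j : ℕ+) : wt (u + Finsupp.single j 1) = wt u + j := by
  rw [wt, map_add, ← wt, ← wt, wt_single, one_mul]

theorem pderivScaled_complete (j : ℕ+) (k : ℕ) :
    pderivScaled j (complete k) = if (j : ℕ) ≤ k then complete (k - j) else 0 := by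
  ext u
  rw [coeff_pderivScaled, coeff_complete, wt_add_single, zee_add_single]
  have h0 : ((j : ℕ) : ℚ) ≠ 0 := by exact_mod_cast j.ne_zero
  have h1 : ((u j : ℕ) : ℚ) + 1 ≠ 0 := by positivity
  have h2 := zee_ne_zero u
  split_ifs with h3 h4 h4
  · rw [coeff_complete, if_pos (by omega)]
    field_simp
  · omega
  · rw [coeff_complete, if_neg (by omega), mul_zero]
  · simp

theorem pderivScaled_elementary (j : ℕ+) (k : ℕ) :
    pderivScaled j (elementary k)
      = if (j : ℕ) ≤ k then (-1 : ℚ) ^ ((j : ℕ) + 1) • elementary (k - j) else 0 := by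
  ext u
  rw [coeff_pderivScaled, coeff_elementary, wt_add_single, zee_add_single]
  have h0 : ((j : ℕ) : ℚ) ≠ 0 := by exact_mod_cast j.ne_zero
  have h1 : ((u j : ℕ) : ℚ) + 1 ≠ 0 := by positivity
  have h2 := zee_ne_zero u
  have h5 : (u + Finsupp.single j 1).degree = u.degree + 1 := by
    rw [map_add, Finsupp.degree_single]
  split_ifs with h3 h4 h4
  · rw [MvPolynomial.coeff_smul, coeff_elementary, if_pos (by omega), h5, smul_eq_mul,
      show k + (u.degree + 1) = ((j : ℕ) + 1 + (k - j + u.degree)) by omega, pow_add]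
    field_simp
  · omega
  · rw [MvPolynomial.coeff_smul, coeff_elementary, if_neg (by omega), smul_zero, mul_zero]
  · simp

/-! ### The Hall scalar product -/

theorem hall_apply (F G : SymFun) : hall F G = ∑ u ∈ F.support, F.coeff u * (zee u * G.coeff u) := by
  conv_lhs => rw [F.as_sum]
  rw [map_sum, LinearMap.sum_apply]
  exact Finset.sum_congr rfl fun u _ => hall_monomial _ _ _

theorem hall_monomial_right (m : ℕ+ →₀ ℕ) (c : ℚ) (F : SymFun) :
    hall F (MvPolynomial.monomial m c) = c * (zee m * F.coeff m) := by
  rw [hall_apply, Finset.sum_eq_single m]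
  · simp; ring
  · intro u _ hu
    rw [MvPolynomial.coeff_monomial, if_neg (Ne.symm hu)]; simp
  · intro h
    rw [MvPolynomial.notMem_support_iff.1 h]; simp

theorem hall_comm (F G : SymFun) : hall F G = hall G F := by
  induction F using MvPolynomial.induction_on' with
  | monomial u a => rw [hall_monomial, hall_monomial_right]
  | add p q hp hq => rw [map_add, LinearMap.add_apply, hp, hq, map_add]

theorem hall_nondegenerate {F : SymFun} (h : ∀ G, hall F G = 0) : F = 0 := by
  ext u
  have h1 := h (MvPolynomial.monomial u 1)
  rw [hall_monomial_right, one_mul] at h1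
  simpa [zee_ne_zero u] using h1

theorem hall_X_mul (j : ℕ+) (F G : SymFun) :
    hall (MvPolynomial.X j * F) G = hall F (pderivScaled j G) := by
  induction F using MvPolynomial.induction_on' with
  | monomial u a =>
    rw [hall_monomial, coeff_pderivScaled, MvPolynomial.X, MvPolynomial.monomial_mul, hall_monomial,
      add_comm, zee_add_single]
    ring
  | add p q hp hq => rw [mul_add, map_add, LinearMap.add_apply, hp, hq, map_add, LinearMap.add_apply]

theorem hall_eq_zero_of_ne {m k : ℕ} (h : m ≠ k) {F G : SymFun} (hF : F ∈ homog m)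
    (hG : G ∈ homog k) : hall F G = 0 := by
  rw [mem_homog] at hF hG
  rw [hall_apply]
  refine Finset.sum_eq_zero fun u hu => ?_
  have h1 := hF u (MvPolynomial.mem_support_iff.1 hu)
  by_cases h2 : G.coeff u = 0
  · simp [h2]
  · exact absurd (h1.symm.trans (hG u h2)) h

/-! ### Newton's identities -/

/-- The generating series of the power sums `∑ₖ p_{k+1} tᵏ`. -/
def powerSeries : PowerSeries SymFun := PowerSeries.mk fun k => MvPolynomial.X k.succPNat

/-- Euler's identity: `∑_j p_j · j ∂/∂p_j` multiplies a function of degree `k + 1` by `k + 1`, and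
`hf` replaces each derivative of `f (k + 1)` by a multiple of an earlier `f`. The scalars `c` treat
the `h_k` and the `e_k` at once. -/
theorem newton {f : ℕ → SymFun} {c : ℕ+ → ℚ} (hw : ∀ k, f k ∈ homog k)
    (hf : ∀ (j : ℕ+) k, pderivScaled j (f k) = if (j : ℕ) ≤ k then c j • f (k - j) else 0) (k : ℕ) :
    ((k + 1 : ℕ) : ℚ) • f (k + 1) = ∑ p ∈ Finset.HasAntidiagonal.antidiagonal k,
      (c p.1.succPNat • MvPolynomial.X p.1.succPNat) * f p.2 := by
  ext u
  rw [MvPolynomial.coeff_smul, MvPolynomial.coeff_sum, smul_eq_mul]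
  by_cases hu : wt u = k + 1
  · have key : ∀ j : ℕ+, ((j : ℕ) ≤ k + 1) →
        ((c j • MvPolynomial.X j) * f (k + 1 - j)).coeff u = (j : ℕ) * (u j) * (f (k + 1)).coeff u := by
      intro j hj
      have h1 := hf j (k + 1)
      rw [if_pos hj] at h1
      rw [smul_mul_assoc, ← mul_smul_comm, ← h1, MvPolynomial.coeff_X_mul']
      split_ifs with h2
      · rw [coeff_pderivScaled]
        have h3 : 1 ≤ u j := Nat.one_le_iff_ne_zero.2 (Finsupp.mem_support_iff.1 h2)
        have h4 : u - Finsupp.single j 1 + Finsupp.single j 1 = u :=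
          tsub_add_cancel_of_le (by simpa using h3)
        rw [h4, Finsupp.tsub_apply, Finsupp.single_eq_same, Nat.cast_sub h3]
        push_cast; ring
      · rw [Finsupp.notMem_support_iff.1 h2]; simp
    have h5 : ∑ p ∈ Finset.HasAntidiagonal.antidiagonal k,
        ((c p.1.succPNat • MvPolynomial.X p.1.succPNat) * f p.2).coeff u
        = ∑ p ∈ Finset.HasAntidiagonal.antidiagonal k,
          ((p.1.succPNat : ℕ) : ℚ) * (u p.1.succPNat) * (f (k + 1)).coeff u := by
      refine Finset.sum_congr rfl fun p hp => ?_
      rw [Finset.HasAntidiagonal.mem_antidiagonal] at hp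
      rw [← key _ (by rw [Nat.succPNat_coe]; omega)]
      congr 3
      rw [Nat.succPNat_coe]; omega
    rw [h5, ← Finset.sum_mul, Finset.Nat.sum_antidiagonal_eq_sum_range_succ_mk]
    congr 1
    rw [← hu, wt, Finsupp.weight_apply, Finsupp.sum]
    push_cast
    refine Finset.sum_of_injOn PNat.natPred (PNat.natPred_injective.injOn) ?_ ?_ ?_
    · intro j hj
      have h6 : u j * (j : ℕ) ≤ wt u := by
        rw [wt, Finsupp.weight_apply, Finsupp.sum]
        exact Finset.single_le_sum (f := fun i : ℕ+ => u i • (i : ℕ)) (fun _ _ => Nat.zero_le _) hj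
      have h7 : 1 ≤ u j := Nat.one_le_iff_ne_zero.2 (Finsupp.mem_support_iff.1 hj)
      have h8 : (j : ℕ) ≤ u j * j := Nat.le_mul_of_pos_left _ h7
      have h9 := PNat.natPred_add_one j
      simp only [Finset.coe_range, Set.mem_Iio]
      omega
    · intro i hi hi'
      have : u i.succPNat = 0 := by
        by_contra h
        exact hi' ⟨i.succPNat, Finsupp.mem_support_iff.2 h, Nat.natPred_succPNat i⟩
      simp [this]
    · intro j _
      simp only [PNat.succPNat_natPred]
      simp; ring
  · have h1 : (f (k + 1)).coeff u = 0 := by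
      by_contra h; exact hu (mem_homog.1 (hw _) u h)
    rw [h1, mul_zero]
    symm
    refine Finset.sum_eq_zero fun p hp => ?_
    rw [Finset.HasAntidiagonal.mem_antidiagonal] at hp
    rw [smul_mul_assoc, MvPolynomial.coeff_smul, MvPolynomial.coeff_X_mul']
    split_ifs with h2
    · have h3 : 1 ≤ u p.1.succPNat := Nat.one_le_iff_ne_zero.2 (Finsupp.mem_support_iff.1 h2)
      have h4 : u - Finsupp.single p.1.succPNat 1 + Finsupp.single p.1.succPNat 1 = u :=
        tsub_add_cancel_of_le (by simpa using h3)
      have h5 : (f p.2).coeff (u - Finsupp.single p.1.succPNat 1) = 0 := by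
        by_contra h
        have h6 := mem_homog.1 (hw _) _ h
        have h7 := wt_add_single (u - Finsupp.single p.1.succPNat 1) p.1.succPNat
        rw [h4, h6, Nat.succPNat_coe] at h7
        omega
      rw [h5, smul_zero]
    · simp

theorem newton_complete (k : ℕ) :
    ((k + 1 : ℕ) : ℚ) • complete (k + 1) = ∑ p ∈ Finset.HasAntidiagonal.antidiagonal k,
      MvPolynomial.X p.1.succPNat * complete p.2 := by
  simpa using newton (c := fun _ => 1) complete_mem_homog (by simpa using pderivScaled_complete) k

theorem newton_elementary (k : ℕ) :
    ((k + 1 : ℕ) : ℚ) • elementary (k + 1) = ∑ p ∈ Finset.HasAntidiagonal.antidiagonal k,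
      ((-1 : ℚ) ^ p.1 • MvPolynomial.X p.1.succPNat) * elementary p.2 := by
  rw [newton (c := fun j => (-1 : ℚ) ^ ((j : ℕ) + 1)) elementary_mem_homog pderivScaled_elementary k]
  refine Finset.sum_congr rfl fun p _ => ?_
  simp [pow_succ]

/-- The generating series `H(t) = ∑ₖ h_k tᵏ`. -/
def completeSeries : PowerSeries SymFun := PowerSeries.mk complete

/-- The generating series `E(-t) = ∑ₖ (-1)ᵏ e_k tᵏ`. -/
def elementarySeries : PowerSeries SymFun := PowerSeries.mk fun k => (-1 : ℚ) ^ k • elementary k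

theorem derivative_completeSeries :
    PowerSeries.derivative SymFun completeSeries = powerSeries * completeSeries := by
  ext1 k
  rw [PowerSeries.coeff_derivative, PowerSeries.coeff_mul, completeSeries, PowerSeries.coeff_mk,
    mul_comm]
  have := newton_complete k
  rw [MvPolynomial.smul_eq_C_mul] at this
  simp only [powerSeries, PowerSeries.coeff_mk]
  rw [← this]
  simp

theorem derivative_elementarySeries :
    PowerSeries.derivative SymFun elementarySeries = - (powerSeries * elementarySeries) := by
  ext1 k
  rw [PowerSeries.coeff_derivative, map_neg, PowerSeries.coeff_mul, elementarySeries,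
    PowerSeries.coeff_mk, mul_comm]
  have := congrArg (fun F => (-1 : ℚ) ^ (k + 1) • F) (newton_elementary k)
  simp only [powerSeries, PowerSeries.coeff_mk]
  rw [smul_comm, Finset.smul_sum, MvPolynomial.smul_eq_C_mul] at this
  simp only [Nat.cast_add, Nat.cast_one, map_add, map_natCast, map_one] at this
  rw [this, ← Finset.sum_neg_distrib]
  refine Finset.sum_congr rfl fun p hp => ?_
  rw [Finset.HasAntidiagonal.mem_antidiagonal] at hp
  rw [mul_smul_comm, smul_mul_assoc, smul_smul, ← neg_smul, ← pow_add]
  congr 1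
  rw [show k + 1 + p.1 = p.2 + 1 + 2 * p.1 by omega, pow_add, pow_mul, pow_succ]
  simp

/-- The two factors have opposite logarithmic derivatives, so the product is constant, and its
constant term is 1. -/
theorem completeSeries_mul_elementarySeries : completeSeries * elementarySeries = 1 := by
  apply PowerSeries.derivative.ext
  · rw [Derivation.leibniz, derivative_completeSeries, derivative_elementarySeries,
      PowerSeries.derivative_one, smul_eq_mul, smul_eq_mul]
    ring
  · simp [completeSeries, elementarySeries, complete_zero, elementary_zero]

/-- Newton's identity is solved for `p_{k+1}`: it occurs only in the term `(k, 0)`, with the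
non-zero coefficient `c k`. -/
theorem X_mem_adjoin {f : ℕ → SymFun} {c : ℕ → ℚ} (hc : ∀ k, c k ≠ 0) (h0 : f 0 = 1)
    (hf : ∀ k, ((k + 1 : ℕ) : ℚ) • f (k + 1) = ∑ p ∈ Finset.HasAntidiagonal.antidiagonal k,
      (c p.1 • MvPolynomial.X p.1.succPNat) * f p.2) (k : ℕ) :
    (MvPolynomial.X k.succPNat : SymFun) ∈ Algebra.adjoin ℚ (Set.range fun k : ℕ => f (k + 1)) := by
  induction k using Nat.strong_induction_on with
  | _ k ih =>
  have hmem : ∀ k, f k ∈ Algebra.adjoin ℚ (Set.range fun k : ℕ => f (k + 1)) := by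
    intro k
    cases k with
    | zero => rw [h0]; exact one_mem _
    | succ k => exact Algebra.subset_adjoin ⟨k, rfl⟩
  have h1 := hf k
  rw [← Finset.add_sum_erase _ _ (show (k, 0) ∈ Finset.HasAntidiagonal.antidiagonal k by simp), h0, mul_one,
    ← sub_eq_iff_eq_add] at h1
  have h2 : (MvPolynomial.X k.succPNat : SymFun) = (c k)⁻¹ • (c k • MvPolynomial.X k.succPNat) := by
    rw [smul_smul, inv_mul_cancel₀ (hc k), one_smul]
  rw [h2, ← h1]
  refine Subalgebra.smul_mem _ (Subalgebra.sub_mem _ (Subalgebra.smul_mem _ (hmem _) _) ?_) _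
  refine Subalgebra.sum_mem _ fun p hp => ?_
  rw [Finset.mem_erase, Finset.HasAntidiagonal.mem_antidiagonal] at hp
  refine Subalgebra.mul_mem _ (Subalgebra.smul_mem _ (ih _ ?_) _) (hmem _)
  rcases Nat.eq_zero_or_pos p.2 with h | h
  · exact absurd (Prod.ext (by simp; omega) h) hp.1
  · omega

theorem adjoin_eq_top {f : ℕ → SymFun} {c : ℕ → ℚ} (hc : ∀ k, c k ≠ 0) (h0 : f 0 = 1)
    (hf : ∀ k, ((k + 1 : ℕ) : ℚ) • f (k + 1) = ∑ p ∈ Finset.HasAntidiagonal.antidiagonal k,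
      (c p.1 • MvPolynomial.X p.1.succPNat) * f p.2) :
    Algebra.adjoin ℚ (Set.range fun k : ℕ => f (k + 1)) = ⊤ := by
  rw [eq_top_iff, ← MvPolynomial.adjoin_range_X, Algebra.adjoin_le_iff]
  rintro _ ⟨k, rfl⟩
  rw [← PNat.succPNat_natPred k]
  exact X_mem_adjoin hc h0 hf _

theorem span_prod_eq_top {f : ℕ → SymFun} {c : ℕ → ℚ} (hc : ∀ k, c k ≠ 0) (h0 : f 0 = 1)
    (hf : ∀ k, ((k + 1 : ℕ) : ℚ) • f (k + 1) = ∑ p ∈ Finset.HasAntidiagonal.antidiagonal k,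
      (c p.1 • MvPolynomial.X p.1.succPNat) * f p.2) :
    Submodule.span ℚ {F | ∃ s : Multiset ℕ, (∀ i ∈ s, 0 < i) ∧ F = (s.map f).prod} = ⊤ := by
  rw [eq_top_iff, ← Algebra.top_toSubmodule, ← adjoin_eq_top hc h0 hf, Algebra.adjoin_eq_span]
  refine Submodule.span_mono ?_
  intro F hF
  induction hF using Submonoid.closure_induction with
  | mem x hx =>
    obtain ⟨k, rfl⟩ := hx
    exact ⟨{k + 1}, by simp, by simp⟩
  | one => exact ⟨0, by simp, by simp⟩
  | mul x y _ _ hx hy =>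
    obtain ⟨s, hs, rfl⟩ := hx
    obtain ⟨t, ht, rfl⟩ := hy
    refine ⟨s + t, fun i hi => ?_, by simp⟩
    rcases Multiset.mem_add.1 hi with h | h
    exacts [hs i h, ht i h]

/-! ### Expansions in variables, and duality with the complete symmetric functions -/

/-- The power sum `∑ᵢ qᵢᵏ`, as a power series. -/
def psumSeries (ι : Type) (k : ℕ+) : MvPowerSeries ι ℚ := fun d : ι →₀ ℕ =>
  open Classical in if ∃ i, d = Finsupp.single i (k : ℕ) then (1 : ℚ) else 0

/-- The expansion of a symmetric function in the variables indexed by `ι`. -/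
def seriesOn (ι : Type) : SymFun →ₐ[ℚ] MvPowerSeries ι ℚ := MvPolynomial.aeval (psumSeries ι)

theorem toSeries_eq : toSeries = seriesOn ℕ := rfl

section Series

variable {ι : Type} [DecidableEq ι]

omit [DecidableEq ι] in
theorem coeff_seriesOn_X (k : ℕ+) (d : ι →₀ ℕ) :
    MvPowerSeries.coeff d (seriesOn ι (MvPolynomial.X k))
      = open Classical in if ∃ i, d = Finsupp.single i (k : ℕ) then (1 : ℚ) else 0 := by
  rw [seriesOn, MvPolynomial.aeval_X]
  rfl

theorem coeff_seriesOn_X_mul (k : ℕ+) (F : SymFun) (d : ι →₀ ℕ) (s : Finset ι)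
    (hs : d.support ⊆ s) :
    MvPowerSeries.coeff d (seriesOn ι (MvPolynomial.X k * F)) = ∑ i ∈ s,
      if (k : ℕ) ≤ d i then
        MvPowerSeries.coeff (d - Finsupp.single i (k : ℕ)) (seriesOn ι F) else 0 := by
  classical
  rw [map_mul, MvPowerSeries.coeff_mul, ← Finset.sum_filter]
  symm
  refine Finset.sum_of_injOn (fun i => (Finsupp.single i (k : ℕ), d - Finsupp.single i (k : ℕ)))
    ?_ ?_ ?_ ?_
  · intro i _ j _ h
    exact (Finsupp.single_left_inj k.ne_zero).1 (Prod.ext_iff.1 h).1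
  · intro i hi
    rw [Finset.mem_coe, Finset.mem_filter] at hi
    rw [Finset.mem_coe, Finset.HasAntidiagonal.mem_antidiagonal]
    exact add_tsub_cancel_of_le (Finsupp.single_le_iff.2 hi.2)
  · intro p hp hp'
    rw [Finset.HasAntidiagonal.mem_antidiagonal] at hp
    rw [coeff_seriesOn_X, if_neg, zero_mul]
    rintro ⟨i, hi⟩
    refine hp' ⟨i, ?_, ?_⟩
    · have h1 : (k : ℕ) ≤ d i := by
        rw [← hp, hi, Finsupp.add_apply, Finsupp.single_eq_same]; omega
      rw [Finset.mem_coe, Finset.mem_filter]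
      refine ⟨hs (Finsupp.mem_support_iff.2 ?_), h1⟩
      have := k.pos
      omega
    · refine Prod.ext hi.symm ?_
      simp only
      rw [← hi, ← hp, add_tsub_cancel_left]
  · intro i hi
    rw [coeff_seriesOn_X, if_pos ⟨i, rfl⟩, one_mul]

/-- The product `∏ᵢ h_{dᵢ}`. -/
def completeProd (d : ι →₀ ℕ) : SymFun := d.prod fun _ k => complete k

omit [DecidableEq ι] in
theorem completeProd_eq (d : ι →₀ ℕ) (s : Finset ι) (hs : d.support ⊆ s) :
    completeProd d = ∏ i ∈ s, complete (d i) :=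
  Finsupp.prod_of_support_subset d hs _ fun _ _ => complete_zero

theorem derivation_prod {R A : Type*} [CommRing R] [CommRing A] [Algebra R A] (D : Derivation R A A)
    (s : Finset ι) (f : ι → A) :
    D (∏ i ∈ s, f i) = ∑ i ∈ s, D (f i) * ∏ j ∈ s.erase i, f j := by
  induction s using Finset.induction_on with
  | empty => simp
  | insert a s ha ih =>
    rw [Finset.prod_insert ha, Derivation.leibniz, ih, Finset.sum_insert ha,
      Finset.erase_insert ha, smul_eq_mul, smul_eq_mul, Finset.mul_sum, add_comm, mul_comm]
    congr 1
    refine Finset.sum_congr rfl fun i hi => ?_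
    have hia : i ≠ a := fun h => ha (h ▸ hi)
    rw [Finset.erase_insert_of_ne hia.symm, Finset.prod_insert fun h => ha (Finset.mem_of_mem_erase h)]
    ring

theorem pderivScaled_completeProd (j : ℕ+) (d : ι →₀ ℕ) :
    pderivScaled j (completeProd d) = ∑ i ∈ d.support,
      if (j : ℕ) ≤ d i then completeProd (d - Finsupp.single i (j : ℕ)) else 0 := by
  rw [completeProd_eq d _ subset_rfl, derivation_prod]
  refine Finset.sum_congr rfl fun i hi => ?_
  rw [pderivScaled_complete]
  split_ifs with h
  · rw [completeProd_eq (d - Finsupp.single i (j : ℕ)) d.support,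
      ← Finset.mul_prod_erase _ _ hi]
    · congr 1
      · simp
      · refine Finset.prod_congr rfl fun k hk => ?_
        rw [Finsupp.tsub_apply, Finsupp.single_eq_of_ne (Finset.ne_of_mem_erase hk), tsub_zero]
    · exact Finsupp.support_tsub
  · rw [zero_mul]

/-- The products of complete symmetric functions are dual to the monomial ones. -/
theorem hall_completeProd (F : SymFun) (d : ι →₀ ℕ) :
    hall F (completeProd d) = MvPowerSeries.coeff d (seriesOn ι F) := by
  induction F using MvPolynomial.induction_on generalizing d with
  | C a =>
    have h1 : (completeProd d).coeff 0 = if d = 0 then 1 else 0 := by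
      have h2 : ∀ k, MvPolynomial.constantCoeff (complete k) = if k = 0 then 1 else 0 := by
        intro k
        rw [MvPolynomial.constantCoeff_eq, coeff_complete]
        simp [zee, eq_comm]
      rw [← MvPolynomial.constantCoeff_eq, completeProd, Finsupp.prod, map_prod]
      split_ifs with h
      · subst h; simp
      · obtain ⟨i, hi⟩ := Finsupp.support_nonempty_iff.2 h
        refine Finset.prod_eq_zero hi ?_
        rw [h2, if_neg (Finsupp.mem_support_iff.1 hi)]
    rw [MvPolynomial.C_apply, hall_monomial, h1, ← MvPolynomial.C_apply,
      ← MvPolynomial.algebraMap_eq, AlgHom.commutes, MvPowerSeries.algebraMap_apply,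
      MvPowerSeries.coeff_C]
    simp [zee]
  | add p q hp hq => rw [map_add, LinearMap.add_apply, hp, hq, map_add, map_add]
  | mul_X p j ih =>
    -- Both sides obey the same recursion: a factor `p_j` lowers one of the `d_i` by `j`, through
    -- the adjoint derivation on the left and through `p_j = ∑ q_i ^ j` on the right.
    rw [mul_comm, hall_X_mul, pderivScaled_completeProd, map_sum,
      coeff_seriesOn_X_mul j p d _ subset_rfl]
    refine Finset.sum_congr rfl fun i _ => ?_
    split_ifs
    · exact ih _
    · simp

end Series

/-- Each part receives a variable of its own, which is possible as there are infinitely many. -/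
theorem exists_completeProd (s : Multiset ℕ) :
    ∃ d : ℕ →₀ ℕ, (s.map complete).prod = completeProd d := by
  induction s using Multiset.induction with
  | empty => exact ⟨0, by simp [completeProd]⟩
  | cons a s ih =>
    obtain ⟨d, hd⟩ := ih
    obtain ⟨i, hi⟩ := Infinite.exists_notMem_finset d.support
    refine ⟨Finsupp.single i a + d, ?_⟩
    rw [Multiset.map_cons, Multiset.prod_cons, hd]
    unfold completeProd
    rw [Finsupp.prod_add_index_of_disjoint, Finsupp.prod_single_index complete_zero]
    refine Finset.disjoint_left.2 fun k hk hk' => hi ?_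
    rwa [Finset.mem_singleton.1 (Finsupp.support_single_subset hk)] at hk'

theorem span_complete_eq_top :
    Submodule.span ℚ {F | ∃ s : Multiset ℕ, (∀ i ∈ s, 0 < i) ∧ F = (s.map complete).prod} = ⊤ := by
  refine span_prod_eq_top (c := fun _ => 1) (fun _ => one_ne_zero) complete_zero fun k => ?_
  rw [newton_complete]
  simp

/-- The coefficients of the expansion are the pairings with products of the `h_k`; these span, and
the Hall product is non-degenerate. -/
theorem toSeries_injective : Function.Injective toSeries := by
  rw [injective_iff_map_eq_zero]
  intro F hF
  refine hall_nondegenerate fun G => ?_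
  have hG : G ∈ (⊤ : Submodule ℚ SymFun) := trivial
  rw [← span_complete_eq_top] at hG
  induction hG using Submodule.span_induction with
  | mem x hx =>
    obtain ⟨s, -, rfl⟩ := hx
    obtain ⟨d, hd⟩ := exists_completeProd s
    rw [hd, hall_completeProd, ← toSeries_eq, hF, map_zero]
  | zero => simp
  | add x y _ _ hx hy => rw [map_add, hx, hy, add_zero]
  | smul c x _ hx => rw [map_smul, hx, smul_zero]

/-! ### Coefficients of tensors -/

/-- The contraction of a tensor with a linear form on its right factor. -/
def contract (φ : SymFun →ₗ[ℚ] ℚ) : SymFun ⊗[ℚ] SymFun →ₗ[ℚ] SymFun :=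
  (TensorProduct.rid ℚ SymFun).toLinearMap ∘ₗ LinearMap.lTensor SymFun φ

@[simp]
theorem contract_tmul (φ : SymFun →ₗ[ℚ] ℚ) (f g : SymFun) : contract φ (f ⊗ₜ g) = φ g • f := by
  simp [contract]

theorem qCoeff_tmul (d : ℕ →₀ ℕ) (f g : SymFun) :
    qCoeff d (f ⊗ₜ g) = MvPowerSeries.coeff d (toSeries f) • g := by
  simp [qCoeff]

/-- Contracting the `𝐳` side commutes with extracting a coefficient in `𝐪`, which reduces questions
on tensors to single symmetric functions. -/
theorem apply_qCoeff (φ : SymFun →ₗ[ℚ] ℚ) (d : ℕ →₀ ℕ) (S : SymFun ⊗[ℚ] SymFun) :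
    φ (qCoeff d S) = MvPowerSeries.coeff d (toSeries (contract φ S)) := by
  induction S using TensorProduct.induction_on with
  | zero => simp
  | tmul f g => rw [qCoeff_tmul, contract_tmul]; simp [mul_comm]
  | add x y hx hy => simp only [map_add, hx, hy]

theorem eq_zero_of_contract {S : SymFun ⊗[ℚ] SymFun} (h : ∀ φ, contract φ S = 0) : S = 0 := by
  set b := MvPolynomial.basisMonomials ℕ+ ℚ
  have h1 : ∀ T : SymFun ⊗[ℚ] SymFun, ∀ i,
      TensorProduct.equivFinsuppOfBasisRight b T i = contract (b.coord i) T := by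
    intro T i
    induction T using TensorProduct.induction_on with
    | zero => simp
    | tmul f g => simp [TensorProduct.equivFinsuppOfBasisRight_apply_tmul]
    | add x y hx hy => simp only [map_add, Finsupp.add_apply, hx, hy]
  refine (TensorProduct.equivFinsuppOfBasisRight b).injective ?_
  ext1 i
  rw [h1, h, map_zero, Finsupp.zero_apply]

theorem eq_of_qCoeff {S T : SymFun ⊗[ℚ] SymFun} (h : ∀ d, qCoeff d S = qCoeff d T) : S = T := by
  rw [← sub_eq_zero]
  refine eq_zero_of_contract fun φ => toSeries_injective ?_
  ext d
  rw [← apply_qCoeff, map_sub, h, sub_self, map_zero, map_zero, map_zero]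

/-! ### Schur functions as quotients of alternants -/

/-- The determinant `det (h_{f_i - i + j})` of size `N`. -/
def jacobiTrudi (f : ℕ → ℕ) (N : ℕ) : SymFun :=
  Matrix.det (Matrix.of fun i j : Fin N => completeInt ((f i : ℤ) - (i : ℤ) + (j : ℤ)))

theorem completeInt_natCast (k : ℕ) : completeInt k = complete k := by
  simp [completeInt]

theorem completeInt_of_neg {k : ℤ} (h : k < 0) : completeInt k = 0 := if_neg (by omega)

/-- The last row is `(0, …, 0, 1)`: it consists of `h` of negative index followed by `h_0`. -/
theorem jacobiTrudi_succ {f : ℕ → ℕ} {N : ℕ} (h : f N = 0) :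
    jacobiTrudi f (N + 1) = jacobiTrudi f N := by
  rw [jacobiTrudi, Matrix.det_succ_row _ (Fin.last N), Finset.sum_eq_single (Fin.last N)]
  · rw [Matrix.of_apply, Fin.val_last, h]
    simp only [Nat.cast_zero, zero_sub, neg_add_cancel, ← two_mul, pow_mul]
    rw [show (0 : ℤ) = ((0 : ℕ) : ℤ) from rfl, completeInt_natCast, complete_zero]
    simp only [neg_one_sq, one_pow, one_mul, jacobiTrudi]
    congr 1
    ext1 i j
    simp
  · intro j _ hj
    have h1 : (j : ℕ) < N := Fin.val_lt_last hj
    rw [Matrix.of_apply, Fin.val_last, h, completeInt_of_neg (by push_cast; omega)]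
    simp
  · simp

theorem jacobiTrudi_add {f : ℕ → ℕ} {N : ℕ} (h : ∀ i, N ≤ i → f i = 0) (k : ℕ) :
    jacobiTrudi f (N + k) = jacobiTrudi f N := by
  induction k with
  | zero => rfl
  | succ k ih => rw [← add_assoc, jacobiTrudi_succ (h _ (by omega)), ih]

theorem jacobiTrudi_zero (N : ℕ) : jacobiTrudi 0 N = 1 := by
  have := jacobiTrudi_add (f := 0) (N := 0) (fun _ _ => rfl) N
  rw [zero_add] at this
  rw [this]
  simp [jacobiTrudi]

section Alternants

variable (N : ℕ)

theorem seriesOn_X_fin (k : ℕ+) :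
    seriesOn (Fin N) (MvPolynomial.X k) = ∑ i, (MvPowerSeries.X i : MvPowerSeries (Fin N) ℚ) ^ (k : ℕ) := by
  classical
  ext d
  rw [coeff_seriesOn_X, map_sum]
  simp only [MvPowerSeries.coeff_X_pow]
  split_ifs with h
  · obtain ⟨i, rfl⟩ := h
    rw [Finset.sum_eq_single i]
    · simp
    · intro j _ hj
      rw [if_neg]
      intro h
      exact hj ((Finsupp.single_left_inj k.ne_zero).1 h).symm
    · simp
  · symm
    refine Finset.sum_eq_zero fun i _ => if_neg fun hi => h ⟨i, hi⟩

/-- The geometric series `∑ₖ xᵢᵏ tᵏ`. -/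
def geometric (i : Fin N) : PowerSeries (MvPowerSeries (Fin N) ℚ) :=
  PowerSeries.mk fun k => (MvPowerSeries.X i) ^ k

/-- The polynomial `∏_{i ∈ s} (1 - xᵢ t)`. -/
def linearProd (s : Finset (Fin N)) : Polynomial (MvPowerSeries (Fin N) ℚ) :=
  ∏ i ∈ s, (1 - Polynomial.C (MvPowerSeries.X i) * Polynomial.X)

theorem geometric_mul (i : Fin N) :
    geometric N i * (1 - PowerSeries.C (MvPowerSeries.X i) * PowerSeries.X) = 1 := by
  ext1 k
  rw [mul_sub, mul_one, mul_left_comm, map_sub, PowerSeries.coeff_C_mul, geometric,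
    PowerSeries.coeff_mk]
  cases k with
  | zero => simp
  | succ k => rw [PowerSeries.coeff_succ_mul_X, PowerSeries.coeff_mk, pow_succ']; simp [PowerSeries.coeff_one]

theorem coe_linearProd (s : Finset (Fin N)) :
    (linearProd N s : PowerSeries (MvPowerSeries (Fin N) ℚ))
      = ∏ i ∈ s, (1 - PowerSeries.C (MvPowerSeries.X i) * PowerSeries.X) := by
  rw [linearProd, ← Polynomial.coeToPowerSeries.ringHom_apply, map_prod]
  simp

theorem derivative_linearProd (s : Finset (Fin N)) :
    PowerSeries.derivative _ (linearProd N s : PowerSeries (MvPowerSeries (Fin N) ℚ))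
      = -((∑ i ∈ s, PowerSeries.C (MvPowerSeries.X i) * geometric N i) * linearProd N s) := by
  classical
  rw [coe_linearProd]
  induction s using Finset.induction_on with
  | empty => simp
  | insert a s ha ih =>
    rw [Finset.prod_insert ha, Finset.sum_insert ha, Derivation.leibniz, ih]
    have h1 : PowerSeries.derivative (MvPowerSeries (Fin N) ℚ)
        (1 - PowerSeries.C (MvPowerSeries.X a) * PowerSeries.X) = -PowerSeries.C (MvPowerSeries.X a) := by
      rw [map_sub, Derivation.leibniz]
      simp
    rw [h1, smul_eq_mul, smul_eq_mul]
    linear_combination (PowerSeries.C (MvPowerSeries.X a) *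
      ∏ i ∈ s, (1 - PowerSeries.C (MvPowerSeries.X i) * PowerSeries.X)) * geometric_mul N a
-- This is `H(t) = ∏ 1 / (1 - x_i t)` in `N` variables. Again the two factors have opposite
-- logarithmic derivatives and constant term 1.
theorem map_completeSeries_mul :
    PowerSeries.map (seriesOn (Fin N)).toRingHom completeSeries * (linearProd N Finset.univ) = 1 := by
  have : IsAddTorsionFree (MvPowerSeries (Fin N) ℚ) := IsAddTorsionFree.of_module_rat _
  apply PowerSeries.derivative.ext
  · have h1 : PowerSeries.derivative _ (PowerSeries.map (seriesOn (Fin N)).toRingHom completeSeries)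
        = (∑ i, PowerSeries.C (MvPowerSeries.X i) * geometric N i)
          * PowerSeries.map (seriesOn (Fin N)).toRingHom completeSeries := by
      have h2 : PowerSeries.derivative _ (PowerSeries.map (seriesOn (Fin N)).toRingHom completeSeries)
          = PowerSeries.map (seriesOn (Fin N)).toRingHom
            (PowerSeries.derivative _ completeSeries) := by
        ext1 k
        simp [PowerSeries.coeff_derivative]
      rw [h2, derivative_completeSeries, map_mul]
      congr 1
      ext1 k
      rw [map_sum, PowerSeries.coeff_map, powerSeries, PowerSeries.coeff_mk]
      simp only [PowerSeries.coeff_C_mul, geometric, PowerSeries.coeff_mk, ← pow_succ']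
      exact seriesOn_X_fin N k.succPNat
    rw [Derivation.leibniz, h1, derivative_linearProd, PowerSeries.derivative_one, smul_eq_mul,
      smul_eq_mul]
    ring
  · rw [map_mul, coe_linearProd, map_prod]
    rw [← PowerSeries.coeff_zero_eq_constantCoeff_apply, PowerSeries.coeff_map, completeSeries,
      PowerSeries.coeff_mk, complete_zero, map_one]
    simp

theorem map_completeSeries_mul_erase (j : Fin N) :
    PowerSeries.map (seriesOn (Fin N)).toRingHom completeSeries
      * (linearProd N (Finset.univ.erase j)) = geometric N j := by
  have h1 := map_completeSeries_mul N
  rw [coe_linearProd, ← Finset.mul_prod_erase _ _ (Finset.mem_univ j), ← coe_linearProd] at h1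
  have h2 := geometric_mul N j
  linear_combination geometric N j * h1 -
    PowerSeries.map (seriesOn (Fin N)).toRingHom completeSeries *
      (linearProd N (Finset.univ.erase j)) * h2

theorem coeff_linearProd_erase (j : Fin N) {i : ℕ} (hi : N ≤ i) :
    (linearProd N (Finset.univ.erase j)).coeff i = 0 := by
  refine Polynomial.coeff_eq_zero_of_natDegree_lt (lt_of_le_of_lt (Polynomial.natDegree_prod_le _ _) ?_)
  refine lt_of_le_of_lt (Finset.sum_le_card_nsmul _ _ 1 fun i _ => ?_) ?_
  · refine (Polynomial.natDegree_sub_le _ _).trans ?_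
    simp only [Polynomial.natDegree_one, zero_le, sup_of_le_right]
    exact (Polynomial.natDegree_C_mul_le _ _).trans Polynomial.natDegree_X_le
  · rw [Finset.card_erase_of_mem (Finset.mem_univ _)]
    have := j.pos
    simp
    omega

/-- Coefficient of `t^k` in `H(t) ∏_{i ≠ j} (1 - x_i t) = 1 / (1 - x_j t)`. The polynomial has
degree below `N`, so `N` terms suffice. -/
theorem X_pow_eq_sum (j : Fin N) (k : ℕ) :
    (MvPowerSeries.X j : MvPowerSeries (Fin N) ℚ) ^ k = ∑ i : Fin N,
      seriesOn (Fin N) (completeInt ((k : ℤ) - (i : ℕ))) *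
        (linearProd N (Finset.univ.erase j)).coeff i := by
  have h1 := congrArg (PowerSeries.coeff k) (map_completeSeries_mul_erase N j)
  rw [mul_comm, PowerSeries.coeff_mul, geometric, PowerSeries.coeff_mk] at h1
  have h2 : ∀ i, (PowerSeries.coeff i (linearProd N (Finset.univ.erase j) :
      PowerSeries (MvPowerSeries (Fin N) ℚ))) = (linearProd N (Finset.univ.erase j)).coeff i :=
    fun i => Polynomial.coeff_coe _ _
  rw [← h1, Finset.Nat.sum_antidiagonal_eq_sum_range_succ_mk,
    Fin.sum_univ_eq_sum_range (fun i => seriesOn (Fin N) (completeInt ((k : ℤ) - (i : ℕ))) *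
      (linearProd N (Finset.univ.erase j)).coeff i)]
  have h3 : ∀ i ∈ Finset.range k.succ,
      (PowerSeries.coeff i (linearProd N (Finset.univ.erase j) :
        PowerSeries (MvPowerSeries (Fin N) ℚ))) *
        PowerSeries.coeff (k - i) (PowerSeries.map (seriesOn (Fin N)).toRingHom completeSeries)
      = seriesOn (Fin N) (completeInt ((k : ℤ) - (i : ℕ))) *
        (linearProd N (Finset.univ.erase j)).coeff i := by
    intro i hi
    rw [h2, mul_comm, ← Nat.cast_sub (by simpa [Nat.lt_succ_iff] using hi), completeInt_natCast,
      PowerSeries.coeff_map, completeSeries, PowerSeries.coeff_mk]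
    rfl
  rw [Finset.sum_congr rfl h3, Finset.sum_subset (Finset.range_mono (le_max_left (k + 1) N)),
    Finset.sum_subset (Finset.range_mono (le_max_right (k + 1) N))]
  · intro i _ hi
    rw [coeff_linearProd_erase N j (by simpa using hi), mul_zero]
  · intro i _ hi
    rw [Finset.mem_range] at hi
    rw [completeInt_of_neg (by omega), map_zero, zero_mul]

/-- The alternant `det (x_j ^ α_i)`. -/
def alternantSeries (α : Fin N → ℕ) : MvPowerSeries (Fin N) ℚ :=
  Matrix.det (Matrix.of fun i j : Fin N => (MvPowerSeries.X j : MvPowerSeries (Fin N) ℚ) ^ α i)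

/-- The exponents `f_i + N - 1 - i`. -/
def staircase (f : ℕ → ℕ) (i : Fin N) : ℕ := f i + i.rev

/-- `X_pow_eq_sum` factors the matrix of the alternant. The second factor does not depend on `f`, so
the case `f = 0` identifies its determinant with `a_δ`. -/
theorem alternantSeries_eq (f : ℕ → ℕ) :
    alternantSeries N (staircase N f) = seriesOn (Fin N) (jacobiTrudi f N) *
      Matrix.det (Matrix.of fun i j : Fin N => (linearProd N (Finset.univ.erase j)).coeff i.rev) := by
  rw [jacobiTrudi, AlgHom.map_det, ← Matrix.det_mul, alternantSeries]
  congr 1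
  ext1 r j
  -- Summing over the reversed index turns `f r + (N - 1 - r) - (N - 1 - c)` into the Jacobi-Trudi
  -- index `f r - r + c`.
  rw [Matrix.of_apply, X_pow_eq_sum, Matrix.mul_apply, ← Equiv.sum_comp Fin.revPerm]
  refine Finset.sum_congr rfl fun c _ => ?_
  simp only [AlgHom.mapMatrix_apply, Matrix.map_apply, Matrix.of_apply, Fin.revPerm_apply, staircase]
  congr 3
  simp only [Fin.val_rev]
  have := r.2
  have := c.2
  push_cast [Nat.sub_add_eq]
  omega

theorem alternantSeries_staircase (f : ℕ → ℕ) :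
    alternantSeries N (staircase N f)
      = alternantSeries N (staircase N 0) * seriesOn (Fin N) (jacobiTrudi f N) := by
  rw [alternantSeries_eq, alternantSeries_eq N 0, jacobiTrudi_zero, map_one, one_mul, mul_comm]

/-- The exponent vector of a function. -/
abbrev toExp {N : ℕ} (α : Fin N → ℕ) : Fin N →₀ ℕ := Finsupp.equivFunOnFinite.symm α

theorem alternantSeries_eq_sum (α : Fin N → ℕ) :
    alternantSeries N α = ∑ w : Equiv.Perm (Fin N), ((Equiv.Perm.sign w : ℤ) : ℚ) •
      MvPowerSeries.monomial (toExp (α ∘ w)) (1 : ℚ) := by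
  rw [alternantSeries, Matrix.det_apply']
  refine Finset.sum_congr rfl fun w _ => ?_
  simp only [Matrix.of_apply, MvPowerSeries.X_pow_eq]
  have h1 : ∑ i, Finsupp.single i (α (w i)) = toExp (α ∘ w) := by
    ext i
    simp [Finsupp.finsetSum_apply, Finsupp.single_apply]
  rw [MvPowerSeries.prod_monomial, Finset.prod_const_one, h1]
  rcases Int.units_eq_one_or (Equiv.Perm.sign w) with h | h <;> simp [h]

/-- Scalar products with Jacobi-Trudi determinants are coefficients. -/
theorem hall_jacobiTrudi (F : SymFun) (f : ℕ → ℕ) :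
    hall F (jacobiTrudi f N) = MvPowerSeries.coeff (toExp (staircase N f))
      (alternantSeries N (staircase N 0) * seriesOn (Fin N) F) := by
  rw [alternantSeries_eq_sum, Finset.sum_mul, map_sum, jacobiTrudi, ← Matrix.det_transpose,
    Matrix.det_apply', map_sum]
  refine Finset.sum_congr rfl fun w _ => ?_
  -- The term of `a_δ` for `w` is `x^{δ∘w}`, and the exponent `f + δ` exceeds it at place `i` by `f
  -- i - i + w i`, the index of the corresponding `h`. If one of these is negative, both sides
  -- vanish.
  have h1 : hall F (∏ i : Fin N, completeInt ((f i : ℤ) - (i : ℤ) + (w i : ℤ)))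
      = MvPowerSeries.coeff (toExp (staircase N f))
        (MvPowerSeries.monomial (toExp (staircase N 0 ∘ w)) (1 : ℚ) * seriesOn (Fin N) F) := by
    rw [MvPowerSeries.coeff_monomial_mul, one_mul]
    by_cases h : ∀ i : Fin N, (i : ℕ) ≤ f i + w i
    · rw [if_pos]
      · rw [← hall_completeProd, completeProd_eq _ Finset.univ (Finset.subset_univ _)]
        congr 1
        refine Finset.prod_congr rfl fun i _ => ?_
        have hi := h i
        rw [show (f i : ℤ) - (i : ℤ) + (w i : ℤ) = ((f i + w i - i : ℕ) : ℤ) by omega,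
          completeInt_natCast]
        congr 1
        simp only [staircase, Finsupp.tsub_apply, Finsupp.equivFunOnFinite_symm_apply_apply,
          Function.comp_apply, Pi.zero_apply, Fin.val_rev]
        have := i.2
        have := (w i).2
        omega
      · intro i
        have hi := h i
        simp only [staircase, Finsupp.equivFunOnFinite_symm_apply_apply,
          Function.comp_apply, Pi.zero_apply, Fin.val_rev]
        have := i.2
        have := (w i).2
        omega
    · rw [if_neg]
      · push Not at h
        obtain ⟨i, hi⟩ := h
        rw [Finset.prod_eq_zero (Finset.mem_univ i) (completeInt_of_neg (by omega)), map_zero]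
      · intro h'
        refine h fun i => ?_
        have hi := h' i
        simp only [staircase, Finsupp.equivFunOnFinite_symm_apply_apply,
          Function.comp_apply, Pi.zero_apply, Fin.val_rev] at hi
        have := i.2
        have := (w i).2
        omega
  have h2 : (((Equiv.Perm.sign w : ℤ) : SymFun)) * (∏ i : Fin N, (Matrix.of fun i j : Fin N =>
      completeInt ((f i : ℤ) - (i : ℤ) + (j : ℤ))).transpose (w i) i)
      = ((Equiv.Perm.sign w : ℤ) : ℚ) •
        ∏ i : Fin N, completeInt ((f i : ℤ) - (i : ℤ) + (w i : ℤ)) := by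
    rcases Int.units_eq_one_or (Equiv.Perm.sign w) with h | h <;> simp [h]
  rw [h2, map_smul, h1, smul_mul_assoc]
  rfl

variable {N} in
theorem staircase_strictAnti {f : ℕ → ℕ} (hf : Antitone f) : StrictAnti (staircase N f) := by
  intro i j hij
  have h1 : f j ≤ f i := hf (Fin.le_def.1 hij.le)
  have h2 := Fin.lt_def.1 hij
  have := j.2
  simp only [staircase, Fin.val_rev]
  omega

variable {N} in
theorem eq_one_of_strictAnti {α β : Fin N → ℕ} (hα : StrictAnti α) (hβ : StrictAnti β)
    {w : Equiv.Perm (Fin N)} (h : α = β ∘ w) : w = 1 := by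
  have hw : StrictMono w := by
    intro i j hij
    have := hα hij
    rw [h] at this
    exact hβ.lt_iff_gt.1 this
  ext i
  have : hw.orderIsoOfSurjective w w.surjective = OrderIso.refl _ := Subsingleton.elim _ _
  exact congrArg (fun e : Fin N ≃o Fin N => (e i : ℕ)) this

/-- A strictly decreasing exponent vector is a rearrangement of another one only through the
identity permutation. -/
theorem coeff_alternantSeries {f g : ℕ → ℕ} (hf : Antitone f) (hg : Antitone g) :
    MvPowerSeries.coeff (toExp (staircase N f)) (alternantSeries N (staircase N g))
      = if ∀ i < N, f i = g i then 1 else 0 := by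
  have key : ∀ w : Equiv.Perm (Fin N), staircase N f = staircase N g ∘ w →
      w = 1 ∧ ∀ i < N, f i = g i := by
    intro w hw
    obtain rfl := eq_one_of_strictAnti (staircase_strictAnti hf) (staircase_strictAnti hg) hw
    refine ⟨rfl, fun i hi => ?_⟩
    simpa [staircase] using congrFun hw ⟨i, hi⟩
  rw [alternantSeries_eq_sum, map_sum]
  simp only [map_smul, MvPowerSeries.coeff_monomial]
  split_ifs with h
  · rw [Finset.sum_eq_single 1]
    · rw [if_pos]
      · simp
      · congr 1
        funext i
        simp [staircase, h i i.2]
    · intro w _ hw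
      rw [if_neg, smul_zero]
      intro h1
      exact hw (key w (Finsupp.equivFunOnFinite.symm.injective h1)).1
    · simp
  · refine Finset.sum_eq_zero fun w _ => ?_
    rw [if_neg, smul_zero]
    intro h1
    exact h (key w (Finsupp.equivFunOnFinite.symm.injective h1)).2

theorem hall_jacobiTrudi_jacobiTrudi {f g : ℕ → ℕ} (hf : Antitone f) (hg : Antitone g) :
    hall (jacobiTrudi g N) (jacobiTrudi f N) = if ∀ i < N, f i = g i then 1 else 0 := by
  rw [hall_jacobiTrudi, ← alternantSeries_staircase, coeff_alternantSeries N hf hg]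

end Alternants

/-! ### Lowest terms of alternants in the lexicographic order -/

section LexOrder

variable {N : ℕ}

/-- Among the rearrangements of a strictly decreasing vector, the increasing one is
lexicographically smallest. -/
theorem toLex_rev_lt {α : Fin N → ℕ} (hα : StrictAnti α) {w : Equiv.Perm (Fin N)}
    (hw : w ≠ Fin.revPerm) : toLex (toExp (α ∘ Fin.revPerm)) < toLex (toExp (α ∘ w)) := by
  have hne : (Finset.univ.filter fun i => w i ≠ Fin.rev i).Nonempty := by
    by_contra h
    rw [Finset.not_nonempty_iff_eq_empty, Finset.filter_eq_empty_iff] at h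
    exact hw (Equiv.ext fun i => by simpa using h (Finset.mem_univ i))
  set i := Finset.min' _ hne with hi
  have h1 : w i ≠ Fin.rev i := (Finset.mem_filter.1 (Finset.min'_mem _ hne)).2
  have h2 : ∀ j < i, w j = Fin.rev j := by
    intro j hj
    by_contra h
    exact absurd (Finset.min'_le _ j (Finset.mem_filter.2 ⟨Finset.mem_univ _, h⟩)) (not_le.2 hj)
  have h3 : w i < Fin.rev i := by
    -- If `w i` were larger, the place `rev (w i)` would lie before `i` and already have the value
    -- `w i`, against injectivity.
    refine lt_of_le_of_ne ?_ h1
    by_contra h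
    rw [not_le] at h
    have h4 : Fin.rev (w i) < i := by simpa using Fin.rev_lt_rev.2 h
    have h5 := h2 _ h4
    rw [Fin.rev_rev] at h5
    exact absurd (w.injective h5) h4.ne
  refine Finsupp.Lex.lt_iff.2 ⟨i, fun j hj => ?_, ?_⟩
  · simp [h2 j hj]
  · simpa using hα h3

theorem coeff_alternantSeries_rev {α : Fin N → ℕ} (hα : StrictAnti α) :
    MvPowerSeries.coeff (toExp (α ∘ Fin.revPerm)) (alternantSeries N α)
      = ((Equiv.Perm.sign (Fin.revPerm : Equiv.Perm (Fin N)) : ℤ) : ℚ) := by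
  rw [alternantSeries_eq_sum, map_sum]
  simp only [map_smul, MvPowerSeries.coeff_monomial]
  rw [Finset.sum_eq_single Fin.revPerm]
  · simp
  · intro w _ hw
    rw [if_neg, smul_zero]
    intro h
    have := toLex_rev_lt hα hw
    rw [h] at this
    exact lt_irrefl _ this
  · simp

theorem lexOrder_alternantSeries {α : Fin N → ℕ} (hα : StrictAnti α) :
    MvPowerSeries.lexOrder (alternantSeries N α) = toLex (toExp (α ∘ Fin.revPerm)) := by
  refine le_antisymm (MvPowerSeries.lexOrder_le_of_coeff_ne_zero ?_)
    (MvPowerSeries.le_lexOrder_iff.2 fun d hd => ?_)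
  · rw [coeff_alternantSeries_rev hα]
    rcases Int.units_eq_one_or (Equiv.Perm.sign (Fin.revPerm : Equiv.Perm (Fin N))) with h | h <;>
      simp [h]
  · rw [alternantSeries_eq_sum, map_sum]
    simp only [map_smul, MvPowerSeries.coeff_monomial]
    refine Finset.sum_eq_zero fun w _ => ?_
    rw [if_neg, smul_zero]
    rintro rfl
    rw [WithTop.coe_lt_coe] at hd
    by_cases hw : w = Fin.revPerm
    · subst hw; exact lt_irrefl _ hd
    · exact lt_asymm hd (toLex_rev_lt hα hw)

/-- A Schur function has a positive coefficient. -/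
theorem exists_hall_jacobiTrudi_pos {f : ℕ → ℕ} (hf : Antitone f) :
    ∃ d : Fin N →₀ ℕ, 0 < hall (jacobiTrudi f N) (completeProd d) := by
  have h0 := alternantSeries_staircase N f
  have hs := lexOrder_alternantSeries (staircase_strictAnti (N := N) hf)
  have hδ := lexOrder_alternantSeries (staircase_strictAnti (N := N) (f := 0) antitone_const)
  have hne : seriesOn (Fin N) (jacobiTrudi f N) ≠ 0 := by
    intro h
    rw [h, mul_zero] at h0
    rw [h0] at hs
    simp at hs
  obtain ⟨q, hq⟩ := MvPowerSeries.exists_finsupp_eq_lexOrder_of_ne_zero hne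
  refine ⟨q, ?_⟩
  -- Lowest coefficients multiply. Those of `a_δ` and `a_{f+δ}` are both the sign of the reversal,
  -- so the lowest coefficient of the Schur function is 1.
  have h1 := MvPowerSeries.coeff_mul_of_add_lexOrder hδ hq
  have h2 := MvPowerSeries.lexOrder_mul (alternantSeries N (staircase N 0))
    (seriesOn (Fin N) (jacobiTrudi f N))
  rw [← h0, hs, hδ, hq, ← WithTop.coe_add, WithTop.coe_inj, ← toLex_add] at h2
  have h3 := toLex.injective h2
  rw [← h0, ← h3, coeff_alternantSeries_rev (staircase_strictAnti hf),
    coeff_alternantSeries_rev (staircase_strictAnti (f := 0) antitone_const)] at h1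
  rw [hall_completeProd]
  rcases Int.units_eq_one_or (Equiv.Perm.sign (Fin.revPerm : Equiv.Perm (Fin N))) with h | h <;>
    simp only [h, Units.val_one, Units.val_neg, Int.cast_neg, Int.cast_one] at h1 <;> linarith

end LexOrder

/-! ### The bases of Schur functions and of products of elementary symmetric functions -/

/-- The parts of a partition in decreasing order, followed by zeros. -/
def partsFn {m : ℕ} (μ : m.Partition) (i : ℕ) : ℕ := (μ.parts.sort (· ≥ ·)).getD i 0

theorem partsFn_antitone {m : ℕ} (μ : m.Partition) : Antitone (partsFn μ) := by
  intro i j hij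
  have h := Multiset.pairwise_sort μ.parts (· ≥ ·)
  unfold partsFn
  rcases lt_or_ge j (μ.parts.sort (· ≥ ·)).length with hj | hj
  · rw [List.getD_eq_getElem _ _ hj, List.getD_eq_getElem _ _ (hij.trans_lt hj)]
    rcases hij.eq_or_lt with rfl | hij
    · exact le_rfl
    · exact List.pairwise_iff_getElem.1 h i j _ hj hij
  · rw [List.getD_eq_default _ _ hj]
    exact Nat.zero_le _

theorem length_sort_le {m : ℕ} (μ : m.Partition) : (μ.parts.sort (· ≥ ·)).length ≤ m := by
  rw [Multiset.length_sort]
  conv_rhs => rw [← μ.parts_sum]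
  have := Multiset.card_nsmul_le_sum (s := μ.parts) (a := 1) fun i hi => μ.parts_pos hi
  simpa using this

/-- All partitions of `m` get determinants of the same size, so that they can be compared through
alternants in `m` variables. -/
theorem schur_eq_jacobiTrudi {m : ℕ} (μ : m.Partition) : schur μ = jacobiTrudi (partsFn μ) m := by
  have h1 : schur μ = jacobiTrudi (partsFn μ) (μ.parts.sort (· ≥ ·)).length := by
    rw [schur, jacobiTrudi]
    congr 1
    ext1 i j
    rw [Matrix.of_apply, Matrix.of_apply, partsFn, List.getD_eq_getElem _ _ i.2]
    rfl
  obtain ⟨k, hk⟩ := Nat.exists_eq_add_of_le (length_sort_le μ)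
  have h2 : jacobiTrudi (partsFn μ) ((μ.parts.sort (· ≥ ·)).length + k)
      = jacobiTrudi (partsFn μ) (μ.parts.sort (· ≥ ·)).length :=
    jacobiTrudi_add (fun i hi => List.getD_eq_default _ _ hi) k
  rw [← hk] at h2
  rw [h1, h2]

theorem map_partsFn {m : ℕ} (μ : m.Partition) :
    ∃ k, (List.range m).map (partsFn μ) = μ.parts.sort (· ≥ ·) ++ List.replicate k 0 := by
  obtain ⟨k, hk⟩ := Nat.exists_eq_add_of_le (length_sort_le μ)
  refine ⟨k, List.ext_getElem (by simpa using hk) fun i hi hi' => ?_⟩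
  rw [List.getElem_map, List.getElem_range, partsFn, List.getElem_append]
  split_ifs with h
  · rw [List.getD_eq_getElem _ _ h]
  · rw [List.getD_eq_default _ _ (not_lt.1 h), List.getElem_replicate]

theorem partsFn_injective {m : ℕ} {μ ν : m.Partition} (h : ∀ i < m, partsFn μ i = partsFn ν i) :
    μ = ν := by
  have h1 : ∀ μ : m.Partition,
      μ.parts = (Multiset.map (partsFn μ) (Multiset.range m)).filter (· ≠ 0) := by
    intro μ
    obtain ⟨k, hk⟩ := map_partsFn μ
    rw [← Multiset.coe_range, Multiset.map_coe, hk, ← Multiset.coe_add, Multiset.filter_add,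
      Multiset.sort_eq, Multiset.coe_replicate]
    rw [Multiset.filter_eq_self.2 fun i hi => (μ.parts_pos hi).ne',
      Multiset.filter_eq_nil.2 fun i hi => by simp [Multiset.eq_of_mem_replicate hi], add_zero]
  refine Nat.Partition.ext ?_
  rw [h1 μ, h1 ν]
  congr 1
  exact Multiset.map_congr rfl fun i hi => h i (by simpa using hi)

theorem sum_partsFn {m : ℕ} (μ : m.Partition) : ∑ i : Fin m, partsFn μ i = m := by
  obtain ⟨k, hk⟩ := map_partsFn μ
  have h := congrArg List.sum hk
  rw [List.sum_append, List.sum_replicate, smul_zero, add_zero, ← Multiset.sum_coe,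
    ← Multiset.sum_coe, Multiset.sort_eq, μ.parts_sum, ← Multiset.map_coe, Multiset.coe_range] at h
  rw [Fin.sum_univ_eq_sum_range]
  exact h

theorem hall_schur_schur {m : ℕ} (μ ν : m.Partition) :
    hall (schur μ) (schur ν) = if μ = ν then 1 else 0 := by
  rw [schur_eq_jacobiTrudi, schur_eq_jacobiTrudi,
    hall_jacobiTrudi_jacobiTrudi m (partsFn_antitone ν) (partsFn_antitone μ)]
  by_cases h : μ = ν
  · subst h; simp
  · rw [if_neg h, if_neg fun h1 => h (partsFn_injective h1).symm]

theorem jacobiTrudi_mem_homog (f : ℕ → ℕ) (N : ℕ) : jacobiTrudi f N ∈ homog (∑ i : Fin N, f i) := by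
  rw [jacobiTrudi, ← Matrix.det_transpose, Matrix.det_apply]
  refine Submodule.sum_mem _ fun w _ => ?_
  rw [Units.smul_def, ← Int.cast_smul_eq_zsmul ℚ]
  refine Submodule.smul_mem _ _ ?_
  simp only [Matrix.transpose_apply, Matrix.of_apply]
  by_cases h : ∀ i : Fin N, (i : ℕ) ≤ f i + w i
  · have h1 : ∏ i : Fin N, completeInt ((f i : ℤ) - (i : ℤ) + (w i : ℤ))
        = ∏ i : Fin N, complete (f i + w i - i) := by
      refine Finset.prod_congr rfl fun i _ => ?_
      have := h i
      rw [← completeInt_natCast]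
      congr 1
      omega
    have h2 : ∑ i : Fin N, (f i + w i - i) = ∑ i : Fin N, f i := by
      have h3 : ∑ i : Fin N, (f i + w i - i) + ∑ i : Fin N, (i : ℕ)
          = ∑ i : Fin N, f i + ∑ i : Fin N, (i : ℕ) := by
        rw [← Finset.sum_add_distrib]
        conv_rhs => rw [← Equiv.sum_comp w (fun i : Fin N => (i : ℕ)), ← Finset.sum_add_distrib]
        exact Finset.sum_congr rfl fun i _ => Nat.sub_add_cancel (h i)
      omega
    rw [h1, ← h2]
    exact MvPolynomial.IsWeightedHomogeneous.prod _ _ _ fun i _ => complete_mem_homog _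
  · push Not at h
    obtain ⟨i, hi⟩ := h
    rw [Finset.prod_eq_zero (Finset.mem_univ i) (completeInt_of_neg (by omega))]
    exact Submodule.zero_mem _

theorem schur_mem_homog {m : ℕ} (μ : m.Partition) : schur μ ∈ homog m := by
  have := jacobiTrudi_mem_homog (partsFn μ) m
  rwa [sum_partsFn, ← schur_eq_jacobiTrudi] at this

/-- The coordinates of a homogeneous symmetric function on the power sums. -/
def homogCoords (m : ℕ) : homog m →ₗ[ℚ] (m.Partition → ℚ) where
  toFun F l := (F : SymFun).coeff (exponent l.parts)
  map_add' F G := by ext l; simp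
  map_smul' c F := by ext l; simp

theorem homogCoords_injective (m : ℕ) : Function.Injective (homogCoords m) := by
  rw [injective_iff_map_eq_zero]
  rintro ⟨F, hF⟩ h
  refine Subtype.ext (MvPolynomial.ext _ _ fun u => ?_)
  by_contra h1
  have h2 := mem_homog.1 hF u h1
  refine h1 ?_
  have := congrFun h (partitionOf u h2)
  simpa [homogCoords, exponent_partitionOf] using this

instance (m : ℕ) : FiniteDimensional ℚ (homog m) :=
  FiniteDimensional.of_injective _ (homogCoords_injective m)

theorem schur_linearIndependent (m : ℕ) :
    LinearIndependent ℚ fun μ : m.Partition => (⟨schur μ, schur_mem_homog μ⟩ : homog m) := by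
  rw [Fintype.linearIndependent_iff]
  intro c hc μ
  have h1 := congrArg (fun F : homog m => hall (schur μ) (F : SymFun)) hc
  simpa [hall_schur_schur] using h1

/-- The orthonormal Schur functions bound the dimension from below, the power sum coordinates from
above. -/
theorem finrank_homog (m : ℕ) : Module.finrank ℚ (homog m) = Fintype.card m.Partition := by
  refine le_antisymm ?_ (schur_linearIndependent m).fintype_card_le_finrank
  have := LinearMap.finrank_le_finrank_of_injective (homogCoords_injective m)
  simpa using this

/-- Every homogeneous symmetric function is `∑ ⟨F, s_μ⟩ s_μ`. -/
theorem eq_sum_schur {m : ℕ} {F : SymFun} (hF : F ∈ homog m) :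
    F = ∑ μ : m.Partition, hall F (schur μ) • schur μ := by
  have h1 := (schur_linearIndependent m).span_eq_top_of_card_eq_finrank' (finrank_homog m).symm
  have h2 : (⟨F, hF⟩ : homog m) ∈ Submodule.span ℚ (Set.range
      fun μ : m.Partition => (⟨schur μ, schur_mem_homog μ⟩ : homog m)) := by
    rw [h1]; trivial
  obtain ⟨c, hc⟩ := (Submodule.mem_span_range_iff_exists_fun ℚ).1 h2
  have h3 : F = ∑ μ : m.Partition, c μ • schur μ := by
    simpa using (congrArg (Submodule.subtype (homog m)) hc).symm
  conv_lhs => rw [h3]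
  refine Finset.sum_congr rfl fun μ _ => ?_
  congr 1
  rw [h3]
  simp [hall_schur_schur]

theorem prod_mem_homog {f : ℕ → SymFun} (hf : ∀ k, f k ∈ homog k) (s : Multiset ℕ) :
    (s.map f).prod ∈ homog s.sum := by
  induction s using Multiset.induction with
  | empty => simpa using MvPolynomial.isWeightedHomogeneous_one ℚ _
  | cons a s ih =>
    rw [Multiset.map_cons, Multiset.prod_cons, Multiset.sum_cons]
    exact MvPolynomial.IsWeightedHomogeneous.mul (hf a) ih

theorem elementaryProd_mem_homog {m : ℕ} (ν : m.Partition) : elementaryProd ν ∈ homog m := by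
  have := prod_mem_homog elementary_mem_homog ν.parts
  rwa [ν.parts_sum] at this

/-- All products of `e_k` span the whole ring, and projecting to degree `m` keeps exactly the
products of that degree. -/
theorem mem_span_elementaryProd {m : ℕ} {F : SymFun} (hF : F ∈ homog m) :
    F ∈ Submodule.span ℚ (Set.range fun ν : m.Partition => elementaryProd ν) := by
  have h1 : F ∈ (⊤ : Submodule ℚ SymFun) := trivial
  rw [← span_prod_eq_top (c := fun k => (-1 : ℚ) ^ k) (by simp) elementary_zero newton_elementary] at h1
  have h2 : F = MvPolynomial.weightedHomogeneousComponent (fun k : ℕ+ => (k : ℕ)) m F :=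
    (MvPolynomial.weightedHomogeneousComponent_eq_self hF).symm
  rw [h2]
  clear h2 hF
  induction h1 using Submodule.span_induction with
  | mem x hx =>
    obtain ⟨s, hs, rfl⟩ := hx
    have h3 := prod_mem_homog elementary_mem_homog s
    by_cases hm : s.sum = m
    · rw [MvPolynomial.weightedHomogeneousComponent_eq_self (hm ▸ h3)]
      exact Submodule.subset_span ⟨⟨s, fun hi => hs _ hi, hm⟩, rfl⟩
    · rw [MvPolynomial.IsWeightedHomogeneous.weightedHomogeneousComponent_ne _ h3 (Ne.symm hm)]
      exact Submodule.zero_mem _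
  | zero => rw [map_zero]; exact Submodule.zero_mem _
  | add x y _ _ hx hy => rw [map_add]; exact Submodule.add_mem _ hx hy
  | smul c x _ hx => rw [map_smul]; exact Submodule.smul_mem _ c hx

theorem elementaryProd_linearIndependent (m : ℕ) :
    LinearIndependent ℚ fun ν : m.Partition => elementaryProd ν := by
  have h : LinearIndependent ℚ
      fun ν : m.Partition => (⟨elementaryProd ν, elementaryProd_mem_homog ν⟩ : homog m) := by
    refine linearIndependent_of_top_le_span_of_card_eq_finrank ?_ (finrank_homog m).symm
    rintro ⟨F, hF⟩ -
    obtain ⟨c, hc⟩ := (Submodule.mem_span_range_iff_exists_fun ℚ).1 (mem_span_elementaryProd hF)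
    refine (Submodule.mem_span_range_iff_exists_fun ℚ).2 ⟨c, Subtype.ext ?_⟩
    simpa using hc
  exact h.map' (homog m).subtype (Submodule.ker_subtype _)

/-- A tensor whose right factors are homogeneous of degree `m` has exactly one expansion on the
products of elementary symmetric functions. -/
theorem existsUnique_expansion {m : ℕ} {T : SymFun ⊗[ℚ] SymFun}
    (hT : T ∈ Submodule.span ℚ {t | ∃ f, ∃ g ∈ homog m, t = f ⊗ₜ[ℚ] g}) :
    ∃! d : m.Partition → SymFun, IsElementaryExpansion T d := by
  refine existsUnique_of_exists_of_unique ?_ ?_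
  · induction hT using Submodule.span_induction with
    | mem x hx =>
      obtain ⟨f, g, hg, rfl⟩ := hx
      obtain ⟨c, hc⟩ := (Submodule.mem_span_range_iff_exists_fun ℚ).1 (mem_span_elementaryProd hg)
      refine ⟨fun ν => c ν • f, ?_⟩
      rw [IsElementaryExpansion, ← hc, TensorProduct.tmul_sum]
      simp only [TensorProduct.smul_tmul]
    | zero => exact ⟨0, by simp [IsElementaryExpansion]⟩
    | add x y _ _ hx hy =>
      obtain ⟨d, hd⟩ := hx
      obtain ⟨d', hd'⟩ := hy
      refine ⟨d + d', ?_⟩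
      rw [IsElementaryExpansion] at hd hd' ⊢
      rw [hd, hd', ← Finset.sum_add_distrib]
      simp only [Pi.add_apply, TensorProduct.add_tmul]
    | smul c x _ hx =>
      obtain ⟨d, hd⟩ := hx
      refine ⟨c • d, ?_⟩
      rw [IsElementaryExpansion] at hd ⊢
      rw [hd, Finset.smul_sum]
      simp only [Pi.smul_apply, TensorProduct.smul_tmul']
  · intro d d' hd hd'
    funext ν
    -- A left inverse of the linear combination map provides a linear form dual to `e_ν`;
    -- contracting with it reads off `d ν`.
    obtain ⟨g, hg⟩ := LinearMap.exists_leftInverse_of_injective _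
      (LinearMap.ker_eq_bot.2 (elementaryProd_linearIndependent m))
    have hφ : ∀ κ : m.Partition, g (elementaryProd κ) = Finsupp.single κ 1 := by
      intro κ
      have := LinearMap.congr_fun hg (Finsupp.single κ 1)
      simpa using this
    set φ := Finsupp.lapply ν ∘ₗ g
    have h := congrArg (contract φ) (hd.symm.trans hd')
    simpa [φ, hφ, Finsupp.single_apply] using h

open Finset.HasAntidiagonal (antidiagonal mem_antidiagonal)

/-! ### Schur functions of hooks -/

/-- The determinant with first row `r` and other rows those of the Jacobi-Trudi determinant
of a column. -/
def borderDet (r : ℕ → SymFun) (N : ℕ) : SymFun :=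
  Matrix.det (Matrix.of fun i j : Fin N =>
    if (i : ℕ) = 0 then r j else completeInt (1 - (i : ℤ) + (j : ℤ)))

/-- Expansion along the first column, whose only possibly non-zero entries are `r 0` and the `h_0 =
1` just below. Both minors are bordered determinants again. -/
theorem borderDet_succ_succ (r : ℕ → SymFun) (N : ℕ) :
    borderDet r (N + 2) = r 0 * borderDet (fun j => complete (1 + j)) (N + 1)
      - borderDet (fun j => r (j + 1)) (N + 1) := by
  rw [borderDet, Matrix.det_succ_column_zero, Fin.sum_univ_succ, Fin.sum_univ_succ,
    Finset.sum_eq_zero, add_zero, sub_eq_add_neg]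
  · congr 1
    · rw [borderDet]
      simp only [Fin.val_zero, pow_zero, one_mul, Matrix.of_apply, if_true]
      congr 2
      ext1 i j
      simp only [Matrix.submatrix_apply, Fin.zero_succAbove, Matrix.of_apply, Fin.val_succ]
      rw [if_neg (by omega)]
      split_ifs with h
      · rw [h, ← completeInt_natCast]; congr 1; push_cast; ring
      · congr 1; push_cast; ring
    · rw [borderDet]
      have h1 : completeInt (1 - ((1 : ℕ) : ℤ) + ((0 : ℕ) : ℤ)) = 1 := by
        simp [completeInt, complete_zero]
      simp only [Matrix.of_apply, Fin.val_succ, Fin.val_zero, zero_add, one_ne_zero, if_false,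
        pow_one]
      rw [h1, mul_one, neg_one_mul]
      congr 2
      ext1 i j
      simp only [Matrix.submatrix_apply, Matrix.of_apply, Fin.val_succ]
      refine Fin.cases ?_ (fun i => ?_) i
      · simp
      · rw [Fin.succ_succAbove_succ, Fin.zero_succAbove]
        simp only [Fin.val_succ]
        rw [if_neg (by omega), if_neg (by omega)]
        congr 1; push_cast; ring
  · intro i _
    rw [Matrix.of_apply, if_neg (by simp), completeInt_of_neg]
    · simp
    · simp only [Fin.val_succ, Fin.val_zero]; push_cast; omega

/-- The coefficient of `t^(N+1)` in `H(t) E(-t) = 1`, up to a sign. -/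
theorem sum_complete_mul_elementary (N : ℕ) :
    ∑ p ∈ antidiagonal N, (-1 : ℚ) ^ p.1 • (complete (1 + p.1) * elementary p.2)
      = elementary (N + 1) := by
  have h := congrArg (PowerSeries.coeff (N + 1)) completeSeries_mul_elementarySeries
  rw [PowerSeries.coeff_mul, Finset.Nat.sum_antidiagonal_succ, PowerSeries.coeff_one,
    if_neg (Nat.succ_ne_zero N)] at h
  simp only [completeSeries, elementarySeries, PowerSeries.coeff_mk, complete_zero, one_mul] at h
  have h1 : ∑ p ∈ antidiagonal N, complete (p.1 + 1) * (-1 : ℚ) ^ p.2 • elementary p.2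
      = (-1 : ℚ) ^ N • ∑ p ∈ antidiagonal N,
        (-1 : ℚ) ^ p.1 • (complete (1 + p.1) * elementary p.2) := by
    rw [Finset.smul_sum]
    refine Finset.sum_congr rfl fun p hp => ?_
    rw [mem_antidiagonal] at hp
    rw [add_comm 1 p.1, smul_smul, ← pow_add, mul_smul_comm,
      show N + p.1 = p.2 + 2 * p.1 by omega, pow_add, pow_mul, neg_one_sq, one_pow, mul_one]
  rw [h1, pow_succ, mul_neg_one, neg_smul, neg_add_eq_zero] at h
  exact (smul_right_injective _ (pow_ne_zero N (by norm_num : (-1 : ℚ) ≠ 0)) h).symm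

theorem borderDet_succ (r : ℕ → SymFun) (N : ℕ) :
    borderDet r (N + 1) = ∑ p ∈ antidiagonal N, (-1 : ℚ) ^ p.1 • (r p.1 * elementary p.2) := by
  induction N generalizing r with
  | zero => simp [borderDet, elementary_zero]
  | succ N ih =>
    rw [borderDet_succ_succ, ih, ih, sum_complete_mul_elementary, Finset.Nat.antidiagonal_succ,
      Finset.sum_cons, Finset.sum_map, sub_eq_add_neg, ← Finset.sum_neg_distrib]
    congr 1
    · simp
    · refine Finset.sum_congr rfl fun p _ => ?_
      simp [pow_succ]

theorem sort_hook (n k : ℕ) (hk : k < n) :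
    (hook n k hk).parts.sort (· ≥ ·) = (k + 1) :: List.replicate (n - 1 - k) 1 := by
  have h : (hook n k hk).parts = (((k + 1) :: List.replicate (n - 1 - k) 1 : List ℕ) : Multiset ℕ) := by
    rw [← Multiset.cons_coe, Multiset.coe_replicate]
    rfl
  refine List.Perm.eq_of_pairwise (le := (· ≥ ·)) (fun _ _ _ _ h1 h2 => le_antisymm h2 h1)
    (Multiset.pairwise_sort _ _) ?_ ?_
  · rw [List.pairwise_cons]
    refine ⟨fun a ha => ?_, List.pairwise_replicate.2 (Or.inr le_rfl)⟩
    rw [List.eq_of_mem_replicate ha]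
    omega
  · rw [← Multiset.coe_eq_coe, Multiset.sort_eq, h]

theorem schur_hook (n k : ℕ) (hk : k < n) :
    schur (hook n k hk) = ∑ p ∈ antidiagonal (n - 1 - k),
      (-1 : ℚ) ^ p.1 • (complete (k + 1 + p.1) * elementary p.2) := by
  rw [← borderDet_succ fun j => complete (k + 1 + j)]
  have h1 : schur (hook n k hk)
      = jacobiTrudi (partsFn (hook n k hk)) ((hook n k hk).parts.sort (· ≥ ·)).length := by
    rw [schur_eq_jacobiTrudi]
    obtain ⟨l, hl⟩ := Nat.exists_eq_add_of_le (length_sort_le (hook n k hk))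
    have := jacobiTrudi_add (f := partsFn (hook n k hk))
      (N := ((hook n k hk).parts.sort (· ≥ ·)).length)
      (fun i hi => List.getD_eq_default _ _ hi) l
    rwa [← hl] at this
  have h2 : ((hook n k hk).parts.sort (· ≥ ·)).length = n - 1 - k + 1 := by
    rw [sort_hook]; simp
  rw [h1, h2, jacobiTrudi, borderDet]
  congr 1
  ext1 i j
  rw [Matrix.of_apply, Matrix.of_apply, partsFn, sort_hook]
  split_ifs with h
  · rw [h, ← completeInt_natCast]
    congr 1
  · obtain ⟨i', hi'⟩ := Nat.exists_eq_succ_of_ne_zero h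
    have := i.2
    rw [hi', List.getD_cons_succ, List.getD_eq_getElem _ _ (by simp; omega), List.getElem_replicate]
    simp

theorem column_eq_hook {n : ℕ} (hn : 0 < n) : column n = hook n 0 hn := by
  refine Nat.Partition.ext ?_
  simp only [column, hook]
  rw [← Multiset.replicate_succ]
  congr 1
  omega

theorem schur_column {n : ℕ} (hn : 0 < n) : schur (column n) = elementary n := by
  rw [column_eq_hook hn, schur_hook]
  have := sum_complete_mul_elementary (n - 1)
  rw [Nat.sub_add_cancel hn] at this
  rw [← this]
  simp

/-- The pair `(i, j)` arises once for each `k` from `0` to `i`. -/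
theorem sum_antidiagonal_add {M : Type*} [AddCommMonoid M] (F : ℕ → ℕ → M) (N : ℕ) :
    ∑ k ∈ Finset.range (N + 1), ∑ p ∈ antidiagonal (N - k), F (k + p.1) p.2
      = ∑ p ∈ antidiagonal N, (p.1 + 1) • F p.1 p.2 := by
  induction N generalizing F with
  | zero => simp
  | succ N ih =>
    rw [Finset.sum_range_succ']
    have h := ih fun i j => F (i + 1) j
    have h2 : ∀ k ∈ Finset.range (N + 1), ∑ p ∈ antidiagonal (N + 1 - (k + 1)), F (k + 1 + p.1) p.2
        = ∑ p ∈ antidiagonal (N - k), F (k + p.1 + 1) p.2 := by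
      intro k _
      rw [Nat.add_sub_add_right]
      refine Finset.sum_congr rfl fun p _ => ?_
      rw [add_right_comm]
    rw [Finset.sum_congr rfl h2, h, Finset.Nat.antidiagonal_succ (n := N), Nat.sub_zero,
      Finset.Nat.antidiagonal_succ (n := N), Finset.sum_cons, Finset.sum_cons, Finset.sum_map,
      Finset.sum_map, add_left_comm, ← Finset.sum_add_distrib]
    simp [add_smul, add_assoc, two_smul]

/-- `p_n = ∑_{k + j + 1 = n} (-1) ^ j s_{(k|j)}`. -/
theorem X_eq_sum_schur_hook (n : ℕ+) :
    (MvPolynomial.X n : SymFun)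
      = ∑ k : Fin n, (-1 : ℚ) ^ ((n : ℕ) - 1 - k) • schur (hook n k k.2) := by
  have h1 : ∀ k : Fin n, (-1 : ℚ) ^ ((n : ℕ) - 1 - k) • schur (hook n k k.2)
      = ∑ p ∈ antidiagonal (n.natPred - k),
        (-1 : ℚ) ^ p.2 • (complete (k + p.1 + 1) * elementary p.2) := by
    intro k
    rw [schur_hook, Finset.smul_sum]
    refine Finset.sum_congr rfl fun p hp => ?_
    rw [mem_antidiagonal] at hp
    have h0 : (n : ℕ) - 1 - k = p.1 + p.2 := hp.symm
    rw [h0, smul_smul, ← pow_add, add_right_comm _ 1,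
      show p.1 + p.2 + p.1 = p.2 + 2 * p.1 by omega, pow_add, pow_mul, neg_one_sq, one_pow, mul_one]
  -- As `∑ p_{k+1} t^k = H'(t) E(-t)`, the power sum is a signed sum of `(i + 1) h_{i+1} e_j`. The
  -- factor `i + 1` counts the hooks whose expansion contains `h_{i+1} e_j`.
  have h2 : PowerSeries.derivative SymFun completeSeries * elementarySeries = powerSeries := by
    rw [derivative_completeSeries, mul_assoc, completeSeries_mul_elementarySeries, mul_one]
  have h3 := congrArg (PowerSeries.coeff n.natPred) h2
  rw [PowerSeries.coeff_mul] at h3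
  simp only [PowerSeries.coeff_derivative, powerSeries, completeSeries, elementarySeries,
    PowerSeries.coeff_mk, PNat.succPNat_natPred] at h3
  have h4 := sum_antidiagonal_add (fun i j => (-1 : ℚ) ^ j • (complete (i + 1) * elementary j))
    n.natPred
  rw [PNat.natPred_add_one] at h4
  rw [Finset.sum_congr rfl fun k _ => h1 k, Fin.sum_univ_eq_sum_range fun k =>
    ∑ p ∈ antidiagonal (n.natPred - k), (-1 : ℚ) ^ p.2 • (complete (k + p.1 + 1) * elementary p.2),
    h4, ← h3]
  refine Finset.sum_congr rfl fun p _ => ?_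
  rw [nsmul_eq_mul, mul_smul_comm, mul_smul_comm, Nat.cast_succ, mul_comm (complete (p.1 + 1)) _,
    mul_assoc]

/-! ### Skewing by elementary symmetric functions -/

theorem hall_ext {F G : SymFun} (h : ∀ H, hall F H = hall G H) : F = G := by
  rw [← sub_eq_zero]
  refine hall_nondegenerate fun H => ?_
  rw [map_sub, LinearMap.sub_apply, h, sub_self]

theorem skew_smul (c : ℚ) (f F : SymFun) : skew (c • f) F = c • skew f F :=
  hall_ext fun H => by
    rw [hall_skew, smul_mul_assoc, map_smul, map_smul, LinearMap.smul_apply, hall_skew]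

theorem skew_zero_left (F : SymFun) : skew 0 F = 0 :=
  hall_ext fun H => by rw [hall_skew, zero_mul, map_zero, map_zero, LinearMap.zero_apply]

theorem skew_one (F : SymFun) : skew 1 F = F := hall_ext fun H => by rw [hall_skew, one_mul]

/-- The adjoint form of the Leibniz rule for the derivation `p_j^⊥`. -/
theorem skew_X_mul (f : SymFun) (j : ℕ+) (F : SymFun) :
    skew f (MvPolynomial.X j * F) = MvPolynomial.X j * skew f F + skew (pderivScaled j f) F := by
  refine hall_ext fun H => ?_
  rw [hall_skew, hall_X_mul, Derivation.leibniz, map_add, map_add, LinearMap.add_apply, hall_X_mul,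
    hall_skew, hall_skew, smul_eq_mul, smul_eq_mul, mul_comm H]

/-- The substitution `p_k ↦ p_k - 1`. -/
def plethSubOne : SymFun →ₐ[ℚ] SymFun := MvPolynomial.aeval fun k => MvPolynomial.X k - 1

/-- The adjoint of multiplication by `∑ (-1)^k e_k` is the substitution `p_j ↦ p_j - 1`. For each
`F` the sum is finite, hence the bound `K₀`. In the induction the correction term of `skew_X_mul`
shifts `e_k` to `e_{k-j}`, and the signs combine to `-1` whatever `j` is. -/
theorem sum_skew_elementary (F : SymFun) : ∃ K₀, ∀ K ≥ K₀,
    ∑ k ∈ Finset.range K, (-1 : ℚ) ^ k • skew (elementary k) F = plethSubOne F := by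
  induction F using MvPolynomial.induction_on with
  | C a =>
    refine ⟨1, fun K hK => ?_⟩
    obtain ⟨L, rfl⟩ := Nat.exists_eq_add_of_le' hK
    rw [Finset.sum_range_succ', Finset.sum_eq_zero, elementary_zero, skew_one]
    · simp [plethSubOne]
    · intro k _
      have : skew (elementary (k + 1)) (MvPolynomial.C a) = 0 := by
        refine hall_nondegenerate fun H => ?_
        have h0 : MvPolynomial.constantCoeff (elementary (k + 1)) = 0 := by
          rw [MvPolynomial.constantCoeff_eq, coeff_elementary, if_neg (by simp)]
        rw [hall_skew, MvPolynomial.C_apply, hall_monomial, ← MvPolynomial.constantCoeff_eq,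
          map_mul, h0]
        simp
      rw [this, smul_zero]
  | add p q hp hq =>
    obtain ⟨K₁, h₁⟩ := hp
    obtain ⟨K₂, h₂⟩ := hq
    refine ⟨max K₁ K₂, fun K hK => ?_⟩
    rw [map_add, ← h₁ K (le_trans (le_max_left _ _) hK), ← h₂ K (le_trans (le_max_right _ _) hK),
      ← Finset.sum_add_distrib]
    simp only [map_add, smul_add]
  | mul_X p j ih =>
    obtain ⟨K₀, h₀⟩ := ih
    refine ⟨K₀ + j, fun K hK => ?_⟩
    obtain ⟨L, rfl⟩ : ∃ L, K = j + L := Nat.exists_eq_add_of_le (by omega)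
    have h1 : ∑ k ∈ Finset.range (j + L), (-1 : ℚ) ^ k • skew (pderivScaled j (elementary k)) p
        = - plethSubOne p := by
      rw [Finset.sum_range_add, Finset.sum_eq_zero, zero_add, ← h₀ L (by omega),
        ← Finset.sum_neg_distrib]
      · refine Finset.sum_congr rfl fun k _ => ?_
        rw [pderivScaled_elementary, if_pos (by omega), skew_smul, smul_smul, ← pow_add,
          Nat.add_sub_cancel_left, show (j : ℕ) + k + (j + 1) = k + 2 * j + 1 by omega, pow_succ, pow_add,
          pow_mul]
        simp
      · intro k hk
        rw [pderivScaled_elementary, if_neg (by simpa using hk), skew_zero_left, smul_zero]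
    rw [mul_comm]
    simp only [skew_X_mul, smul_add]
    rw [Finset.sum_add_distrib, h1]
    simp only [← mul_smul_comm]
    rw [← Finset.mul_sum, h₀ _ (by omega), map_mul, plethSubOne, MvPolynomial.aeval_X]
    ring

theorem plethOneAdd_plethSubOne (F : SymFun) : plethOneAdd (plethSubOne F) = F := by
  have : plethOneAdd.comp plethSubOne = AlgHom.id ℚ SymFun := by
    ext1 k
    simp [plethOneAdd, plethSubOne]
  exact DFunLike.congr_fun this F

/-- The vanishing hypothesis truncates the sum at `n`; the substitution `p_j ↦ 1 + p_j` then inverts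
`p_j ↦ p_j - 1`. -/
theorem sum_plethOneAdd_skew {F : SymFun} {n : ℕ} (h : ∀ k ≥ n, skew (elementary k) F = 0) :
    ∑ k ∈ Finset.range n, (-1 : ℚ) ^ k • plethOneAdd (skew (elementary k) F) = F := by
  obtain ⟨K₀, h₀⟩ := sum_skew_elementary F
  have h1 := h₀ (max K₀ n) (le_max_left _ _)
  rw [← Finset.sum_subset (Finset.range_mono (le_max_right K₀ n))] at h1
  · have h2 := congrArg plethOneAdd h1
    rw [plethOneAdd_plethSubOne, map_sum] at h2
    simpa using h2
  · intro k _ hk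
    rw [h k (by simpa using hk), smul_zero]

/-! ### The coefficient of `e_n` -/

theorem contract_shifted (φ : SymFun →ₗ[ℚ] ℚ) (S : SymFun ⊗[ℚ] SymFun) :
    contract φ (shifted S) = plethOneAdd (contract φ S) := by
  induction S using TensorProduct.induction_on with
  | zero => simp [shifted]
  | tmul f g => simp [shifted]
  | add x y hx hy =>
    simp only [map_add, ← hx, ← hy]
    simp [shifted]

theorem isotypic_eq_contract {n : ℕ} (S : SymFun ⊗[ℚ] SymFun) (μ : n.Partition) :
    isotypic S μ = contract (hall.flip (schur μ)) S := rfl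

theorem contract_sum {ι : Type} (s : Finset ι) (c : ι → ℚ) (f : ι → SymFun)
    (S : SymFun ⊗[ℚ] SymFun) :
    contract (hall.flip (∑ k ∈ s, c k • f k)) S = ∑ k ∈ s, c k • contract (hall.flip (f k)) S := by
  induction S using TensorProduct.induction_on with
  | zero => simp
  | tmul f g => simp [Finset.sum_smul, mul_smul]
  | add x y hx hy =>
    simp only [map_add] at hx hy ⊢
    rw [hx, hy, ← Finset.sum_add_distrib]
    simp only [smul_add]

/-- The derivation `p_n^⊥` kills every `e_i` with `i < n`, hence every product in which all parts
are smaller than `n`. -/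
theorem hall_elementaryProd_X {n : ℕ+} (ν : (n : ℕ).Partition) :
    hall (elementaryProd ν) (MvPolynomial.X n)
      = if ν = Nat.Partition.indiscrete n then (-1) ^ ((n : ℕ) + 1) else 0 := by
  rw [hall_comm, ← mul_one (MvPolynomial.X n), hall_X_mul]
  split_ifs with h
  · subst h
    have h1 : elementaryProd (Nat.Partition.indiscrete (n : ℕ)) = elementary n := by
      simp [elementaryProd]
    rw [h1, pderivScaled_elementary, if_pos le_rfl, Nat.sub_self, elementary_zero, map_smul,
      ← MvPolynomial.C_1, MvPolynomial.C_apply, hall_monomial]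
    simp [zee]
  · have h1 : ∀ s : Multiset ℕ, (∀ i ∈ s, i < (n : ℕ)) →
        pderivScaled n (s.map elementary).prod = 0 := by
      intro s hs
      induction s using Multiset.induction with
      | empty => simp
      | cons a s ih =>
        rw [Multiset.map_cons, Multiset.prod_cons, Derivation.leibniz,
          ih fun i hi => hs i (Multiset.mem_cons_of_mem hi), pderivScaled_elementary,
          if_neg (not_le.2 (hs a (Multiset.mem_cons_self a s)))]
        simp
    rw [elementaryProd, h1, map_zero]
    intro i hi
    obtain ⟨t, ht⟩ := Multiset.exists_cons_of_mem hi
    have hsum := ν.parts_sum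
    rw [ht, Multiset.sum_cons] at hsum
    refine lt_of_le_of_ne (by omega) fun hin => h (Nat.Partition.ext ?_)
    have ht0 : t = 0 := by
      refine Multiset.eq_zero_of_forall_notMem fun j hj => ?_
      have h2 : 0 < j := ν.parts_pos (by rw [ht]; exact Multiset.mem_cons_of_mem hj)
      have h3 := Multiset.single_le_sum (fun x _ => Nat.zero_le x) j hj
      omega
    rw [Nat.Partition.indiscrete_parts n.ne_zero, ht, ht0, hin]
    rfl

/-- The coefficient of `e_n` in the expansion of `S[1 + 𝐪; 𝐳]`. -/
theorem expansion_indiscrete {n : ℕ} (hn : 0 < n) {S : SymFun ⊗[ℚ] SymFun} (hS : HookComponents n S)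
    (hA : ∀ k ≥ n, skew (elementary k) (alternant n S) = 0) {d : n.Partition → SymFun}
    (hd : IsElementaryExpansion (shifted S) d) :
    d (Nat.Partition.indiscrete n) = alternant n S := by
  lift n to ℕ+ using hn
  have h1 : contract (hall.flip (MvPolynomial.X n)) (shifted S)
      = (-1 : ℚ) ^ ((n : ℕ) + 1) • d (Nat.Partition.indiscrete n) := by
    rw [hd, map_sum]
    simp only [contract_tmul, LinearMap.flip_apply, hall_elementaryProd_X]
    rw [Finset.sum_eq_single (Nat.Partition.indiscrete (n : ℕ))]
    · rw [if_pos rfl]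
    · intro ν _ hν
      rw [if_neg hν, zero_smul]
    · simp
  -- With `p_n` expanded in hooks, the Hook Components property makes this the sum evaluated by
  -- `sum_plethOneAdd_skew`.
  have h2 : contract (hall.flip (MvPolynomial.X n)) (shifted S)
      = (-1 : ℚ) ^ ((n : ℕ) + 1) • alternant n S := by
    rw [contract_shifted, X_eq_sum_schur_hook, contract_sum, map_sum]
    conv_rhs => rw [← sum_plethOneAdd_skew hA, Finset.smul_sum, ← Fin.sum_univ_eq_sum_range
      fun k => (-1 : ℚ) ^ ((n : ℕ) + 1) • (-1 : ℚ) ^ k •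
        plethOneAdd (skew (elementary k) (alternant n S))]
    refine Finset.sum_congr rfl fun k _ => ?_
    have hk := k.2
    rw [← isotypic_eq_contract, hS k k.2, map_smul, smul_smul, ← pow_add]
    congr 1
    rw [show (n : ℕ) + 1 + k = ((n : ℕ) - 1 - k) + 2 * (k + 1) by omega, pow_add, pow_mul,
      neg_one_sq, one_pow, mul_one]
  have h3 := h1.symm.trans h2
  exact smul_right_injective _ (pow_ne_zero _ (by norm_num)) h3

/-! ### Frobenius characteristics of class functions -/

theorem powerSum_eq_prod (s : Multiset ℕ) :
    powerSum s = (s.map fun k => (MvPolynomial.X k.toPNat' : SymFun)).prod := by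
  induction s using Multiset.induction with
  | empty => simp [powerSum, exponent_zero]
  | cons a s ih =>
    rw [← Multiset.singleton_add, powerSum_add, ih, Multiset.singleton_add, Multiset.map_cons,
      Multiset.prod_cons]
    congr 1
    simp [powerSum, exponent, MvPolynomial.X]

theorem exponent_apply {s : Multiset ℕ} (hs : ∀ i ∈ s, 0 < i) (k : ℕ+) :
    exponent s k = s.count (k : ℕ) := by
  induction s using Multiset.induction with
  | empty => simp [exponent_zero]
  | cons a s ih =>
    rw [exponent_cons, Finsupp.add_apply, ih fun i hi => hs i (Multiset.mem_cons_of_mem hi),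
      Multiset.count_cons, add_comm, Finsupp.single_apply]
    have ha := hs a (Multiset.mem_cons_self a s)
    congr 1
    refine if_congr ⟨?_, ?_⟩ rfl rfl
    · rintro rfl; simp [ha]
    · intro h; rw [← h]; simp

theorem zee_exponent {s : Multiset ℕ} (hs : ∀ i ∈ s, 0 < i) :
    zee (exponent s) = (s.prod : ℚ) * ∏ i ∈ s.toFinset, ((s.count i).factorial : ℚ) := by
  rw [Finset.prod_multiset_count, zee, Finsupp.prod]
  push_cast
  rw [← Finset.prod_mul_distrib]
  refine Finset.prod_nbij (fun k : ℕ+ => (k : ℕ)) ?_ ?_ ?_ ?_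
  · intro k hk
    rw [Finsupp.mem_support_iff, exponent_apply hs] at hk
    exact Multiset.mem_toFinset.2 (Multiset.count_ne_zero.1 hk)
  · exact PNat.coe_injective.injOn
  · intro i hi
    have hi' := Multiset.mem_toFinset.1 hi
    obtain ⟨k, rfl⟩ : ∃ k : ℕ+, (k : ℕ) = i := ⟨⟨i, hs i hi'⟩, rfl⟩
    refine ⟨k, Finset.mem_coe.2 (Finsupp.mem_support_iff.2 ?_), rfl⟩
    rw [exponent_apply hs]
    exact Multiset.count_ne_zero.2 hi'
  · intro k _
    rw [exponent_apply hs]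

theorem zee_exponent_add_replicate {s : Multiset ℕ} (hs : ∀ i ∈ s, 1 < i) (r : ℕ) :
    zee (exponent (s + Multiset.replicate r 1)) = (r.factorial : ℚ) * zee (exponent s) := by
  induction r with
  | zero => simp
  | succ r ih =>
    have h1 : exponent (s + Multiset.replicate (r + 1) 1)
        = exponent (s + Multiset.replicate r 1) + Finsupp.single 1 1 := by
      rw [Multiset.replicate_succ, Multiset.add_cons, exponent_cons, add_comm]
      rfl
    have h2 : exponent (s + Multiset.replicate r 1) 1 = r := by
      rw [exponent_apply]
      · rw [Multiset.count_add, PNat.one_coe, Multiset.count_replicate_self,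
          Multiset.count_eq_zero_of_notMem fun h => lt_irrefl _ (hs 1 h), zero_add]
      · intro i hi
        rcases Multiset.mem_add.1 hi with h | h
        · exact zero_lt_one.trans (hs i h)
        · rw [Multiset.eq_of_mem_replicate h]; exact one_pos
    rw [h1, zee_add_single, h2, ih, Nat.factorial_succ]
    push_cast
    ring

section Perm

variable {α : Type} [Fintype α] [DecidableEq α]

/-- The power sum `p_{λ(σ)}`. -/
abbrev cyclePowerSum (σ : Equiv.Perm α) : SymFun := powerSum σ.partition.parts

/-- `z_λ` is the order of the centralizer. Cycle types omit the fixed points, whose factor `r!`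
comes from `zee_exponent_add_replicate`. -/
theorem card_isConj_mul_zee (σ : Equiv.Perm α) :
    ((Finset.univ.filter fun τ => IsConj σ τ).card : ℚ) * zee (exponent σ.partition.parts)
      = (Fintype.card α).factorial := by
  classical
  have h := Equiv.Perm.card_isConj_mul_eq σ
  have h1 : Nat.card {τ : Equiv.Perm α | IsConj σ τ}
      = (Finset.univ.filter fun τ => IsConj σ τ).card := by
    rw [Nat.card_eq_fintype_card, ← Fintype.card_subtype]
    rfl
  rw [h1] at h
  rw [Equiv.Perm.parts_partition,
    zee_exponent_add_replicate fun i hi => Equiv.Perm.one_lt_of_mem_cycleType hi,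
    zee_exponent fun i hi => zero_lt_one.trans (Equiv.Perm.one_lt_of_mem_cycleType hi),
    ← Equiv.Perm.sum_cycleType, ← h]
  push_cast
  ring

theorem hall_cyclePowerSum (σ τ : Equiv.Perm α) :
    hall (cyclePowerSum σ) (cyclePowerSum τ)
      = if IsConj τ σ then zee (exponent τ.partition.parts) else 0 := by
  rw [cyclePowerSum, powerSum, hall_monomial, coeff_powerSum, one_mul, mul_ite, mul_one, mul_zero]
  refine ite_congr ?_ ?_ fun _ => rfl
  · rw [eq_iff_iff, Equiv.Perm.partition_eq_of_isConj]
    constructor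
    · intro h
      exact exponent_parts_injective h
    · intro h
      rw [h]
  · intro h
    rw [Equiv.Perm.partition_eq_of_isConj.1 h]

theorem cyclePowerSum_mem_homog (σ : Equiv.Perm α) : cyclePowerSum σ ∈ homog (Fintype.card α) :=
  powerSum_mem_homog _

/-- The Frobenius characteristic of a function on a symmetric group. -/
def ch (χ : Equiv.Perm α → ℚ) : SymFun :=
  ((Fintype.card α).factorial : ℚ)⁻¹ • ∑ τ, χ τ • cyclePowerSum τ

theorem ch_mem_homog (χ : Equiv.Perm α → ℚ) : ch χ ∈ homog (Fintype.card α) :=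
  Submodule.smul_mem _ _ (Submodule.sum_mem _ fun _ _ =>
    Submodule.smul_mem _ _ (cyclePowerSum_mem_homog _))

theorem ch_sub (χ ψ : Equiv.Perm α → ℚ) : ch (χ - ψ) = ch χ - ch ψ := by
  simp only [ch, Pi.sub_apply, sub_smul, Finset.sum_sub_distrib, smul_sub]

theorem hall_ch_cyclePowerSum {χ : Equiv.Perm α → ℚ} (hχ : ∀ σ τ, IsConj σ τ → χ σ = χ τ)
    (σ : Equiv.Perm α) : hall (ch χ) (cyclePowerSum σ) = χ σ := by
  rw [ch, map_smul, LinearMap.smul_apply, map_sum, LinearMap.sum_apply]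
  simp only [map_smul, LinearMap.smul_apply, hall_cyclePowerSum, smul_eq_mul, mul_ite, mul_zero]
  rw [← Finset.sum_filter]
  have h1 : ∀ τ ∈ Finset.univ.filter (fun τ => IsConj σ τ),
      χ τ * zee (exponent σ.partition.parts) = χ σ * zee (exponent σ.partition.parts) := by
    intro τ hτ
    rw [hχ σ τ (Finset.mem_filter.1 hτ).2]
  have h2 := card_isConj_mul_zee σ
  have h3 : ((Fintype.card α).factorial : ℚ) ≠ 0 := by positivity
  rw [Finset.sum_congr rfl h1, Finset.sum_const, nsmul_eq_mul, mul_left_comm _ (χ σ), h2]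
  field_simp

theorem hall_ch {χ : Equiv.Perm α → ℚ} (hχ : ∀ σ τ, IsConj σ τ → χ σ = χ τ)
    (ψ : Equiv.Perm α → ℚ) :
    hall (ch χ) (ch ψ) = ((Fintype.card α).factorial : ℚ)⁻¹ * ∑ τ, ψ τ * χ τ := by
  conv_lhs => rw [ch.eq_def ψ]
  rw [map_smul, map_sum, smul_eq_mul]
  simp only [map_smul, hall_ch_cyclePowerSum hχ, smul_eq_mul]

theorem exists_partition_eq (l : (Fintype.card α).Partition) :
    ∃ σ : Equiv.Perm α, σ.partition = l := by
  have h1 : l.parts = l.parts.filter (2 ≤ ·) + l.parts.filter (fun i => ¬ 2 ≤ i) :=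
    (Multiset.filter_add_not _ _).symm
  have h2 : l.parts.filter (fun i => ¬ 2 ≤ i)
      = Multiset.replicate (Multiset.card (l.parts.filter (fun i => ¬ 2 ≤ i))) 1 := by
    refine Multiset.eq_replicate_card.2 fun i hi => ?_
    have h3 := Multiset.mem_filter.1 hi
    have h4 := l.parts_pos h3.1
    omega
  obtain ⟨σ, hσ⟩ := (Equiv.Perm.exists_with_cycleType_iff α (m := l.parts.filter (2 ≤ ·))).2
    ⟨by
      have h4 := l.parts_sum
      rw [h1, Multiset.sum_add] at h4
      omega, fun a ha => (Multiset.mem_filter.1 ha).2⟩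
  refine ⟨σ, Nat.Partition.ext ?_⟩
  rw [Equiv.Perm.parts_partition, hσ]
  conv_rhs => rw [h1]
  rw [h2]
  congr 2
  have h4 := l.parts_sum
  rw [h1, Multiset.sum_add, ← hσ, Equiv.Perm.sum_cycleType, h2, Multiset.sum_replicate] at h4
  simp only [smul_eq_mul, mul_one] at h4 ⊢
  omega

/-- Every homogeneous symmetric function is a Frobenius characteristic. -/
theorem eq_ch {F : SymFun} (hF : F ∈ homog (Fintype.card α)) :
    F = ch fun τ : Equiv.Perm α => hall (cyclePowerSum τ) F := by
  have hc : ∀ σ τ : Equiv.Perm α, IsConj σ τ →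
      hall (cyclePowerSum σ) F = hall (cyclePowerSum τ) F := by
    intro σ τ h
    rw [cyclePowerSum, cyclePowerSum, Equiv.Perm.partition_eq_of_isConj.1 h]
  refine hall_ext fun G => ?_
  induction G using MvPolynomial.induction_on' with
  | add p q hp hq => rw [map_add, map_add, hp, hq]
  | monomial u a =>
    have h0 : MvPolynomial.monomial u a = a • (MvPolynomial.monomial u 1 : SymFun) := by
      simp [MvPolynomial.smul_monomial]
    rw [h0, map_smul, map_smul]
    congr 1
    by_cases hu : wt u = Fintype.card α
    · obtain ⟨σ, hσ⟩ := exists_partition_eq (partitionOf u hu)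
      have h1 : (MvPolynomial.monomial u 1 : SymFun) = cyclePowerSum σ := by
        rw [cyclePowerSum, powerSum, hσ, exponent_partitionOf]
      rw [h1, hall_ch_cyclePowerSum hc, hall_comm]
    · have h1 : (MvPolynomial.monomial u 1 : SymFun) ∈ homog (wt u) :=
        MvPolynomial.isWeightedHomogeneous_monomial _ _ _ rfl
      rw [hall_eq_zero_of_ne (Ne.symm hu) hF h1, hall_eq_zero_of_ne (Ne.symm hu) (ch_mem_homog _) h1]

theorem hall_cyclePowerSum_elementary (σ : Equiv.Perm α) :
    hall (cyclePowerSum σ) (elementary (Fintype.card α)) = ((Equiv.Perm.sign σ : ℤ) : ℚ) := by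
  rw [cyclePowerSum, powerSum, hall_monomial, coeff_elementary, if_pos (wt_exponent_parts _),
    one_mul, mul_left_comm, mul_inv_cancel₀ (zee_ne_zero _), mul_one]
  have h1 : (exponent σ.partition.parts).degree = Multiset.card σ.partition.parts := by
    have := card_partitionOf (exponent σ.partition.parts) (wt_exponent_parts σ.partition)
    rw [← this]
    congr 2
    exact exponent_parts_injective (exponent_partitionOf _ _)
  have h2 : σ.support.card ≤ Fintype.card α := Finset.card_le_univ _
  rw [h1, Equiv.Perm.sign_of_cycleType, Equiv.Perm.parts_partition, Multiset.card_add,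
    Multiset.card_replicate, Equiv.Perm.sum_cycleType]
  push_cast
  rw [show Fintype.card α + (Multiset.card σ.cycleType + (Fintype.card α - σ.support.card))
    = σ.support.card + Multiset.card σ.cycleType + 2 * (Fintype.card α - σ.support.card) by omega,
    pow_add, pow_mul]
  simp

/-- Permutations of complementary subsets. -/
def glue {β γ : Type} {p : α → Prop} [DecidablePred p] (e : β ≃ {x // p x}) (e' : γ ≃ {x // ¬ p x})
    (π : Equiv.Perm β) (υ : Equiv.Perm γ) : Equiv.Perm α := π.extendDomain e * υ.extendDomain e'

theorem cyclePowerSum_glue {β γ : Type} [Fintype β] [DecidableEq β] [Fintype γ] [DecidableEq γ]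
    {p : α → Prop} [DecidablePred p] (e : β ≃ {x // p x}) (e' : γ ≃ {x // ¬ p x})
    (π : Equiv.Perm β) (υ : Equiv.Perm γ) :
    cyclePowerSum (glue e e' π υ) = cyclePowerSum π * cyclePowerSum υ := by
  have hd : (π.extendDomain e).Disjoint (υ.extendDomain e') := by
    intro x
    by_cases hx : p x
    · exact Or.inr (Equiv.Perm.extendDomain_apply_not_subtype _ _ (not_not.2 hx))
    · exact Or.inl (Equiv.Perm.extendDomain_apply_not_subtype _ _ hx)
  have hc : Fintype.card α = Fintype.card β + Fintype.card γ := by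
    rw [Fintype.card_congr e, Fintype.card_congr e', Fintype.card_subtype_compl]
    have := Fintype.card_subtype_le p
    omega
  rw [cyclePowerSum, cyclePowerSum, cyclePowerSum, ← powerSum_add]
  congr 1
  rw [glue, Equiv.Perm.parts_partition, Equiv.Perm.parts_partition, Equiv.Perm.parts_partition,
    hd.cycleType_mul, hd.card_support_mul, Equiv.Perm.cycleType_extendDomain,
    Equiv.Perm.cycleType_extendDomain, Equiv.Perm.card_support_extend_domain,
    Equiv.Perm.card_support_extend_domain, hc]
  have h1 : π.support.card ≤ Fintype.card β := Finset.card_le_univ _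
  have h2 : υ.support.card ≤ Fintype.card γ := Finset.card_le_univ _
  rw [show Fintype.card β + Fintype.card γ - (π.support.card + υ.support.card)
    = (Fintype.card β - π.support.card) + (Fintype.card γ - υ.support.card) by omega,
    Multiset.replicate_add]
  abel

/-- A criterion for the vanishing of `e_k^⊥`. -/
theorem skew_elementary_ch_eq_zero {χ : Equiv.Perm α → ℚ} (hχ : ∀ σ τ, IsConj σ τ → χ σ = χ τ)
    (k : ℕ) (h : ∀ (l : ℕ) (p : α → Prop) [DecidablePred p] (e : Fin k ≃ {x // p x})
      (e' : Fin l ≃ {x // ¬ p x}) (υ : Equiv.Perm (Fin l)),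
      ∑ π : Equiv.Perm (Fin k), ((Equiv.Perm.sign π : ℤ) : ℚ) * χ (glue e e' π υ) = 0) :
    skew (elementary k) (ch χ) = 0 := by
  refine hall_nondegenerate fun G => ?_
  rw [hall_skew]
  induction G using MvPolynomial.induction_on' with
  | add p q hp hq => rw [mul_add, map_add, hp, hq, add_zero]
  | monomial u a =>
    have h1 : (MvPolynomial.monomial u a : SymFun) ∈ homog (wt u) :=
      MvPolynomial.isWeightedHomogeneous_monomial _ _ _ rfl
    by_cases hu : Fintype.card α = k + wt u
    · set G : SymFun := MvPolynomial.monomial u a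
      have e₀ : Fin k ⊕ Fin (wt u) ≃ α := finSumFinEquiv.trans (Fintype.equivFinOfCardEq hu).symm
      let p : α → Prop := fun x => (e₀.symm x).isLeft
      have : DecidablePred p := Classical.decPred p
      let e : Fin k ≃ {x // p x} := Equiv.ofBijective
        (fun i => ⟨e₀ (Sum.inl i), by simp [p]⟩) ⟨fun i j hij => by simpa using hij, by
          rintro ⟨x, hx⟩
          obtain ⟨y, hy⟩ := Sum.isLeft_iff.1 hx
          exact ⟨y, Subtype.ext (by simp [← hy])⟩⟩
      let e' : Fin (wt u) ≃ {x // ¬ p x} := Equiv.ofBijective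
        (fun i => ⟨e₀ (Sum.inr i), by simp [p]⟩) ⟨fun i j hij => by simpa using hij, by
          rintro ⟨x, hx⟩
          obtain ⟨y, hy⟩ := Sum.isRight_iff.1 (by simpa [p] using hx)
          exact ⟨y, Subtype.ext (by simp [← hy])⟩⟩
      have h2 : elementary k = ch fun π : Equiv.Perm (Fin k) => ((Equiv.Perm.sign π : ℤ) : ℚ) := by
        have h3 := eq_ch (α := Fin k) (F := elementary k) (by simpa using elementary_mem_homog k)
        rw [h3]
        congr 1
        funext π
        simpa using hall_cyclePowerSum_elementary π
      have h3 := eq_ch (α := Fin (wt u)) (F := G) (by simpa using h1)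
      -- Frobenius reciprocity: `e_k` is the characteristic of the sign, and a product of
      -- characteristics is paired with `ch χ` by evaluating `χ` on glued permutations. For fixed
      -- `υ` the sum over `π` is the one in `h`.
      rw [h2, h3, ch.eq_def (α := Fin k), ch.eq_def (α := Fin (wt u)), smul_mul_smul_comm,
        Finset.sum_mul_sum, Finset.sum_comm, map_smul, map_sum, Finset.sum_eq_zero, smul_zero]
      intro υ _
      rw [map_sum]
      have h4 : ∀ π ∈ (Finset.univ : Finset (Equiv.Perm (Fin k))),
          hall (ch χ) (((Equiv.Perm.sign π : ℤ) : ℚ) • cyclePowerSum π *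
            hall (cyclePowerSum υ) G • cyclePowerSum υ)
          = hall (cyclePowerSum υ) G * (((Equiv.Perm.sign π : ℤ) : ℚ) * χ (glue e e' π υ)) := by
        intro π _
        rw [smul_mul_smul_comm, ← cyclePowerSum_glue e e', map_smul, hall_ch_cyclePowerSum hχ,
          smul_eq_mul]
        ring
      rw [Finset.sum_congr rfl h4, ← Finset.mul_sum, h (wt u) p e e' υ, mul_zero]
    · exact hall_eq_zero_of_ne hu (ch_mem_homog _)
        (MvPolynomial.IsWeightedHomogeneous.mul (elementary_mem_homog k) h1)

end Perm

/-! ### Colorings -/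

section Colorings

variable {ι : Type} [DecidableEq ι] {α : Type} [Fintype α] [DecidableEq α]

theorem coeff_seriesOn_prod {I : Type} [Fintype I] [DecidableEq I] (s : I → ℕ+) (d : ι →₀ ℕ) :
    MvPowerSeries.coeff d (seriesOn ι (∏ i, MvPolynomial.X (s i)))
      = ((Fintype.piFinset fun _ : I => d.support).filter
        fun c => ∑ i, Finsupp.single (c i) (s i : ℕ) = d).card := by
  classical
  rw [map_prod, MvPowerSeries.coeff_prod]
  simp only [coeff_seriesOn_X]
  have h0 : ∀ l : I →₀ ι →₀ ℕ,
      (∏ i, if ∃ j, l i = Finsupp.single j (s i : ℕ) then (1 : ℚ) else 0)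
        = if ∀ i, ∃ j, l i = Finsupp.single j (s i : ℕ) then 1 else 0 := by
    intro l
    rw [Finset.prod_ite_zero]
    simp
  rw [Finset.sum_congr rfl fun l _ => h0 l, Finset.sum_boole]
  congr 1
  symm
  refine Finset.card_nbij
    (fun c => Finsupp.equivFunOnFinite.symm fun i => Finsupp.single (c i) (s i : ℕ)) ?_ ?_ ?_
  · intro c hc
    rw [Finset.mem_coe, Finset.mem_filter, Finset.mem_finsuppAntidiag]
    refine ⟨⟨?_, Finset.subset_univ _⟩, fun i => ⟨c i, rfl⟩⟩
    exact (Finset.mem_filter.1 (Finset.mem_coe.1 hc)).2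
  · intro c _ c' _ h
    funext i
    exact (Finsupp.single_left_inj (s i).ne_zero).1 (DFunLike.congr_fun h i)
  · intro l hl
    have hl' := Finset.mem_filter.1 (Finset.mem_coe.1 hl)
    rw [Finset.mem_finsuppAntidiag] at hl'
    choose c hc using hl'.2
    have h1 : ∑ i, Finsupp.single (c i) (s i : ℕ) = d := by
      rw [← hl'.1.1]
      exact Finset.sum_congr rfl fun i _ => (hc i).symm
    refine ⟨c, Finset.mem_coe.2 (Finset.mem_filter.2 ⟨?_, h1⟩), ?_⟩
    · rw [Fintype.mem_piFinset]
      intro i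
      rw [Finsupp.mem_support_iff, ← h1, Finsupp.finsetSum_apply]
      have h2 : (Finsupp.single (c i) (s i : ℕ)) (c i) ≤ ∑ j, (Finsupp.single (c j) (s j : ℕ)) (c i) :=
        Finset.single_le_sum (f := fun j => (Finsupp.single (c j) (s j : ℕ)) (c i))
          (fun _ _ => Nat.zero_le _) (Finset.mem_univ i)
      rw [Finsupp.single_eq_same] at h2
      have := (s i).pos
      omega
    · ext1 i
      exact (hc i).symm

omit [DecidableEq ι] in
/-- The multiplicities of the colors in a coloring. -/
def content (g : α → ι) : ι →₀ ℕ := ∑ x, Finsupp.single (g x) 1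

/-- The colorings with given multiplicities of the colors. -/
def colorings (α : Type) [Fintype α] [DecidableEq α] (d : ι →₀ ℕ) : Finset (α → ι) :=
  (Fintype.piFinset fun _ : α => d.support).filter fun g => content g = d

omit [DecidableEq α] in
theorem content_apply (g : α → ι) (i : ι) :
    content g i = (Finset.univ.filter fun x => g x = i).card := by
  rw [content, Finsupp.finsetSum_apply, Finset.card_filter]
  exact Finset.sum_congr rfl fun x _ => Finsupp.single_apply

theorem mem_colorings {d : ι →₀ ℕ} {g : α → ι} : g ∈ colorings α d ↔ content g = d := by
  rw [colorings, Finset.mem_filter, and_iff_right_iff_imp, Fintype.mem_piFinset]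
  rintro rfl x
  rw [Finsupp.mem_support_iff, content_apply]
  exact Finset.card_ne_zero.2 ⟨x, by simp⟩

omit [DecidableEq ι] [DecidableEq α] in
theorem content_comp_perm (g : α → ι) (τ : Equiv.Perm α) : content (g ∘ τ) = content g :=
  Equiv.sum_comp τ fun x => Finsupp.single (g x) 1

omit [DecidableEq ι] [DecidableEq α] in
theorem degree_content (g : α → ι) : (content g).degree = Fintype.card α := by
  rw [content, map_sum]
  simp

omit [Fintype α] [DecidableEq α] [DecidableEq ι] in
theorem apply_eq_of_sameCycle [Finite α] {τ : Equiv.Perm α} {g : α → ι} (h : g ∘ τ = g) {x y : α}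
    (hxy : τ.SameCycle x y) : g x = g y := by
  obtain ⟨k, rfl⟩ := hxy.exists_nat_pow_eq
  clear hxy
  induction k with
  | zero => simp
  | succ k ih =>
    rw [pow_succ', Equiv.Perm.mul_apply, ih]
    exact (congrFun h _).symm

/-- The index set of the cycles of a permutation, including the fixed points. -/
abbrev Cycles (τ : Equiv.Perm α) : Type := {c // c ∈ τ.cycleFactorsFinset} ⊕ {x // τ x = x}

/-- The lengths of the cycles. -/
def cycleLength (τ : Equiv.Perm α) : Cycles τ → ℕ+ :=
  Sum.elim (fun c => c.1.support.card.toPNat') fun _ => 1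

/-- The cycle containing a given element. -/
def cycleAt (τ : Equiv.Perm α) (x : α) : Cycles τ :=
  if h : τ x = x then Sum.inr ⟨x, h⟩
  else Sum.inl ⟨τ.cycleOf x, Equiv.Perm.cycleOf_mem_cycleFactorsFinset_iff.2
    (Equiv.Perm.mem_support.2 h)⟩

theorem cycleAt_eq_inl {τ : Equiv.Perm α} {x : α} (c : {c // c ∈ τ.cycleFactorsFinset}) :
    cycleAt τ x = Sum.inl c ↔ x ∈ c.1.support := by
  rw [← Equiv.Perm.eq_cycleOf_of_mem_cycleFactorsFinset_iff τ c.1 c.2 x, cycleAt]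
  split_ifs with h
  · simp only [false_iff]
    intro h1
    have h2 := (Equiv.Perm.mem_cycleFactorsFinset_iff.1 c.2).1.ne_one
    rw [h1, Equiv.Perm.cycleOf_eq_one_iff τ |>.2 h] at h2
    exact h2 rfl
  · rw [Sum.inl.injEq, Subtype.ext_iff, eq_comm]

theorem cycleAt_eq_inr {τ : Equiv.Perm α} {x : α} (y : {x // τ x = x}) :
    cycleAt τ x = Sum.inr y ↔ x = y := by
  rw [cycleAt]
  split_ifs with h
  · rw [Sum.inr.injEq, Subtype.ext_iff]
  · simp only [false_iff]
    rintro rfl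
    exact h y.2

theorem card_cycleAt_fiber {τ : Equiv.Perm α} (i : Cycles τ) :
    (Finset.univ.filter fun x => cycleAt τ x = i).card = cycleLength τ i := by
  rcases i with c | y
  · simp only [cycleAt_eq_inl, cycleLength, Sum.elim_inl, Finset.filter_univ_mem]
    have h2 := (Equiv.Perm.mem_cycleFactorsFinset_iff.1 c.2).1.two_le_card_support
    rw [Nat.toPNat'_coe, if_pos (by omega)]
  · simp [cycleAt_eq_inr, cycleLength, Finset.filter_eq']

theorem cycleAt_surjective (τ : Equiv.Perm α) : Function.Surjective (cycleAt τ) := by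
  intro i
  have h := card_cycleAt_fiber i
  have h1 : (Finset.univ.filter fun x => cycleAt τ x = i).Nonempty := by
    rw [← Finset.card_pos, h]
    exact (cycleLength τ i).pos
  obtain ⟨x, hx⟩ := h1
  exact ⟨x, (Finset.mem_filter.1 hx).2⟩

theorem cycleAt_apply (τ : Equiv.Perm α) (x : α) : cycleAt τ (τ x) = cycleAt τ x := by
  rcases h : cycleAt τ x with c | y
  · rw [cycleAt_eq_inl] at h ⊢
    have h2 := (Equiv.Perm.mem_cycleFactorsFinset_iff.1 c.2).2 x h
    rw [← h2]
    exact Equiv.Perm.apply_mem_support.2 h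
  · rw [cycleAt_eq_inr] at h ⊢
    rw [h, y.2]

theorem sameCycle_of_cycleAt_eq {τ : Equiv.Perm α} {x y : α} (h : cycleAt τ x = cycleAt τ y) :
    τ.SameCycle x y := by
  rcases h1 : cycleAt τ y with c | z
  · have h2 := h.trans h1
    rw [cycleAt_eq_inl, ← Equiv.Perm.eq_cycleOf_of_mem_cycleFactorsFinset_iff τ c.1 c.2] at h1 h2
    have h3 : x ∈ τ.support := by
      rw [← Equiv.Perm.cycleOf_mem_cycleFactorsFinset_iff, ← h2]
      exact c.2
    have h4 : y ∈ τ.support := by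
      rw [← Equiv.Perm.cycleOf_mem_cycleFactorsFinset_iff, ← h1]
      exact c.2
    exact (Equiv.Perm.sameCycle_iff_cycleOf_eq_of_mem_support h3 h4).2 (h2.symm.trans h1)
  · have h2 := h.trans h1
    rw [cycleAt_eq_inr] at h1 h2
    rw [h1, h2]

theorem cyclePowerSum_eq_prod (τ : Equiv.Perm α) :
    cyclePowerSum τ = ∏ i, MvPolynomial.X (cycleLength τ i) := by
  have h1 : Fintype.card {x // τ x = x} = Fintype.card α - τ.support.card := by
    have h := Finset.card_compl τ.support
    rw [← h, Fintype.card_subtype]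
    congr 1
    ext x
    simp
  rw [cyclePowerSum, powerSum_eq_prod, Equiv.Perm.parts_partition, Multiset.map_add,
    Multiset.prod_add, Fintype.prod_sum_type]
  congr 1
  · rw [Equiv.Perm.cycleType_def, Multiset.map_map]
    exact (Finset.prod_coe_sort τ.cycleFactorsFinset
      fun c => (MvPolynomial.X c.support.card.toPNat' : SymFun)).symm
  · rw [Multiset.map_replicate, Multiset.prod_replicate]
    simp [cycleLength, h1]
    rfl

/-- The coefficients of `p_{λ(τ)}` count the colorings fixed by `τ`. -/
theorem coeff_cyclePowerSum (τ : Equiv.Perm α) (d : ι →₀ ℕ) :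
    MvPowerSeries.coeff d (seriesOn ι (cyclePowerSum τ))
      = ((colorings α d).filter fun g => g ∘ τ = g).card := by
  rw [cyclePowerSum_eq_prod, coeff_seriesOn_prod]
  congr 1
  have hcont : ∀ c : Cycles τ → ι,
      content (c ∘ cycleAt τ) = ∑ i, Finsupp.single (c i) (cycleLength τ i : ℕ) := by
    intro c
    rw [content, ← Finset.sum_fiberwise (s := Finset.univ) (g := cycleAt τ)]
    refine Finset.sum_congr rfl fun i _ => ?_
    rw [Finset.sum_congr rfl (g := fun _ => Finsupp.single (c i) 1), Finset.sum_const,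
      card_cycleAt_fiber, Finsupp.smul_single, smul_eq_mul, mul_one]
    intro x hx
    rw [Function.comp_apply, (Finset.mem_filter.1 hx).2]
  -- A coloring is fixed by `τ` exactly when it is constant on cycles, so it amounts to a coloring
  -- of the cycles.
  refine Finset.card_nbij (fun c => c ∘ cycleAt τ) ?_ ?_ ?_
  · intro c hc
    rw [Finset.mem_coe, Finset.mem_filter, mem_colorings, hcont]
    refine ⟨(Finset.mem_filter.1 (Finset.mem_coe.1 hc)).2, ?_⟩
    funext x
    simp only [Function.comp_apply, cycleAt_apply]
  · intro c _ c' _ h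
    exact (cycleAt_surjective τ).injective_comp_right h
  · intro g hg
    have hg' := Finset.mem_filter.1 (Finset.mem_coe.1 hg)
    obtain ⟨r, hr⟩ := (cycleAt_surjective τ).hasRightInverse
    have h1 : (g ∘ r) ∘ cycleAt τ = g := by
      funext x
      exact apply_eq_of_sameCycle hg'.2 (sameCycle_of_cycleAt_eq (hr _))
    refine ⟨g ∘ r, Finset.mem_coe.2 (Finset.mem_filter.2 ⟨?_, ?_⟩), h1⟩
    · have h2 := (Finset.mem_filter.1 hg'.1).1
      rw [Fintype.mem_piFinset] at h2 ⊢
      exact fun i => h2 _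
    · rw [← hcont, h1]
      exact mem_colorings.1 hg'.1

omit [DecidableEq α] in
theorem exists_perm_of_content_eq {g g' : α → ι} (h : content g = content g') :
    ∃ π : Equiv.Perm α, g ∘ π = g' := by
  have h1 : ∀ i, Nonempty ({x // g' x = i} ≃ {x // g x = i}) := by
    intro i
    refine ⟨Fintype.equivOfCardEq ?_⟩
    rw [Fintype.card_subtype, Fintype.card_subtype, ← content_apply, ← content_apply, h]
  refine ⟨Equiv.ofFiberEquiv fun i => (h1 i).some, ?_⟩
  funext x
  exact Equiv.ofFiberEquiv_map _ x

/-- The permutations that fix a coloring. -/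
def colorStabilizer (g : α → ι) : Finset (Equiv.Perm α) := Finset.univ.filter fun τ => g ∘ τ = g

/-- Orbit-stabilizer: `π ↦ g₀ ∘ π` maps the group onto the colorings of content `d`, and the fibre
over `g` is a coset of the stabilizer of `g`. -/
theorem sum_card_colorStabilizer {d : ι →₀ ℕ} (hd : (colorings α d).Nonempty) :
    ∑ g ∈ colorings α d, (colorStabilizer g).card = (Fintype.card α).factorial := by
  obtain ⟨g₀, hg₀⟩ := hd
  have hg₀' := mem_colorings.1 hg₀
  rw [← Fintype.card_perm, ← Finset.card_univ]
  rw [Finset.card_eq_sum_card_fiberwise (f := fun π : Equiv.Perm α => g₀ ∘ π) (t := colorings α d)]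
  · refine Finset.sum_congr rfl fun g hg => ?_
    obtain ⟨π₀, hπ₀⟩ := exists_perm_of_content_eq (hg₀'.trans (mem_colorings.1 hg).symm)
    refine Finset.card_nbij (fun τ => π₀ * τ) ?_ ?_ ?_
    · intro τ hτ
      have := (Finset.mem_filter.1 (Finset.mem_coe.1 hτ)).2
      refine Finset.mem_coe.2 <| Finset.mem_filter.2 ⟨Finset.mem_univ _, ?_⟩
      rw [Equiv.Perm.coe_mul, ← Function.comp_assoc, hπ₀, this]
    · exact (mul_right_injective π₀).injOn
    · intro π hπ
      have := (Finset.mem_filter.1 (Finset.mem_coe.1 hπ)).2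
      refine ⟨π₀⁻¹ * π, Finset.mem_coe.2 (Finset.mem_filter.2 ⟨Finset.mem_univ _, ?_⟩), by simp⟩
      funext x
      have h1 : g ((π₀⁻¹ * π) x) = g₀ (π x) := by
        rw [← hπ₀]
        simp
      exact h1.trans (congrFun this x)
  · intro π _
    rw [Finset.mem_coe, mem_colorings, content_comp_perm, hg₀']

/-- The coefficients of a Frobenius characteristic. -/
theorem coeff_ch {χ : Equiv.Perm α → ℚ} {d : ι →₀ ℕ} {v : ℚ} (hd : (colorings α d).Nonempty)
    (h : ∀ g ∈ colorings α d, ∑ τ ∈ colorStabilizer g, χ τ = (colorStabilizer g).card * v) :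
    MvPowerSeries.coeff d (seriesOn ι (ch χ)) = v := by
  -- The pairs `(τ, g)` with `g ∘ τ = g` are summed in both orders.
  have h1 : ∑ τ, χ τ * ((colorings α d).filter fun g => g ∘ τ = g).card
      = ∑ g ∈ colorings α d, ∑ τ ∈ colorStabilizer g, χ τ := by
    simp only [colorStabilizer, Finset.sum_filter, Finset.card_filter]
    push_cast
    simp only [Finset.mul_sum]
    rw [Finset.sum_comm]
    refine Finset.sum_congr rfl fun g _ => Finset.sum_congr rfl fun τ _ => ?_
    split_ifs <;> simp
  have h2 : ((Fintype.card α).factorial : ℚ) ≠ 0 := by positivity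
  rw [ch, map_smul, map_smul, map_sum, map_sum]
  simp only [map_smul, coeff_cyclePowerSum, smul_eq_mul]
  rw [h1, Finset.sum_congr rfl h, ← Finset.sum_mul, ← Nat.cast_sum, sum_card_colorStabilizer hd]
  field_simp

theorem coeff_ch_eq_zero {χ : Equiv.Perm α → ℚ} {d : ι →₀ ℕ} (hd : d.degree ≠ Fintype.card α) :
    MvPowerSeries.coeff d (seriesOn ι (ch χ)) = 0 := by
  rw [ch, map_smul, map_smul, map_sum, map_sum, Finset.sum_eq_zero, smul_zero]
  intro τ _
  rw [map_smul, map_smul, coeff_cyclePowerSum, Finset.filter_eq_empty_iff.2, Finset.card_empty,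
    Nat.cast_zero, smul_zero]
  intro g hg
  exact absurd ((congrArg _ (mem_colorings.1 hg)).symm.trans (degree_content g)) hd

theorem colorings_nonempty {d : ι →₀ ℕ} {m : ℕ} (hd : d.degree = m) :
    (colorings (Fin m) d).Nonempty := by
  induction m generalizing d with
  | zero =>
    rw [Finsupp.degree_eq_zero_iff] at hd
    exact ⟨Fin.elim0, mem_colorings.2 (by rw [hd, content, Finset.univ_eq_empty, Finset.sum_empty])⟩
  | succ m ih =>
    have h0 : d ≠ 0 := by
      rintro rfl
      simp at hd
    obtain ⟨i, hi⟩ := Finsupp.ne_iff.1 h0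
    have h1 : Finsupp.single i 1 ≤ d := by
      rw [Finsupp.single_le_iff]
      exact Nat.one_le_iff_ne_zero.2 hi
    have h2 := tsub_add_cancel_of_le h1
    have h3 : (d - Finsupp.single i 1).degree = m := by
      have := congrArg Finsupp.degree h2
      rw [map_add, Finsupp.degree_single, hd] at this
      omega
    obtain ⟨g, hg⟩ := ih h3
    refine ⟨Fin.cons i g, mem_colorings.2 ?_⟩
    rw [content, Fin.sum_univ_succ, ← h2, add_comm]
    simp only [Fin.cons_zero, Fin.cons_succ]
    rw [← mem_colorings.1 hg, content]

end Colorings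

/-! ### The modules generated by hook determinants -/

section HookModule

variable {n : ℕ}

theorem hookModule_isStable (n a : ℕ) : IsStable (hookModule n a) := by
  unfold hookModule
  split_ifs
  · constructor
    · intro u i F hF
      rw [Submodule.mem_sInf] at hF ⊢
      exact fun N hN => hN.2.deriv_mem u i F (hF N hN)
    · intro u v r hr F hF
      rw [Submodule.mem_sInf] at hF ⊢
      exact fun N hN => hN.2.polarize_mem u v r hr F (hF N hN)
  · constructor
    · intro u i F hF
      rw [(Submodule.mem_bot ℚ).1 hF, map_zero]
      exact zero_mem _
    · intro u v r _ F hF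
      rw [(Submodule.mem_bot ℚ).1 hF, polarize, Finset.sum_eq_zero]
      · exact zero_mem _
      · intro i _
        rw [Function.iterate_fixed (map_zero _), mul_zero]

theorem hookDet_mem_hookModule {a : ℕ} (ha : a < n) : hookDet n a ∈ hookModule n a := by
  rw [hookModule, if_pos ha, Submodule.mem_sInf]
  exact fun N hN => hN.1

theorem hookModule_le {a : ℕ} {N : Submodule ℚ (Poly n)} (h : a < n → hookDet n a ∈ N)
    (hN : IsStable N) : hookModule n a ≤ N := by
  unfold hookModule
  split_ifs with ha
  · exact sInf_le ⟨h ha, hN⟩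
  · exact bot_le

theorem iterate_pderiv_monomial {σ : Type*} (v : σ) (r : ℕ) (u : σ →₀ ℕ) (c : ℚ) :
    (MvPolynomial.pderiv v)^[r] (MvPolynomial.monomial u c)
      = MvPolynomial.monomial (u - Finsupp.single v r) (c * ((u v).descFactorial r : ℚ)) := by
  classical
  induction r with
  | zero => simp
  | succ r ih =>
    rw [Function.iterate_succ_apply', ih, MvPolynomial.pderiv_monomial, tsub_tsub,
      ← Finsupp.single_add, Finsupp.tsub_apply, Finsupp.single_eq_same, Nat.descFactorial_succ]
    push_cast
    rw [mul_comm ((u v - r : ℕ) : ℚ), mul_assoc]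

/-- The exponent vectors of degree at most `B` that contain exactly one of the `θ_j`, with
exponent `1`, and no variable in the column `j`. -/
def hookSupport (n B : ℕ) : Set (Var n →₀ ℕ) :=
  {u | u.degree ≤ B ∧ ∃ j, (∀ i, u (Sum.inr i) = if i = j then 1 else 0) ∧
    ∀ r, u (Sum.inl (r, j)) = 0}

theorem sub_single_mem_hookSupport {B : ℕ} {u : Var n →₀ ℕ} (hu : u ∈ hookSupport n B)
    (r k : ℕ) (i : Fin n) : u - Finsupp.single (Sum.inl (r, i)) k ∈ hookSupport n B := by
  classical
  obtain ⟨h1, j, h2, h3⟩ := hu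
  refine ⟨(Finsupp.degree_mono tsub_le_self).trans h1, j, ?_, ?_⟩
  · intro i'
    rw [Finsupp.tsub_apply, Finsupp.single_eq_of_ne (by simp), tsub_zero, h2]
  · intro r'
    rw [Finsupp.tsub_apply, h3, zero_tsub]

/-- A polarization removes `k ≥ 1` factors from a column and puts one back in the same column. The
degree does not grow, and the column was already occupied, so it is not the column of `θ_j`. -/
theorem isStable_restrictSupport (n B : ℕ) :
    IsStable (MvPolynomial.restrictSupport ℚ (hookSupport n B)) := by
  classical
  constructor
  · intro r i F hF
    suffices h : MvPolynomial.restrictSupport ℚ (hookSupport n B) ≤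
        (MvPolynomial.restrictSupport ℚ (hookSupport n B)).comap
          (MvPolynomial.pderiv (R := ℚ) (Sum.inl (r, i) : Var n)).toLinearMap from h hF
    conv_lhs => rw [MvPolynomial.restrictSupport_eq_span]
    rw [Submodule.span_le]
    rintro _ ⟨u, hu, rfl⟩
    change MvPolynomial.pderiv (R := ℚ) (Sum.inl (r, i) : Var n) _ ∈
      MvPolynomial.restrictSupport ℚ (hookSupport n B)
    rw [MvPolynomial.pderiv_monomial, MvPolynomial.monomial_mem_restrictSupport]
    exact Or.inl (sub_single_mem_hookSupport hu _ _ _)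
  · intro r r' k hk F hF
    refine Submodule.sum_mem (MvPolynomial.restrictSupport ℚ (hookSupport n B)) fun i _ => ?_
    suffices h : MvPolynomial.restrictSupport ℚ (hookSupport n B) ≤
        (MvPolynomial.restrictSupport ℚ (hookSupport n B)).comap
          (LinearMap.mulLeft ℚ (MvPolynomial.X (R := ℚ) (Sum.inl (r', i) : Var n)) ∘ₗ
            (MvPolynomial.pderiv (R := ℚ) (Sum.inl (r, i) : Var n)).toLinearMap ^ k) by
      have h1 := h hF
      rw [Submodule.mem_comap, LinearMap.comp_apply, Module.End.pow_apply] at h1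
      exact h1
    conv_lhs => rw [MvPolynomial.restrictSupport_eq_span]
    rw [Submodule.span_le]
    rintro _ ⟨u, hu, rfl⟩
    rw [SetLike.mem_coe, Submodule.mem_comap, LinearMap.comp_apply, Module.End.pow_apply]
    change MvPolynomial.X (R := ℚ) (Sum.inl (r', i) : Var n) *
      (MvPolynomial.pderiv (R := ℚ) (Sum.inl (r, i) : Var n))^[k] _ ∈
        MvPolynomial.restrictSupport ℚ (hookSupport n B)
    rw [iterate_pderiv_monomial, MvPolynomial.X, MvPolynomial.monomial_mul,
      MvPolynomial.monomial_mem_restrictSupport]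
    -- With fewer than `k` factors to remove, the falling factorial, and with it the whole term, is
    -- zero.
    rcases lt_or_ge (u (Sum.inl (r, i))) k with hlt | hge
    · right
      rw [Nat.descFactorial_of_lt hlt]
      simp
    · left
      obtain ⟨h1, j, h2, h3⟩ := sub_single_mem_hookSupport hu r k i
      obtain ⟨h1', j', h2', h3'⟩ := hu
      have hj : j = j' := by
        have h4 := h2 j
        rw [Finsupp.tsub_apply, Finsupp.single_eq_of_ne (by simp), tsub_zero, h2', if_pos rfl] at h4
        by_contra h
        rw [if_neg h] at h4
        exact absurd h4 (by norm_num)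
      subst hj
      have hi : i ≠ j := by
        rintro rfl
        rw [h3'] at hge
        omega
      refine ⟨?_, j, ?_, ?_⟩
      · have h5 : Finsupp.single (Sum.inl (r, i)) k ≤ u := Finsupp.single_le_iff.2 hge
        have h6 := congrArg Finsupp.degree (tsub_add_cancel_of_le h5)
        rw [map_add, Finsupp.degree_single] at h6
        rw [map_add, Finsupp.degree_single]
        omega
      · intro i'
        rw [Finsupp.add_apply, h2, Finsupp.single_eq_of_ne (by simp), zero_add]
      · intro r''
        rw [Finsupp.add_apply, h3, Finsupp.single_eq_of_ne (by simp [hi.symm]), zero_add]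

/-- Each Leibniz term takes `θ` from one row of the matrix and powers of `x` from the other rows. -/
theorem exists_hookDet_mem_restrictSupport (n a : ℕ) (hn : 0 < n) :
    ∃ B, hookDet n a ∈ MvPolynomial.restrictSupport ℚ (hookSupport n B) := by
  classical
  obtain ⟨k, rfl⟩ : ∃ k, n = k + 1 := ⟨n - 1, by omega⟩
  let e : Fin k → ℕ := fun i => if (i.succ : ℕ) ≤ a then (i.succ : ℕ) - 1 else (i.succ : ℕ)
  refine ⟨1 + ∑ i, e i, ?_⟩
  rw [hookDet, Matrix.det_apply]
  refine sum_mem fun π _ => ?_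
  rw [Units.smul_def]
  refine zsmul_mem ?_ _
  have h : (∏ i : Fin (k + 1), (Matrix.of fun i j : Fin (k + 1) =>
      if (j : ℕ) = 0 then MvPolynomial.X (Sum.inr i)
      else (MvPolynomial.X (Sum.inl (0, i)) : Poly (k + 1)) ^
        (if (j : ℕ) ≤ a then (j : ℕ) - 1 else j)) (π i) i)
      = MvPolynomial.monomial (Finsupp.single (Sum.inr (π 0)) 1 +
        ∑ i, Finsupp.single (Sum.inl (0, π i.succ)) (e i)) 1 := by
    have h1 : (MvPolynomial.monomial (Finsupp.single (Sum.inr (π 0)) 1 +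
        ∑ i, Finsupp.single (Sum.inl (0, π i.succ)) (e i)) 1 : Poly (k + 1))
        = MvPolynomial.X (Sum.inr (π 0)) *
          ∏ i : Fin k, MvPolynomial.X (Sum.inl (0, π i.succ)) ^ e i := by
      rw [← one_mul (1 : ℚ), ← MvPolynomial.monomial_mul, MvPolynomial.monomial_sum_one]
      simp only [MvPolynomial.X_pow_eq_monomial]
      rfl
    rw [h1, Fin.prod_univ_succ]
    simp only [Matrix.of_apply]
    rw [if_pos (Fin.val_zero _)]
    congr 1
  rw [h, MvPolynomial.monomial_mem_restrictSupport]
  left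
  refine ⟨?_, π 0, ?_, ?_⟩
  · rw [map_add, map_sum, Finsupp.degree_single]
    simp
  · intro i
    rw [Finsupp.add_apply, Finsupp.finsetSum_apply, Finset.sum_eq_zero, add_zero,
      Finsupp.single_apply]
    · simp [eq_comm]
    · intro j _
      exact Finsupp.single_eq_of_ne (by simp)
  · intro r
    rw [Finsupp.add_apply, Finsupp.finsetSum_apply, Finset.sum_eq_zero, add_zero,
      Finsupp.single_eq_of_ne (by simp)]
    intro j _
    refine Finsupp.single_eq_of_ne ?_
    simp [Fin.succ_ne_zero, eq_comm]

theorem exists_hookModule_le (n a : ℕ) (hn : 0 < n) :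
    ∃ B, hookModule n a ≤ MvPolynomial.restrictSupport ℚ (hookSupport n B) := by
  obtain ⟨B, hB⟩ := exists_hookDet_mem_restrictSupport n a hn
  exact ⟨B, hookModule_le (fun _ => hB) (isStable_restrictSupport n B)⟩

theorem derivation_det {R A : Type*} [CommRing R] [CommRing A] [Algebra R A]
    (D : Derivation R A A) {ι : Type} [Fintype ι] [DecidableEq ι] (M : Matrix ι ι A) :
    D M.det = ∑ c, (M.updateCol c fun i => D (M i c)).det := by
  simp only [Matrix.det_apply, map_sum, Units.smul_def, map_zsmul, derivation_prod]
  rw [Finset.sum_comm]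
  refine Finset.sum_congr rfl fun π _ => ?_
  rw [← Finset.smul_sum]
  congr 1
  refine Finset.sum_congr rfl fun c _ => ?_
  rw [← Finset.mul_prod_erase _ _ (Finset.mem_univ c), Matrix.updateCol_self]
  congr 1
  refine Finset.prod_congr rfl fun i hi => ?_
  rw [Matrix.updateCol_ne (Finset.ne_of_mem_erase hi)]

/-- The sum of the derivations in the variables of the row `0`. -/
def rowDerivation (n : ℕ) : Derivation ℚ (Poly n) (Poly n) :=
  ∑ i : Fin n, MvPolynomial.pderiv (Sum.inl (0, i))

theorem rowDerivation_apply (F : Poly n) :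
    rowDerivation n F = ∑ i : Fin n, MvPolynomial.pderiv (Sum.inl (0, i)) F := by
  have h := map_sum (Derivation.coeFnAddMonoidHom (R := ℚ) (A := Poly n) (M := Poly n))
    (fun i : Fin n => MvPolynomial.pderiv (Sum.inl (0, i) : Var n)) Finset.univ
  exact (congrFun h F).trans (Finset.sum_apply _ _ _)

/-- Differentiating the column `x^e` gives `e x^(e-1)`, which repeats another column or is zero
unless `e - 1` is the omitted exponent `a`. Only the column `x^(a+1)` contributes; it becomes `x^a`,
and `a + 1` is now omitted. -/
theorem rowDerivation_hookDet {a : ℕ} (ha : a + 1 < n) :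
    rowDerivation n (hookDet n a) = ((a + 1 : ℕ) : ℚ) • hookDet n (a + 1) := by
  have hX : ∀ i : Fin n, rowDerivation n (MvPolynomial.X (Sum.inl (0, i))) = 1 := by
    intro i
    rw [rowDerivation_apply, Finset.sum_eq_single i, MvPolynomial.pderiv_X_self]
    · intro j _ hj
      exact MvPolynomial.pderiv_X_of_ne (by simp [hj.symm])
    · simp
  have hθ : ∀ i : Fin n, rowDerivation n (MvPolynomial.X (Sum.inr i)) = 0 := by
    intro i
    rw [rowDerivation_apply]
    exact Finset.sum_eq_zero fun j _ => MvPolynomial.pderiv_X_of_ne (by simp)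
  let e : ℕ → ℕ → ℕ := fun a j => if j ≤ a then j - 1 else j
  obtain ⟨M, hM⟩ : ∃ M : ℕ → Matrix (Fin n) (Fin n) (Poly n), ∀ b i j, M b i j =
      if (j : ℕ) = 0 then MvPolynomial.X (Sum.inr i)
      else (MvPolynomial.X (Sum.inl (0, i)) : Poly n) ^ e b j :=
    ⟨fun b => Matrix.of fun i j => if (j : ℕ) = 0 then MvPolynomial.X (Sum.inr i)
      else (MvPolynomial.X (Sum.inl (0, i)) : Poly n) ^ e b j, fun _ _ _ => rfl⟩
  have hD : ∀ b, hookDet n b = (M b).det := by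
    intro b
    rw [hookDet]
    congr 1
    ext1 i j
    exact (hM b i j).symm
  have hDM : ∀ i (c : Fin n), (c : ℕ) ≠ 0 → rowDerivation n (M a i c)
      = (e a c : Poly n) * (MvPolynomial.X (Sum.inl (0, i)) : Poly n) ^ (e a c - 1) := by
    intro i c hc
    rw [hM, if_neg hc, Derivation.leibniz_pow, hX, smul_eq_mul, mul_one, nsmul_eq_mul]
  rw [hD, hD, derivation_det, Finset.sum_eq_single ⟨a + 1, ha⟩]
  · have h1 : (fun i => rowDerivation n (M a i ⟨a + 1, ha⟩))
        = ((a + 1 : ℕ) : Poly n) • fun i => (MvPolynomial.X (Sum.inl (0, i)) : Poly n) ^ a := by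
      funext i
      rw [hDM _ _ (Nat.succ_ne_zero a), Pi.smul_apply, smul_eq_mul]
      simp [e]
    have h2 : (M a).updateCol ⟨a + 1, ha⟩
        (fun i => (MvPolynomial.X (Sum.inl (0, i)) : Poly n) ^ a) = M (a + 1) := by
      ext1 i j
      by_cases hj : j = ⟨a + 1, ha⟩
      · subst hj
        rw [Matrix.updateCol_self, hM, if_neg (Nat.succ_ne_zero a)]
        simp [e]
      · have hj' : (j : ℕ) ≠ a + 1 := fun h => hj (Fin.ext h)
        have h3 : e a j = e (a + 1) j := by
          simp only [e]
          split_ifs <;> omega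
        rw [Matrix.updateCol_ne hj, hM, hM, h3]
    rw [h1, Matrix.det_updateCol_smul, h2, ← nsmul_eq_mul, Nat.cast_smul_eq_nsmul]
  · intro c _ hc
    have hc' : (c : ℕ) ≠ a + 1 := fun h => hc (Fin.ext h)
    rcases Nat.eq_zero_or_pos (c : ℕ) with h0 | h0
    · refine Matrix.det_eq_zero_of_column_eq_zero c fun i => ?_
      rw [Matrix.updateCol_self, hM, if_pos h0, hθ]
    · by_cases h1 : (c : ℕ) = 1
      · refine Matrix.det_eq_zero_of_column_eq_zero c fun i => ?_
        rw [Matrix.updateCol_self, hDM _ _ h0.ne']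
        have : e a c = 0 := by
          simp only [e]
          split_ifs <;> omega
        rw [this, Nat.cast_zero, zero_mul]
      · let c' : Fin n := ⟨c - 1, by omega⟩
        have hcc : c' ≠ c := fun h => by
          have := congrArg Fin.val h
          simp only [c'] at this
          omega
        have h2 : (fun i => rowDerivation n (M a i c)) = (e a c : Poly n) • fun i => M a i c' := by
          funext i
          have h3 : e a c - 1 = e a c' := by
            simp only [e, c']
            split_ifs <;> omega
          rw [hDM _ _ h0.ne', Pi.smul_apply, smul_eq_mul, hM, if_neg (by simp only [c']; omega), h3]
        rw [h2, Matrix.det_updateCol_smul, Matrix.det_zero_of_column_eq hcc, mul_zero]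
        intro i
        rw [Matrix.updateCol_self, Matrix.updateCol_ne hcc]
  · simp

/-- This nesting turns the difference of characters in `S_ρ` into the character of a quotient, the
source of positivity. -/
theorem hookModule_succ_le (n a : ℕ) : hookModule n (a + 1) ≤ hookModule n a := by
  refine hookModule_le (fun ha => ?_) (hookModule_isStable n a)
  have h1 : rowDerivation n (hookDet n a) ∈ hookModule n a := by
    rw [rowDerivation_apply]
    exact sum_mem fun i _ => (hookModule_isStable n a).deriv_mem 0 i _
      (hookDet_mem_hookModule (by omega))
  rw [rowDerivation_hookDet ha] at h1
  exact (Submodule.smul_mem_iff _ (by exact_mod_cast Nat.succ_ne_zero a)).1 h1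

end HookModule

/-! ### Multilinear elements -/

section Tensor

variable {n m : ℕ}

/-- The coefficient vectors of the polynomials that are linear in `θ` and in each of `m` rows
of variables. -/
abbrev Tensor (n m : ℕ) : Type := (Fin m → Fin n) × Fin n → ℚ

/-- The exponent vector of the monomial `θ_j ∏ₛ x_{g(s), i(s)}`. -/
def rowExponent (g : Fin m → ℕ) (p : (Fin m → Fin n) × Fin n) : Var n →₀ ℕ :=
  ∑ s, Finsupp.single (Sum.inl (g s, p.1 s)) 1 + Finsupp.single (Sum.inr p.2) 1

theorem monomial_rowExponent (g : Fin m → ℕ) (p : (Fin m → Fin n) × Fin n) :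
    (MvPolynomial.monomial (rowExponent g p) 1 : Poly n)
      = (∏ s, MvPolynomial.X (Sum.inl (g s, p.1 s))) * MvPolynomial.X (Sum.inr p.2) := by
  rw [rowExponent, ← one_mul (1 : ℚ), ← MvPolynomial.monomial_mul, MvPolynomial.monomial_sum_one]
  rfl

theorem rowExponent_inr (g : Fin m → ℕ) (p : (Fin m → Fin n) × Fin n) (j : Fin n) :
    rowExponent g p (Sum.inr j) = if j = p.2 then 1 else 0 := by
  rw [rowExponent, Finsupp.add_apply, Finsupp.finsetSum_apply, Finset.sum_eq_zero, zero_add,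
    Finsupp.single_apply]
  · simp [eq_comm]
  · intro s _
    exact Finsupp.single_eq_of_ne (by simp)

theorem rowExponent_inl (g : Fin m → ℕ) (p : (Fin m → Fin n) × Fin n) (x : ℕ × Fin n) :
    rowExponent g p (Sum.inl x) = (Finset.univ.filter fun s => (g s, p.1 s) = x).card := by
  rw [rowExponent, Finsupp.add_apply, Finsupp.finsetSum_apply, Finsupp.single_eq_of_ne (by simp),
    add_zero, Finset.card_filter]
  refine Finset.sum_congr rfl fun s _ => ?_
  rw [Finsupp.single_apply]
  simp

theorem rowExponent_injective {g : Fin m → ℕ} (hg : Function.Injective g) :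
    Function.Injective (rowExponent (n := n) g) := by
  intro p q h
  refine Prod.ext (funext fun s => ?_) ?_
  · have h1 := DFunLike.congr_fun h (Sum.inl (g s, p.1 s))
    rw [rowExponent_inl, rowExponent_inl] at h1
    have h2 : s ∈ Finset.univ.filter fun t => (g t, p.1 t) = (g s, p.1 s) := by simp
    have h3 := h1 ▸ Finset.card_pos.2 ⟨s, h2⟩
    obtain ⟨t, ht⟩ := Finset.card_pos.1 h3
    have h4 := Prod.ext_iff.1 (Finset.mem_filter.1 ht).2
    have h5 := hg h4.1
    subst h5
    exact h4.2.symm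
  · have h1 := DFunLike.congr_fun h (Sum.inr p.2)
    rw [rowExponent_inr, rowExponent_inr, if_pos rfl] at h1
    by_contra h2
    rw [if_neg h2] at h1
    exact absurd h1 one_ne_zero

/-- The polynomial with given coefficients that is linear in the rows `g(0), g(1), …`. -/
def evalRows (g : Fin m → ℕ) : Tensor n m →ₗ[ℚ] Poly n :=
  Fintype.linearCombination ℚ fun p => MvPolynomial.monomial (rowExponent g p) 1

theorem evalRows_apply (g : Fin m → ℕ) (c : Tensor n m) :
    evalRows g c = ∑ p, c p • MvPolynomial.monomial (rowExponent g p) 1 :=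
  Fintype.linearCombination_apply _ _ _

theorem coeff_evalRows {g : Fin m → ℕ} (hg : Function.Injective g) (c : Tensor n m)
    (p : (Fin m → Fin n) × Fin n) :
    MvPolynomial.coeff (rowExponent g p) (evalRows g c) = c p := by
  rw [evalRows_apply, MvPolynomial.coeff_sum, Finset.sum_eq_single p]
  · simp
  · intro q _ hq
    rw [MvPolynomial.coeff_smul, MvPolynomial.coeff_monomial,
      if_neg fun h => hq (rowExponent_injective hg h), smul_zero]
  · simp

theorem evalRows_injective {g : Fin m → ℕ} (hg : Function.Injective g) :
    Function.Injective (evalRows (n := n) g) := by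
  intro c c' h
  funext p
  rw [← coeff_evalRows hg c p, h, coeff_evalRows hg]

/-- First-order polarization is a derivation: it moves the factors of row `u` to row `v` one at a
time. -/
theorem polarize_monomial_rowExponent (u v : ℕ) (g : Fin m → ℕ) (p : (Fin m → Fin n) × Fin n) :
    polarize u v 1 (MvPolynomial.monomial (rowExponent g p) 1 : Poly n)
      = ∑ s, if g s = u then MvPolynomial.monomial (rowExponent (Function.update g s v) p) 1
        else 0 := by
  have h1 : ∀ i : Fin n, MvPolynomial.pderiv (Sum.inl (u, i))
      (MvPolynomial.monomial (rowExponent g p) 1 : Poly n)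
      = ∑ s, if g s = u ∧ p.1 s = i then (∏ t ∈ Finset.univ.erase s,
        MvPolynomial.X (Sum.inl (g t, p.1 t))) * MvPolynomial.X (Sum.inr p.2) else 0 := by
    intro i
    rw [monomial_rowExponent, Derivation.leibniz, MvPolynomial.pderiv_X_of_ne (by simp), smul_zero,
      zero_add, derivation_prod, smul_eq_mul, Finset.mul_sum]
    refine Finset.sum_congr rfl fun s _ => ?_
    split_ifs with h
    · rw [h.1, h.2, MvPolynomial.pderiv_X_self, one_mul, mul_comm]
    · rw [MvPolynomial.pderiv_X_of_ne, zero_mul, mul_zero]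
      intro h2
      rw [Sum.inl.injEq, Prod.mk.injEq] at h2
      exact h h2
  rw [polarize]
  simp only [Function.iterate_one, h1, Finset.mul_sum]
  rw [Finset.sum_comm]
  refine Finset.sum_congr rfl fun s _ => ?_
  split_ifs with h
  · rw [Finset.sum_eq_single (p.1 s), if_pos ⟨h, rfl⟩, monomial_rowExponent,
      ← Finset.mul_prod_erase _ _ (Finset.mem_univ s), Function.update_self, mul_assoc]
    · congr 2
      refine Finset.prod_congr rfl fun t ht => ?_
      rw [Function.update_of_ne (Finset.ne_of_mem_erase ht)]
    · intro i _ hi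
      rw [if_neg fun h2 => hi h2.2.symm, mul_zero]
    · simp
  · refine Finset.sum_eq_zero fun i _ => ?_
    rw [if_neg fun h2 => h h2.1, mul_zero]

theorem polarize_sum_smul {I : Type*} (s : Finset I) (a : I → ℚ) (F : I → Poly n) (u v : ℕ) :
    polarize u v 1 (∑ i ∈ s, a i • F i) = ∑ i ∈ s, a i • polarize u v 1 (F i) := by
  simp only [polarize, Function.iterate_one, map_sum, Derivation.map_smul, Finset.mul_sum,
    Finset.smul_sum, mul_smul_comm]
  rw [Finset.sum_comm]

theorem polarize_evalRows (u v : ℕ) (g : Fin m → ℕ) (c : Tensor n m) :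
    polarize u v 1 (evalRows g c)
      = ∑ s, if g s = u then evalRows (Function.update g s v) c else 0 := by
  rw [evalRows_apply, polarize_sum_smul]
  simp only [polarize_monomial_rowExponent, Finset.smul_sum]
  rw [Finset.sum_comm]
  refine Finset.sum_congr rfl fun s _ => ?_
  split_ifs with h
  · rw [evalRows_apply]
  · simp

/-- The permutations of the rows. -/
def rowRep (n m : ℕ) : Representation ℚ (Equiv.Perm (Fin m)) (Tensor n m) where
  toFun τ := LinearMap.funLeft ℚ ℚ fun p => (p.1 ∘ τ, p.2)
  map_one' := rfl
  map_mul' _ _ := rfl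

theorem rowRep_apply (τ : Equiv.Perm (Fin m)) (c : Tensor n m) (p : (Fin m → Fin n) × Fin n) :
    rowRep n m τ c p = c (p.1 ∘ τ, p.2) := rfl

/-- The permutations of the columns. -/
def colRep (n m : ℕ) : Representation ℚ (Equiv.Perm (Fin n)) (Tensor n m) where
  toFun σ := LinearMap.funLeft ℚ ℚ fun p => (⇑σ⁻¹ ∘ p.1, σ⁻¹ p.2)
  map_one' := rfl
  map_mul' σ τ := by
    refine LinearMap.ext fun c => funext fun p => ?_
    change c (⇑(σ * τ)⁻¹ ∘ p.1, (σ * τ)⁻¹ p.2) = c (⇑τ⁻¹ ∘ ⇑σ⁻¹ ∘ p.1, τ⁻¹ (σ⁻¹ p.2))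
    rw [mul_inv_rev]
    rfl

theorem colRep_apply (σ : Equiv.Perm (Fin n)) (c : Tensor n m) (p : (Fin m → Fin n) × Fin n) :
    colRep n m σ c p = c (⇑σ⁻¹ ∘ p.1, σ⁻¹ p.2) := rfl

theorem colRep_rowRep (σ : Equiv.Perm (Fin n)) (τ : Equiv.Perm (Fin m)) (c : Tensor n m) :
    colRep n m σ (rowRep n m τ c) = rowRep n m τ (colRep n m σ c) := rfl

theorem evalRows_rowRep (g : Fin m → ℕ) (τ : Equiv.Perm (Fin m)) (c : Tensor n m) :
    evalRows g (rowRep n m τ c) = evalRows (g ∘ τ) c := by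
  rw [evalRows_apply, evalRows_apply]
  refine Fintype.sum_equiv ((Equiv.arrowCongr τ⁻¹ (Equiv.refl _)).prodCongr (Equiv.refl _)) _ _
    fun p => ?_
  have h : rowExponent (g ∘ τ) (p.1 ∘ τ, p.2) = rowExponent g p := by
    rw [rowExponent, rowExponent]
    congr 1
    exact Equiv.sum_comp τ fun s => Finsupp.single (Sum.inl (g s, p.1 s)) 1
  rw [rowRep_apply, ← h]
  rfl

theorem permute_evalRows (g : Fin m → ℕ) (σ : Equiv.Perm (Fin n)) (c : Tensor n m) :
    permute σ (evalRows g c) = evalRows g (colRep n m σ c) := by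
  rw [evalRows_apply, evalRows_apply, map_sum]
  refine Fintype.sum_equiv ((Equiv.arrowCongr (Equiv.refl _) σ).prodCongr σ) _ _ fun p => ?_
  rw [map_smul, colRep_apply, monomial_rowExponent, monomial_rowExponent, map_mul, map_prod]
  simp only [permute, MvPolynomial.rename_X, permVar]
  congr 1
  simp [Function.comp_def]

theorem sum_colorStabilizer_reindex {M : Type*} [AddCommMonoid M] (f : Fin m → ℕ)
    (H : Equiv.Perm (Fin m) → M) {j k : Fin m} (h : f j = f k) :
    ∑ τ ∈ colorStabilizer f, H (Equiv.swap k j * τ) = ∑ τ ∈ colorStabilizer f, H τ := by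
  have hs : f ∘ Equiv.swap k j = f := by
    funext x
    rw [Function.comp_apply, Equiv.swap_apply_def]
    split_ifs with h1 h2
    · rw [h1, h]
    · rw [h2, h]
    · rfl
  refine Finset.sum_equiv (Equiv.mulLeft (Equiv.swap k j)) (fun τ => ?_) fun _ _ => rfl
  simp only [colorStabilizer, Finset.mem_filter, Finset.mem_univ, true_and, Equiv.coe_mulLeft,
    Equiv.Perm.coe_mul]
  rw [← Function.comp_assoc, hs]

/-! ### Moving multilinear elements between rows by polarization -/

section Closure

variable {N : Submodule ℚ (Poly n)} (hN : ∀ u v, ∀ F ∈ N, polarize u v 1 F ∈ N)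

include hN

/-- The rows are moved one by one. Since `g` is injective and `h` avoids its values, polarizing from
`g k` hits the place `k` only. -/
theorem evalRows_mem_of_disjoint {g h : Fin m → ℕ} (hg : Function.Injective g)
    (hgh : ∀ s t, h s ≠ g t) {c : Tensor n m} (hc : evalRows g c ∈ N) : evalRows h c ∈ N := by
  suffices H : ∀ A : Finset (Fin m), evalRows (fun s => if s ∈ A then h s else g s) c ∈ N by
    simpa using H Finset.univ
  intro A
  induction A using Finset.induction_on with
  | empty => simpa using hc
  | insert k A hk ih =>
    have h1 := hN (g k) (h k) _ ih
    rw [polarize_evalRows, Finset.sum_eq_single k] at h1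
    · rw [if_pos (by rw [if_neg hk])] at h1
      refine (congrArg (fun g => evalRows g c ∈ N) ?_).mpr h1
      funext s
      rcases eq_or_ne s k with rfl | hs
      · simp
      · simp [hs]
    · intro s _ hs
      refine if_neg ?_
      split_ifs
      · exact hgh s k
      · exact fun h2 => hs (hg h2)
    · simp

/-- The detour through the fresh rows `K + s` makes both moves disjoint; `h` itself need not be
injective. -/
theorem evalRows_mem {g : Fin m → ℕ} (hg : Function.Injective g) {c : Tensor n m}
    (hc : evalRows g c ∈ N) (h : Fin m → ℕ) : evalRows h c ∈ N := by
  obtain ⟨K, hK⟩ : ∃ K, ∀ s, g s < K ∧ h s < K :=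
    ⟨∑ s, (g s + 1) + ∑ s, (h s + 1), fun s => by
      have h1 := Finset.single_le_sum (f := fun s => g s + 1) (fun _ _ => Nat.zero_le _)
        (Finset.mem_univ s)
      have h2 := Finset.single_le_sum (f := fun s => h s + 1) (fun _ _ => Nat.zero_le _)
        (Finset.mem_univ s)
      omega⟩
  have h1 : evalRows (fun s : Fin m => K + s) c ∈ N :=
    evalRows_mem_of_disjoint hN hg (fun s t => by have := hK t; omega) hc
  exact evalRows_mem_of_disjoint hN (fun s t h => Fin.ext (by simpa using h))
    (fun s t => by have := hK s; omega) h1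

/-- Full polarization: when every factor is moved to a fresh row, factors that shared a row are
distributed in all possible ways. The result is the symmetrization over the stabilizer of `f`, up to
a positive factor. -/
theorem evalRows_symmetrize_mem (f : Fin m → ℕ) {c : Tensor n m} (hc : evalRows f c ∈ N)
    (h : Fin m → ℕ) : evalRows h (∑ τ ∈ colorStabilizer f, rowRep n m τ c) ∈ N := by
  obtain ⟨K, hK⟩ : ∃ K, ∀ s, f s < K :=
    ⟨∑ s, (f s + 1), fun s => Finset.single_le_sum (f := fun s => f s + 1)
      (fun _ _ => Nat.zero_le _) (Finset.mem_univ s)⟩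
  refine evalRows_mem hN (g := fun s => K + s) (fun s t h => Fin.ext (by simpa using h)) ?_ h
  -- Here `A` is the set of fresh labels in use: for each `τ`, the place `s` has been moved to row
  -- `K + τ s` if `τ s ∈ A`.
  suffices H : ∀ A : Finset (Fin m), ∑ τ ∈ colorStabilizer f,
      evalRows (fun s => if τ s ∈ A then K + (τ s : ℕ) else f s) c ∈ N by
    rw [map_sum]
    simp only [evalRows_rowRep]
    simpa [Function.comp_def] using H Finset.univ
  intro A
  induction A using Finset.induction_on with
  | empty =>
    simp only [Finset.notMem_empty, if_false, Finset.sum_const]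
    exact nsmul_mem hc _
  | insert k A hk ih =>
    have hp : ∀ F : Equiv.Perm (Fin m) → Poly n, polarize (f k) (K + k) 1
        (∑ τ ∈ colorStabilizer f, F τ) = ∑ τ ∈ colorStabilizer f, polarize (f k) (K + k) 1 (F τ) := by
      intro F
      simpa using polarize_sum_smul (colorStabilizer f) (fun _ => 1) F (f k) (K + k)
    have h1 := hN (f k) (K + k) _ ih
    rw [hp] at h1
    -- Polarization moves one place `s` that is still in row `f k` to the fresh row `K + k`. With `j
    -- = τ s`, this is the term for `swap k j * τ`, which gives the label `k` to `s`.
    have h2 : ∀ τ ∈ colorStabilizer f, polarize (f k) (K + k) 1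
        (evalRows (fun s => if τ s ∈ A then K + (τ s : ℕ) else f s) c)
        = ∑ j, if j ∉ A ∧ f j = f k then evalRows (fun s => if (Equiv.swap k j * τ) s ∈ insert k A
          then K + ((Equiv.swap k j * τ) s : ℕ) else f s) c else 0 := by
      intro τ hτ
      rw [polarize_evalRows]
      refine Fintype.sum_equiv τ _ _ fun s => ?_
      have hfs : f (τ s) = f s := congrFun (Finset.mem_filter.1 hτ).2 s
      by_cases hs : τ s ∈ A
      · have := hK k
        rw [if_neg (by rw [if_pos hs]; omega), if_neg (by simp [hs])]
      · by_cases h3 : f s = f k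
        · rw [if_pos (by rw [if_neg hs]; exact h3), if_pos ⟨hs, hfs.trans h3⟩]
          congr 2
          funext t
          rcases eq_or_ne t s with rfl | ht
          · simp
          · rw [Function.update_of_ne ht, Equiv.Perm.mul_apply]
            have h4 : τ t ≠ τ s := fun h => ht (τ.injective h)
            rcases eq_or_ne (τ t) k with h5 | h5
            · rw [h5, Equiv.swap_apply_left, if_neg hk, if_neg]
              rw [Finset.mem_insert, not_or]
              exact ⟨fun h6 => h4 (h5.trans h6.symm), hs⟩
            · rw [Equiv.swap_apply_of_ne_of_ne h5 h4]
              simp [h5]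
        · rw [if_neg (by rw [if_neg hs]; exact h3), if_neg fun h4 => h3 (hfs.symm.trans h4.2)]
    rw [Finset.sum_congr rfl h2, Finset.sum_comm] at h1
    -- The swap preserves `f`, so each admissible `j` yields the same sum over the stabilizer. Their
    -- number is not zero, as `k` is one of them.
    have h3 : ∀ j, (∑ τ ∈ colorStabilizer f, if j ∉ A ∧ f j = f k then
        evalRows (fun s => if (Equiv.swap k j * τ) s ∈ insert k A
          then K + ((Equiv.swap k j * τ) s : ℕ) else f s) c else 0)
        = if j ∉ A ∧ f j = f k then ∑ τ ∈ colorStabilizer f,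
          evalRows (fun s => if τ s ∈ insert k A then K + (τ s : ℕ) else f s) c else 0 := by
      intro j
      split_ifs with hj
      · exact sum_colorStabilizer_reindex f (fun τ =>
          evalRows (fun s => if τ s ∈ insert k A then K + (τ s : ℕ) else f s) c) hj.2
      · simp
    rw [Finset.sum_congr rfl fun j _ => h3 j, ← Finset.sum_filter, Finset.sum_const,
      ← Nat.cast_smul_eq_nsmul ℚ] at h1
    refine (Submodule.smul_mem_iff _ ?_).1 h1
    rw [Nat.cast_ne_zero, Finset.card_ne_zero]
    exact ⟨k, by simp [hk]⟩

end Closure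

end Tensor

/-! ### The characters of the components -/

/-- `P` vanishes on the kernel of `R`, so `P = P S R` for a section `S` of `R`. Cyclicity of the
trace moves `R` to the front, where `R s P S = t R P S = k t`. -/
theorem trace_comp_eq_mul_trace {V W : Type*} [AddCommGroup V] [Module ℚ V] [AddCommGroup W]
    [Module ℚ W] [FiniteDimensional ℚ W] {R : W →ₗ[ℚ] V} (hR : Function.Surjective R)
    {P : W →ₗ[ℚ] W} {k : ℚ} (hRP : R ∘ₗ P = k • R) (hP : ∀ w, R w = 0 → P w = 0)
    {s : W →ₗ[ℚ] W} {t : V →ₗ[ℚ] V} (hst : t ∘ₗ R = R ∘ₗ s) :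
    LinearMap.trace ℚ W (s ∘ₗ P) = k * LinearMap.trace ℚ V t := by
  have : FiniteDimensional ℚ V := Module.Finite.of_surjective R hR
  obtain ⟨S, hS⟩ := R.exists_rightInverse_of_surjective (LinearMap.range_eq_top.2 hR)
  have h1 : P = (P ∘ₗ S) ∘ₗ R := by
    ext w
    have h2 : R (w - S (R w)) = 0 := by
      rw [map_sub, sub_eq_zero]
      exact (LinearMap.congr_fun hS (R w)).symm
    have h3 := hP _ h2
    rw [map_sub, sub_eq_zero] at h3
    exact h3
  have h2 : R ∘ₗ (s ∘ₗ P ∘ₗ S) = k • t := by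
    rw [← LinearMap.comp_assoc, ← hst, LinearMap.comp_assoc, ← LinearMap.comp_assoc S, hRP,
      LinearMap.smul_comp, hS, LinearMap.comp_smul, LinearMap.comp_id]
  conv_lhs => rw [h1]
  rw [← LinearMap.comp_assoc, LinearMap.trace_comp_comm', h2, map_smul, smul_eq_mul]

section HookTensors

variable {n m : ℕ}

/-- The multilinear elements of the module `M_{(a|b)}`. -/
def hookTensors (n a m : ℕ) : Submodule ℚ (Tensor n m) :=
  (hookModule n a).comap (evalRows fun s : Fin m => (s : ℕ))

theorem hookModule_polarize_mem (n a : ℕ) :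
    ∀ u v, ∀ F ∈ hookModule n a, polarize u v 1 F ∈ hookModule n a :=
  fun u v F hF => (hookModule_isStable n a).polarize_mem u v 1 le_rfl F hF

theorem evalRows_mem_hookModule {a : ℕ} {c : Tensor n m} (hc : c ∈ hookTensors n a m)
    (g : Fin m → ℕ) : evalRows g c ∈ hookModule n a :=
  evalRows_mem (hookModule_polarize_mem n a) Fin.val_injective hc g

theorem rowRep_mem_hookTensors {a : ℕ} (τ : Equiv.Perm (Fin m)) {c : Tensor n m}
    (hc : c ∈ hookTensors n a m) : rowRep n m τ c ∈ hookTensors n a m := by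
  rw [hookTensors, Submodule.mem_comap, evalRows_rowRep]
  exact evalRows_mem_hookModule hc _

theorem colRep_mem_hookTensors {a : ℕ} (σ : Equiv.Perm (Fin n)) {c : Tensor n m}
    (hc : c ∈ hookTensors n a m) : colRep n m σ c ∈ hookTensors n a m := by
  rw [hookTensors, Submodule.mem_comap, ← permute_evalRows]
  exact permute_mem_hookModule σ a _ hc

theorem hookTensors_succ_le (n a m : ℕ) : hookTensors n (a + 1) m ≤ hookTensors n a m :=
  Submodule.comap_mono (hookModule_succ_le n a)

theorem rowExponent_mem_hookSupport {a B : ℕ}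
    (hB : hookModule n a ≤ MvPolynomial.restrictSupport ℚ (hookSupport n B)) {c : Tensor n m}
    (hc : c ∈ hookTensors n a m) {p : (Fin m → Fin n) × Fin n} (hp : c p ≠ 0) :
    rowExponent (fun s : Fin m => (s : ℕ)) p ∈ hookSupport n B := by
  have h := (MvPolynomial.mem_restrictSupport_iff ℚ).1 (hB hc)
  refine h (Finset.mem_coe.2 (MvPolynomial.mem_support_iff.2 ?_))
  rw [coeff_evalRows Fin.val_injective]
  exact hp

theorem notMem_range_of_ne_zero (hn : 0 < n) {a : ℕ} {c : Tensor n m}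
    (hc : c ∈ hookTensors n a m) {p : (Fin m → Fin n) × Fin n} (hp : c p ≠ 0) (s : Fin m) :
    p.1 s ≠ p.2 := by
  obtain ⟨B, hB⟩ := exists_hookModule_le n a hn
  obtain ⟨-, j, h1, h2⟩ := rowExponent_mem_hookSupport hB hc hp
  intro h
  have hj : p.2 = j := by
    have h3 := h1 p.2
    rw [rowExponent_inr, if_pos rfl] at h3
    by_contra h4
    rw [if_neg h4] at h3
    exact absurd h3 one_ne_zero
  have h3 := h2 s
  rw [rowExponent_inl, Finset.card_eq_zero, Finset.filter_eq_empty_iff] at h3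
  exact h3 (Finset.mem_univ s) (by rw [h, hj])

theorem degree_rowExponent (g : Fin m → ℕ) (p : (Fin m → Fin n) × Fin n) :
    (rowExponent g p).degree = m + 1 := by
  rw [rowExponent, map_add, map_sum]
  simp

theorem hookTensors_eq_bot {a B : ℕ}
    (hB : hookModule n a ≤ MvPolynomial.restrictSupport ℚ (hookSupport n B)) (hm : B ≤ m) :
    hookTensors n a m = ⊥ := by
  refine (Submodule.eq_bot_iff _).2 fun c hc => funext fun p => ?_
  by_contra hp
  have h := (rowExponent_mem_hookSupport hB hc hp).1
  rw [degree_rowExponent] at h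
  omega

/-- The permutations of the rows of the multilinear elements. -/
def hookRow (n a m : ℕ) : Representation ℚ (Equiv.Perm (Fin m)) (hookTensors n a m) :=
  (rowRep n m).subrepresentation _ fun τ _ hc => rowRep_mem_hookTensors τ hc

/-- The permutations of the columns of the multilinear elements. -/
def hookCol (n a m : ℕ) : Representation ℚ (Equiv.Perm (Fin n)) (hookTensors n a m) :=
  (colRep n m).subrepresentation _ fun τ _ hc => colRep_mem_hookTensors τ hc

theorem coe_hookRow (a : ℕ) (τ : Equiv.Perm (Fin m)) (c : hookTensors n a m) :
    (hookRow n a m τ c : Tensor n m) = rowRep n m τ c := rfl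

theorem coe_hookCol (a : ℕ) (σ : Equiv.Perm (Fin n)) (c : hookTensors n a m) :
    (hookCol n a m σ c : Tensor n m) = colRep n m σ c := rfl

theorem hookCol_comp_hookRow (a : ℕ) (σ : Equiv.Perm (Fin n)) (τ : Equiv.Perm (Fin m)) :
    hookCol n a m σ ∘ₗ hookRow n a m τ = hookRow n a m τ ∘ₗ hookCol n a m σ :=
  LinearMap.ext fun c => Subtype.ext (colRep_rowRep σ τ (c : Tensor n m))

/-- The character of the product of the groups of row and column permutations. -/
def mixedTrace (n a m : ℕ) (σ : Equiv.Perm (Fin n)) (τ : Equiv.Perm (Fin m)) : ℚ :=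
  LinearMap.trace ℚ _ (hookCol n a m σ ∘ₗ hookRow n a m τ)

theorem weight_rowExponent (f : Fin m → ℕ) (p : (Fin m → Fin n) × Fin n) :
    Finsupp.weight (rowWeight n) (rowExponent f p) = content f := by
  rw [rowExponent, map_add, map_sum, content]
  simp [rowWeight, Finsupp.weight_single]

/-- The `x`-factors are listed in some order `g`. Their row labels have the same content as `f`, so
a permutation of the places makes them agree with `f`. -/
theorem exists_rowExponent {B : ℕ} {u : Var n →₀ ℕ} (hu : u ∈ hookSupport n B) {f : Fin m → ℕ}
    (hw : Finsupp.weight (rowWeight n) u = content f) : ∃ p, rowExponent f p = u := by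
  obtain ⟨-, j, h1, -⟩ := hu
  set x : ℕ × Fin n →₀ ℕ := (Finsupp.sumFinsuppEquivProdFinsupp u).1 with hx
  have hxu : ∀ y, x y = u (Sum.inl y) := fun y => rfl
  have hu' : u = x.mapDomain Sum.inl + Finsupp.single (Sum.inr j) 1 := by
    ext y
    rcases y with y | y
    · rw [Finsupp.add_apply, Finsupp.mapDomain_apply Sum.inl_injective,
        Finsupp.single_eq_of_ne (by simp), add_zero, hxu]
    · rw [Finsupp.add_apply, Finsupp.mapDomain_of_notMem_range _ _ (by simp), zero_add, h1,
        Finsupp.single_apply]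
      simp [eq_comm]
  have hcont : x.mapDomain Prod.fst = content f := by
    rw [← hw, hu', map_add, Finsupp.weight_single]
    rw [Finsupp.weight_apply, Finsupp.sum_mapDomain_index (by simp) (by simp [add_smul])]
    simp [rowWeight, Finsupp.mapDomain]
  have hdeg : x.degree = m := by
    have h2 := congrArg Finsupp.degree hcont
    rw [degree_content, Fintype.card_fin] at h2
    rw [← h2, Finsupp.degree_mapDomain]
  obtain ⟨g, hg⟩ := colorings_nonempty hdeg
  rw [mem_colorings] at hg
  have h3 : content (Prod.fst ∘ g) = content f := by
    rw [← hcont, ← hg, content, content, Finsupp.mapDomain_finsetSum]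
    simp [Finsupp.mapDomain_single]
  obtain ⟨π, hπ⟩ := exists_perm_of_content_eq h3
  refine ⟨(fun s => (g (π s)).2, j), ?_⟩
  rw [rowExponent, hu', ← hg, ← content_comp_perm g π, content, Finsupp.mapDomain_finsetSum, ← hπ]
  simp [Finsupp.mapDomain_single]

theorem evalRows_mem_component {a : ℕ} (f : Fin m → ℕ) {c : Tensor n m}
    (hc : c ∈ hookTensors n a m) : evalRows f c ∈ component n a (content f) := by
  refine ⟨evalRows_mem_hookModule hc f, ?_⟩
  rw [evalRows_apply]
  refine Submodule.sum_mem _ fun p _ => Submodule.smul_mem _ _ ?_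
  exact MvPolynomial.isWeightedHomogeneous_monomial _ _ _ (weight_rowExponent f p)

theorem exists_evalRows_eq (hn : 0 < n) {a : ℕ} {f : Fin m → ℕ} {F : Poly n}
    (hF : F ∈ component n a (content f)) : ∃ c : Tensor n m, evalRows f c = F := by
  obtain ⟨B, hB⟩ := exists_hookModule_le n a hn
  have h1 := (MvPolynomial.mem_restrictSupport_iff ℚ).1 (hB hF.1)
  have h2 := (MvPolynomial.mem_weightedHomogeneousSubmodule ℚ (rowWeight n) _ F).1 hF.2
  suffices h : F ∈ LinearMap.range (evalRows (n := n) f) from h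
  rw [F.as_sum]
  refine Submodule.sum_mem _ fun u hu => ?_
  obtain ⟨p, rfl⟩ := exists_rowExponent (h1 (Finset.mem_coe.2 hu))
    (h2 (MvPolynomial.mem_support_iff.1 hu))
  refine ⟨Pi.single p (F.coeff (rowExponent f p)), ?_⟩
  rw [evalRows_apply, Finset.sum_eq_single p]
  · simp [MvPolynomial.smul_monomial]
  · intro q _ hq
    rw [Pi.single_eq_of_ne hq, zero_smul]
  · simp

/-- `evalRows f` identifies the component with the coinvariants of the row stabilizer of `f`; the
trace lemma applies to `R = evalRows f` and the unnormalized symmetrizer `P`. -/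
theorem sum_mixedTrace (hn : 0 < n) (a : ℕ) (f : Fin m → ℕ) (σ : Equiv.Perm (Fin n)) :
    ∑ τ ∈ colorStabilizer f, mixedTrace n a m σ τ
      = (colorStabilizer f).card * character n a (content f) σ := by
  let R : hookTensors n a m →ₗ[ℚ] component n a (content f) :=
    (evalRows f).restrict fun c hc => evalRows_mem_component f hc
  let P : hookTensors n a m →ₗ[ℚ] hookTensors n a m := ∑ τ ∈ colorStabilizer f, hookRow n a m τ
  have hP : ∀ c, (P c : Tensor n m) = ∑ τ ∈ colorStabilizer f, rowRep n m τ c := by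
    intro c
    simp only [P, LinearMap.sum_apply, Submodule.coe_sum, coe_hookRow]
  have hsum : ∀ c : Tensor n m, evalRows f (∑ τ ∈ colorStabilizer f, rowRep n m τ c)
      = ((colorStabilizer f).card : ℚ) • evalRows f c := by
    intro c
    rw [map_sum, Nat.cast_smul_eq_nsmul, ← Finset.sum_const]
    refine Finset.sum_congr rfl fun τ hτ => ?_
    rw [evalRows_rowRep, (Finset.mem_filter.1 hτ).2]
  have hcard : ((colorStabilizer f).card : ℚ) ≠ 0 := by
    rw [Nat.cast_ne_zero, Finset.card_ne_zero]
    exact ⟨1, by simp [colorStabilizer]⟩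
  have h1 := trace_comp_eq_mul_trace (R := R) (P := P) (k := (colorStabilizer f).card)
    (s := hookCol n a m σ)
    (t := (permute σ).toLinearMap.restrict (permute_mem_component σ a (content f))) ?_ ?_ ?_ ?_
  · rw [character, ← h1, show hookCol n a m σ ∘ₗ P
      = ∑ τ ∈ colorStabilizer f, hookCol n a m σ ∘ₗ hookRow n a m τ from
      Finset.mul_sum _ _ (hookCol n a m σ : Module.End ℚ (hookTensors n a m)), map_sum]
    rfl
  · rintro ⟨F, hF⟩
    obtain ⟨c, rfl⟩ := exists_evalRows_eq hn hF
    -- The tensor `c` need not belong to the module when its rows are made distinct, but its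
    -- symmetrization does, by full polarization.
    have h2 : ∑ τ ∈ colorStabilizer f, rowRep n m τ c ∈ hookTensors n a m :=
      evalRows_symmetrize_mem (hookModule_polarize_mem n a) f hF.1 fun s => (s : ℕ)
    refine ⟨((colorStabilizer f).card : ℚ)⁻¹ • ⟨_, h2⟩, Subtype.ext ?_⟩
    rw [map_smul]
    refine (congrArg (((colorStabilizer f).card : ℚ)⁻¹ • ·) (hsum c)).trans ?_
    simp only [smul_smul, inv_mul_cancel₀ hcard, one_smul]
  · refine LinearMap.ext fun c => Subtype.ext ?_
    change evalRows f (P c : Tensor n m) = (_ : ℚ) • evalRows f c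
    rw [hP, hsum]
  · intro c hc
    have h2 : evalRows f (c : Tensor n m) ∈ (⊥ : Submodule ℚ (Poly n)) :=
      (Submodule.mem_bot ℚ).2 (congrArg Subtype.val hc)
    -- The zero space is closed under polarization too, so the symmetrization of an element of the
    -- kernel is zero.
    have h3 := evalRows_symmetrize_mem (N := ⊥) ?_ f h2 fun s => (s : ℕ)
    · rw [Submodule.mem_bot, ← hP] at h3
      refine Subtype.ext (evalRows_injective Fin.val_injective ?_)
      rw [h3]
      exact (map_zero _).symm
    · intro u v F hF
      rw [(Submodule.mem_bot ℚ).1 hF, Submodule.mem_bot, polarize]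
      simp
  · refine LinearMap.ext fun c => Subtype.ext ?_
    exact permute_evalRows f σ c

end HookTensors

/-! ### The tensor `S_ρ` and its sign-isotypic part -/

section HookTensor

variable {n m : ℕ}

/-- The tensor whose expansion in the left factor is the graded Frobenius characteristic of the
multilinear part of `M_{(a|b)}`, in the rows `0, …, B - 1`. -/
def hookTensor (n a B : ℕ) : SymFun ⊗[ℚ] SymFun :=
  ∑ m ∈ Finset.range B, (n.factorial : ℚ)⁻¹ •
    ∑ σ : Equiv.Perm (Fin n), ch (mixedTrace n a m σ) ⊗ₜ[ℚ] cyclePowerSum σ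

/-- Only `m = d.degree` can contribute. If this is at least `B`, there are no non-zero multilinear
elements and both sides vanish. -/
theorem coeff_ch_mixedTrace (hn : 0 < n) {a B : ℕ}
    (hB : hookModule n a ≤ MvPolynomial.restrictSupport ℚ (hookSupport n B))
    (σ : Equiv.Perm (Fin n)) (d : ℕ →₀ ℕ) :
    ∑ m ∈ Finset.range B, MvPowerSeries.coeff d (toSeries (ch (mixedTrace n a m σ)))
      = character n a d σ := by
  have h1 : MvPowerSeries.coeff d (toSeries (ch (mixedTrace n a d.degree σ)))
      = character n a d σ := by
    rw [toSeries_eq]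
    refine coeff_ch (colorings_nonempty rfl) fun f hf => ?_
    rw [sum_mixedTrace hn, mem_colorings.1 hf]
  rw [← h1, Finset.sum_eq_single d.degree]
  · intro m _ hm
    rw [toSeries_eq]
    refine coeff_ch_eq_zero ?_
    rw [Fintype.card_fin]
    exact hm.symm
  · intro hd
    have h2 : mixedTrace n a d.degree σ = 0 := by
      funext τ
      have h3 : Subsingleton (hookTensors n a d.degree) := by
        rw [hookTensors_eq_bot hB (by simpa using hd)]
        infer_instance
      rw [mixedTrace, Subsingleton.elim (hookCol n a d.degree σ ∘ₗ hookRow n a d.degree τ) 0,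
        map_zero, Pi.zero_apply]
    rw [h2]
    simp [ch]

theorem qCoeff_hookTensor (hn : 0 < n) {a B : ℕ}
    (hB : hookModule n a ≤ MvPolynomial.restrictSupport ℚ (hookSupport n B)) (d : ℕ →₀ ℕ) :
    qCoeff d (hookTensor n a B) = frobenius n a d := by
  simp only [hookTensor, map_sum, map_smul, qCoeff_tmul]
  rw [← Finset.smul_sum, Finset.sum_comm, frobenius]
  simp only [← Finset.sum_smul, coeff_ch_mixedTrace hn hB]

theorem isHookCharacter_sub (hn : 0 < n) {a B : ℕ}
    (hB : hookModule n a ≤ MvPolynomial.restrictSupport ℚ (hookSupport n B)) :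
    IsHookCharacter n a (hookTensor n a B - hookTensor n (a + 1) B) := fun d => by
  rw [map_sub, qCoeff_hookTensor hn hB, qCoeff_hookTensor hn ((hookModule_succ_le n a).trans hB)]

theorem shifted_hookTensor_mem (n a B : ℕ) : shifted (hookTensor n a B) ∈
    Submodule.span ℚ {t | ∃ f, ∃ g ∈ homog n, t = f ⊗ₜ[ℚ] g} := by
  simp only [shifted, hookTensor, map_sum, map_smul, LinearMap.rTensor_tmul]
  refine Submodule.sum_mem _ fun m _ => Submodule.smul_mem _ _ (Submodule.sum_mem _ fun σ _ => ?_)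
  refine Submodule.subset_span ⟨_, _, ?_, rfl⟩
  simpa using cyclePowerSum_mem_homog σ

/-- The multilinear elements on which the column permutations act by the sign. -/
def signTensors (n a m : ℕ) : Submodule ℚ (Tensor n m) :=
  hookTensors n a m ⊓ ⨅ σ : Equiv.Perm (Fin n),
    LinearMap.ker (colRep n m σ - ((Equiv.Perm.sign σ : ℤ) : ℚ) • LinearMap.id)

theorem mem_signTensors {a : ℕ} {c : Tensor n m} : c ∈ signTensors n a m ↔
    c ∈ hookTensors n a m ∧
      ∀ σ : Equiv.Perm (Fin n), colRep n m σ c = ((Equiv.Perm.sign σ : ℤ) : ℚ) • c := by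
  simp [signTensors, Submodule.mem_iInf, sub_eq_zero]

theorem signTensors_succ_le (n a m : ℕ) : signTensors n (a + 1) m ≤ signTensors n a m :=
  inf_le_inf_right _ (hookTensors_succ_le n a m)

theorem rowRep_mem_signTensors {a : ℕ} (τ : Equiv.Perm (Fin m)) {c : Tensor n m}
    (hc : c ∈ signTensors n a m) : rowRep n m τ c ∈ signTensors n a m := by
  rw [mem_signTensors] at hc ⊢
  refine ⟨rowRep_mem_hookTensors τ hc.1, fun σ => ?_⟩
  rw [colRep_rowRep, hc.2, map_smul]

/-- The action of the row permutations on the sign isotypic part. -/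
def signRep (n a m : ℕ) : Representation ℚ (Equiv.Perm (Fin m)) (signTensors n a m) :=
  (rowRep n m).subrepresentation _ fun τ _ hc => rowRep_mem_signTensors τ hc

theorem coe_signRep (a : ℕ) (τ : Equiv.Perm (Fin m)) (c : signTensors n a m) :
    (signRep n a m τ c : Tensor n m) = rowRep n m τ c := rfl

/-- The signed average `A` of the column permutations projects onto the sign-isotypic part, so the
averaged trace is the trace on its image. -/
theorem sign_sum_mixedTrace (a : ℕ) (τ : Equiv.Perm (Fin m)) :
    (n.factorial : ℚ)⁻¹ * ∑ σ : Equiv.Perm (Fin n),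
      ((Equiv.Perm.sign σ : ℤ) : ℚ) * mixedTrace n a m σ τ = (signRep n a m).character τ := by
  let A : Tensor n m →ₗ[ℚ] Tensor n m := (n.factorial : ℚ)⁻¹ • ∑ σ : Equiv.Perm (Fin n),
    ((Equiv.Perm.sign σ : ℤ) : ℚ) • colRep n m σ
  have hA : ∀ c, A c = (n.factorial : ℚ)⁻¹ • ∑ σ : Equiv.Perm (Fin n),
      ((Equiv.Perm.sign σ : ℤ) : ℚ) • colRep n m σ c := by
    intro c
    simp [A]
  have hss : ∀ σ : Equiv.Perm (Fin n), ((Equiv.Perm.sign σ : ℤ) : ℚ) * ((Equiv.Perm.sign σ : ℤ) : ℚ)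
      = 1 := by
    intro σ
    rw [← Int.cast_mul, Int.units_coe_mul_self, Int.cast_one]
  have h1 : ∀ c ∈ hookTensors n a m, A c ∈ signTensors n a m := by
    intro c hc
    rw [mem_signTensors, hA]
    refine ⟨Submodule.smul_mem _ _ (Submodule.sum_mem _ fun σ _ =>
      Submodule.smul_mem _ _ (colRep_mem_hookTensors σ hc)), fun ρ => ?_⟩
    rw [map_smul, map_sum, smul_comm ((Equiv.Perm.sign ρ : ℤ) : ℚ)]
    refine congrArg ((n.factorial : ℚ)⁻¹ • ·) ?_
    rw [Finset.smul_sum]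
    refine Fintype.sum_equiv (Equiv.mulLeft ρ) _ _ fun σ => ?_
    rw [Equiv.coe_mulLeft, map_smul, ← Module.End.mul_apply, ← map_mul, smul_smul,
      Equiv.Perm.sign_mul, Units.val_mul, Int.cast_mul, ← mul_assoc, hss, one_mul]
  have h2 : ∀ c ∈ signTensors n a m, A c = c := by
    intro c hc
    rw [mem_signTensors] at hc
    rw [hA]
    simp only [hc.2, smul_smul, hss, one_smul]
    rw [Finset.sum_const, Finset.card_univ, Fintype.card_perm, Fintype.card_fin,
      ← Nat.cast_smul_eq_nsmul ℚ, smul_smul, inv_mul_cancel₀ (by positivity), one_smul]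
  let R : hookTensors n a m →ₗ[ℚ] signTensors n a m := A.restrict h1
  let P : hookTensors n a m →ₗ[ℚ] hookTensors n a m :=
    A.restrict fun c hc => (mem_signTensors.1 (h1 c hc)).1
  have h3 := trace_comp_eq_mul_trace (R := R) (P := P) (k := 1) (s := hookRow n a m τ)
    (t := signRep n a m τ) ?_ ?_ ?_ ?_
  · rw [one_mul] at h3
    rw [Representation.character, ← h3]
    have h4 : P = (n.factorial : ℚ)⁻¹ • ∑ σ : Equiv.Perm (Fin n),
        ((Equiv.Perm.sign σ : ℤ) : ℚ) • hookCol n a m σ := by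
      refine LinearMap.ext fun c => Subtype.ext ?_
      refine (hA c).trans ?_
      simp only [LinearMap.smul_apply, LinearMap.sum_apply, Submodule.coe_smul, Submodule.coe_sum,
        coe_hookCol]
    rw [h4, LinearMap.comp_smul, map_smul, smul_eq_mul, show hookRow n a m τ ∘ₗ
      (∑ σ : Equiv.Perm (Fin n), ((Equiv.Perm.sign σ : ℤ) : ℚ) • hookCol n a m σ)
      = ∑ σ : Equiv.Perm (Fin n), hookRow n a m τ ∘ₗ
        (((Equiv.Perm.sign σ : ℤ) : ℚ) • hookCol n a m σ) from
      Finset.mul_sum _ _ (hookRow n a m τ : Module.End ℚ (hookTensors n a m)), map_sum]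
    congr 1
    refine Finset.sum_congr rfl fun σ _ => ?_
    rw [LinearMap.comp_smul, map_smul, ← hookCol_comp_hookRow, mixedTrace, smul_eq_mul]
  · rintro ⟨c, hc⟩
    exact ⟨⟨c, (mem_signTensors.1 hc).1⟩, Subtype.ext (h2 c hc)⟩
  · refine LinearMap.ext fun c => Subtype.ext ?_
    rw [one_smul]
    exact h2 _ (h1 c c.2)
  · intro c hc
    have h5 : A c = 0 := congrArg Subtype.val hc
    exact Subtype.ext h5
  · refine LinearMap.ext fun c => Subtype.ext ?_
    change rowRep n m τ (A c) = A (rowRep n m τ c)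
    rw [hA, hA, map_smul, map_sum]
    simp only [map_smul, colRep_rowRep]

theorem alternant_hookTensor (hn : 0 < n) (a B : ℕ) : alternant n (hookTensor n a B)
    = ∑ m ∈ Finset.range B, ch (signRep n a m).character := by
  rw [alternant, isotypic_eq_contract, hookTensor, map_sum]
  refine Finset.sum_congr rfl fun m _ => ?_
  simp only [map_smul, map_sum, contract_tmul, LinearMap.flip_apply, schur_column hn]
  have h1 : ∀ σ : Equiv.Perm (Fin n), hall (cyclePowerSum σ) (elementary n)
      = ((Equiv.Perm.sign σ : ℤ) : ℚ) := by
    intro σ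
    have := hall_cyclePowerSum_elementary σ
    rwa [Fintype.card_fin] at this
  simp only [h1, ch]
  simp only [← sign_sum_mixedTrace, mul_smul, Finset.sum_smul, Finset.smul_sum]
  rw [Finset.sum_comm]
  refine Finset.sum_congr rfl fun τ _ => Finset.sum_congr rfl fun σ _ => ?_
  simp only [smul_smul]
  congr 1
  ring

theorem alternant_sub (n : ℕ) (S T : SymFun ⊗[ℚ] SymFun) :
    alternant n (S - T) = alternant n S - alternant n T := by
  rw [alternant, isotypic_eq_contract, map_sub]
  rfl

theorem character_eq_of_isConj {G V : Type*} [Group G] [AddCommGroup V] [Module ℚ V]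
    (ρ : Representation ℚ G V) (σ τ : G) (h : IsConj σ τ) : ρ.character σ = ρ.character τ := by
  obtain ⟨c, rfl⟩ := isConj_iff.1 h
  rw [Representation.char_conj]

/-- The criterion asks that antisymmetrizing in `k` rows be zero. A non-zero coordinate places all
rows in the `n - 1` columns different from that of `θ`, so for `k ≥ n` two of these rows share a
column. -/
theorem skew_elementary_ch_signRep (hn : 0 < n) (a m k : ℕ) (hk : n ≤ k) :
    skew (elementary k) (ch (signRep n a m).character) = 0 := by
  refine skew_elementary_ch_eq_zero (character_eq_of_isConj _) k fun l p _ e e' υ => ?_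
  have h1 : ∑ π : Equiv.Perm (Fin k), ((Equiv.Perm.sign π : ℤ) : ℚ) •
      signRep n a m (glue e e' π υ) = 0 := by
    refine LinearMap.ext fun c => Subtype.ext (funext fun q => ?_)
    have h2 : ((∑ π : Equiv.Perm (Fin k), ((Equiv.Perm.sign π : ℤ) : ℚ) •
        signRep n a m (glue e e' π υ)) c : Tensor n m) q
        = ∑ π : Equiv.Perm (Fin k), ((Equiv.Perm.sign π : ℤ) : ℚ) *
          (c : Tensor n m) (q.1 ∘ glue e e' π υ, q.2) := by
      simp only [LinearMap.sum_apply, LinearMap.smul_apply, Submodule.coe_sum, Submodule.coe_smul,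
        coe_signRep, Finset.sum_apply, Pi.smul_apply, rowRep_apply, smul_eq_mul]
    rw [h2]
    change _ = (0 : ℚ)
    by_cases hq : ∃ s, q.1 s = q.2
    · obtain ⟨s, hs⟩ := hq
      refine Finset.sum_eq_zero fun π _ => mul_eq_zero_of_right _ ?_
      by_contra h3
      refine notMem_range_of_ne_zero hn (mem_signTensors.1 c.2).1 h3 ((glue e e' π υ)⁻¹ s) ?_
      simpa using hs
    · push Not at hq
      obtain ⟨x, y, hxy, h3⟩ := Fintype.exists_ne_map_eq_of_card_lt
        (fun x : Fin k => (⟨q.1 (e x), hq _⟩ : {j : Fin n // j ≠ q.2})) (by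
          rw [Fintype.card_subtype_compl, Fintype.card_subtype_eq, Fintype.card_fin,
            Fintype.card_fin]
          omega)
      have h4 : q.1 (e x) = q.1 (e y) := congrArg Subtype.val h3
      have h5 : q.1 ∘ (Equiv.swap x y).extendDomain e = q.1 := by
        funext s
        by_cases hs : p s
        · obtain ⟨z, hz⟩ := e.surjective ⟨s, hs⟩
          have hz' : s = e z := (congrArg Subtype.val hz).symm
          rw [Function.comp_apply, hz', Equiv.Perm.extendDomain_apply_image, Equiv.swap_apply_def]
          split_ifs with h6 h6
          · rw [h6, h4]
          · rw [h6, h4]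
          · rfl
        · rw [Function.comp_apply, Equiv.Perm.extendDomain_apply_not_subtype _ _ hs]
      -- Swapping two rows in the same column leaves the coordinate alone and reverses the sign.
      refine Finset.sum_involution (fun π _ => Equiv.swap x y * π) ?_ ?_ (fun _ _ => Finset.mem_univ _)
        ?_
      · intro π _
        have h6 : q.1 ∘ glue e e' (Equiv.swap x y * π) υ = q.1 ∘ glue e e' π υ := by
          rw [glue, glue, ← Equiv.Perm.extendDomain_mul, mul_assoc, Equiv.Perm.coe_mul,
            ← Function.comp_assoc, h5]
        rw [h6, Equiv.Perm.sign_mul, Equiv.Perm.sign_swap hxy]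
        simp
      · intro π _ _ h6
        have := mul_eq_right.1 h6
        exact hxy (Equiv.swap_eq_one_iff.1 this)
      · intro π _
        simp
  have h2 := congrArg (LinearMap.trace ℚ _) h1
  rw [map_sum, map_zero] at h2
  simpa only [map_smul, smul_eq_mul, Representation.character] using h2

end HookTensor

/-! ### Virtual modules of norm one -/

section VirtualModule

variable (R : Type) [Ring R] [Algebra ℚ R]

/-- The dimension of the space of linear maps between two modules over a `ℚ`-algebra. -/
def homDim (A B : Type) [AddCommGroup A] [AddCommGroup B] [Module ℚ B] [Module R A]
    [Module R B] [IsScalarTower ℚ R B] : ℕ :=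
  Module.finrank ℚ (A →ₗ[R] B)

variable {R}
variable {A B C X : Type} [AddCommGroup A] [AddCommGroup B] [AddCommGroup C] [AddCommGroup X]
  [Module ℚ A] [Module ℚ B] [Module ℚ C] [Module ℚ X] [Module R A] [Module R B] [Module R C]
  [Module R X] [IsScalarTower ℚ R A] [IsScalarTower ℚ R B] [IsScalarTower ℚ R C]
  [IsScalarTower ℚ R X]

theorem finite_hom [FiniteDimensional ℚ A] [FiniteDimensional ℚ B] :
    FiniteDimensional ℚ (A →ₗ[R] B) :=
  Module.Finite.of_injective (LinearMap.restrictScalarsₗ ℚ R A B ℚ)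
    (LinearMap.restrictScalars_injective ℚ)

omit [Module ℚ A] [Module ℚ B] [IsScalarTower ℚ R A] [IsScalarTower ℚ R B] in
theorem homDim_congr_left (e : A ≃ₗ[R] B) : homDim R A X = homDim R B X :=
  (LinearEquiv.congrLeft X ℚ e).finrank_eq

omit [Module ℚ X] [IsScalarTower ℚ R X] in
theorem homDim_congr_right (e : A ≃ₗ[R] B) : homDim R X A = homDim R X B := by
  refine LinearEquiv.finrank_eq (R := ℚ) ⟨⟨⟨fun f => e.toLinearMap ∘ₗ f, ?_⟩, ?_⟩,
    fun f => e.symm.toLinearMap ∘ₗ f, ?_, ?_⟩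
  · intro f g
    ext x
    simp
  · intro c f
    ext x
    exact map_rat_smul e c (f x)
  · intro f
    ext x
    simp
  · intro f
    ext x
    simp

theorem homDim_prod_left [FiniteDimensional ℚ A] [FiniteDimensional ℚ B] [FiniteDimensional ℚ X] :
    homDim R (A × B) X = homDim R A X + homDim R B X := by
  have := finite_hom (R := R) (A := A) (B := X)
  have := finite_hom (R := R) (A := B) (B := X)
  rw [homDim, ← (LinearMap.coprodEquiv (R := R) (M := A) (M₂ := B) (M₃ := X) ℚ).finrank_eq,
    Module.finrank_prod]
  rfl

theorem homDim_prod_right [FiniteDimensional ℚ A] [FiniteDimensional ℚ B] [FiniteDimensional ℚ X] :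
    homDim R X (A × B) = homDim R X A + homDim R X B := by
  have := finite_hom (R := R) (A := X) (B := A)
  have := finite_hom (R := R) (A := X) (B := B)
  rw [homDim, ← (LinearMap.prodEquiv (R := R) (M := X) (M₂ := A) (M₃ := B) ℚ).finrank_eq,
    Module.finrank_prod]
  rfl

theorem homDim_mono_right [FiniteDimensional ℚ A] [FiniteDimensional ℚ B] [FiniteDimensional ℚ X]
    {f : A →ₗ[R] B} (hf : Function.Injective f) : homDim R X A ≤ homDim R X B := by
  have := finite_hom (R := R) (A := X) (B := B)
  refine LinearMap.finrank_le_finrank_of_injective (R := ℚ)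
    (f := ⟨⟨fun g => f ∘ₗ g, ?_⟩, ?_⟩) ?_
  · intro g h
    ext x
    simp
  · intro c g
    ext x
    exact map_rat_smul f c (g x)
  · intro g h hgh
    ext x
    exact hf (LinearMap.congr_fun hgh x)

theorem subsingleton_of_homDim_self [FiniteDimensional ℚ A] (h : homDim R A A = 0) :
    Subsingleton A := by
  have := finite_hom (R := R) (A := A) (B := A)
  have h1 : Subsingleton (A →ₗ[R] A) := Module.finrank_zero_iff.1 h
  refine ⟨fun x y => ?_⟩
  have h2 := Subsingleton.elim (LinearMap.id : A →ₗ[R] A) 0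
  rw [← LinearMap.id_apply (R := R) x, ← LinearMap.id_apply (R := R) y, h2]
  rfl

omit [Module ℚ A] [IsScalarTower ℚ R A] in
theorem homDim_eq_zero_of_subsingleton_left [Subsingleton A] : homDim R A X = 0 := by
  have : Subsingleton (A →ₗ[R] X) := ⟨fun f g => LinearMap.ext fun x => by
    rw [Subsingleton.elim x 0, map_zero, map_zero]⟩
  exact Module.finrank_zero_of_subsingleton

theorem finite_submodule [FiniteDimensional ℚ A] (K : Submodule R A) : FiniteDimensional ℚ K :=
  Module.Finite.of_injective (K.subtype.restrictScalars ℚ) K.subtype_injective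

omit [IsScalarTower ℚ R B] [IsScalarTower ℚ R C] in
theorem finrank_of_equiv_prod [FiniteDimensional ℚ B] [FiniteDimensional ℚ C]
    (e : A ≃ₗ[R] B × C) :
    Module.finrank ℚ A = Module.finrank ℚ B + Module.finrank ℚ C := by
  rw [(e.restrictScalars ℚ).finrank_eq, Module.finrank_prod]

variable [IsSemisimpleRing R]

omit [Algebra ℚ R] [IsScalarTower ℚ R A] [IsScalarTower ℚ R B] in
-- By semisimplicity the kernel and the range have complements, and the complement of the kernel is
-- isomorphic to the range.
theorem exists_common_summand [FiniteDimensional ℚ A] [FiniteDimensional ℚ B] (f : A →ₗ[R] B) :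
    ∃ C : Submodule R B, Nonempty (A ≃ₗ[R] LinearMap.ker f × LinearMap.range f) ∧
      Nonempty (B ≃ₗ[R] C × LinearMap.range f) := by
  obtain ⟨C', hC'⟩ := exists_isCompl (LinearMap.ker f)
  obtain ⟨C, hC⟩ := exists_isCompl (LinearMap.range f)
  exact ⟨C, ⟨(Submodule.prodEquivOfIsCompl _ _ hC').symm.trans
    ((LinearEquiv.refl R _).prodCongr
      ((Submodule.quotientEquivOfIsCompl _ _ hC').symm.trans f.quotKerEquivRange))⟩,
    ⟨(Submodule.prodEquivOfIsCompl _ _ hC.symm).symm⟩⟩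

/-- If `A - B` is a virtual module of norm one that has a positive pairing with some module,
then its pairing is monotone. -/
theorem homDim_add_le_of_norm_one {P U U' : Type} [AddCommGroup P] [AddCommGroup U]
    [AddCommGroup U'] [Module ℚ P] [Module ℚ U] [Module ℚ U'] [Module R P] [Module R U]
    [Module R U'] [IsScalarTower ℚ R P] [IsScalarTower ℚ R U] [IsScalarTower ℚ R U']
    [FiniteDimensional ℚ P] [FiniteDimensional ℚ U] [FiniteDimensional ℚ U'] {j : U' →ₗ[R] U}
    (hj : Function.Injective j) (N : ℕ) :
    ∀ (A B : Type) [AddCommGroup A] [AddCommGroup B] [Module ℚ A] [Module ℚ B] [Module R A]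
      [Module R B] [IsScalarTower ℚ R A] [IsScalarTower ℚ R B] [FiniteDimensional ℚ A]
      [FiniteDimensional ℚ B], Module.finrank ℚ A ≤ N →
      homDim R A A + homDim R B B = homDim R A B + homDim R B A + 1 →
      homDim R B P < homDim R A P →
      homDim R A U' + homDim R B U ≤ homDim R A U + homDim R B U' := by
  induction N with
  | zero =>
    intro A B _ _ _ _ _ _ _ _ _ _ hA _ hP
    have : Subsingleton A := Module.finrank_zero_iff.1 (Nat.le_zero.1 hA)
    rw [homDim_eq_zero_of_subsingleton_left (A := A)] at hP
    exact absurd hP (Nat.not_lt_zero _)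
  | succ N ih =>
    intro A B _ _ _ _ _ _ _ _ _ _ hA hAB hP
    -- Removing a common summand `S` leaves the norm of `A - B` and all its pairings unchanged and
    -- lowers the dimension, so induction applies.
    have step : ∀ (A' B' S : Type) [AddCommGroup A'] [AddCommGroup B'] [AddCommGroup S]
        [Module ℚ A'] [Module ℚ B'] [Module ℚ S] [Module R A'] [Module R B'] [Module R S]
        [IsScalarTower ℚ R A'] [IsScalarTower ℚ R B'] [IsScalarTower ℚ R S]
        [FiniteDimensional ℚ A'] [FiniteDimensional ℚ B'] [FiniteDimensional ℚ S] [Nontrivial S]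
        (_ : A ≃ₗ[R] A' × S) (_ : B ≃ₗ[R] B' × S),
        homDim R A U' + homDim R B U ≤ homDim R A U + homDim R B U' := by
      intro A' B' S _ _ _ _ _ _ _ _ _ _ _ _ _ _ _ _ e e'
      have h1 := finrank_of_equiv_prod e
      have h2 : 0 < Module.finrank ℚ S := Module.finrank_pos
      have h3 := ih A' B' (by omega)
      simp only [homDim_congr_left e, homDim_congr_left e', homDim_congr_right e,
        homDim_congr_right e', homDim_prod_left, homDim_prod_right] at hAB hP ⊢
      have h4 := h3 (by omega) (by omega)
      omega
    by_cases h1 : ∃ f : A →ₗ[R] B, f ≠ 0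
    · obtain ⟨f, hf⟩ := h1
      obtain ⟨C, ⟨e⟩, ⟨e'⟩⟩ := exists_common_summand f
      have := finite_submodule C
      have := finite_submodule (LinearMap.ker f)
      have := finite_submodule (LinearMap.range f)
      have : Nontrivial (LinearMap.range f) :=
        Submodule.nontrivial_iff_ne_bot.2 fun h => hf (LinearMap.range_eq_bot.1 h)
      exact step _ _ _ e e'
    by_cases h2 : ∃ f : B →ₗ[R] A, f ≠ 0
    · obtain ⟨f, hf⟩ := h2
      obtain ⟨C, ⟨e⟩, ⟨e'⟩⟩ := exists_common_summand f
      have := finite_submodule C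
      have := finite_submodule (LinearMap.ker f)
      have := finite_submodule (LinearMap.range f)
      have : Nontrivial (LinearMap.range f) :=
        Submodule.nontrivial_iff_ne_bot.2 fun h => hf (LinearMap.range_eq_bot.1 h)
      exact step _ _ _ e' e
    push Not at h1 h2
    have h3 : homDim R A B = 0 := by
      have : Subsingleton (A →ₗ[R] B) := ⟨fun f g => (h1 f).trans (h1 g).symm⟩
      exact Module.finrank_zero_of_subsingleton
    have h4 : homDim R B A = 0 := by
      have : Subsingleton (B →ₗ[R] A) := ⟨fun f g => (h2 f).trans (h2 g).symm⟩
      exact Module.finrank_zero_of_subsingleton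
    -- Without non-zero maps between `A` and `B`, norm one forces one endomorphism space to vanish.
    -- The positive pairing with `P` excludes `A = 0`, so `B = 0`.
    have h5 : homDim R A A ≠ 0 := by
      intro h
      have := subsingleton_of_homDim_self h
      rw [homDim_eq_zero_of_subsingleton_left (A := A)] at hP
      exact absurd hP (Nat.not_lt_zero _)
    have : Subsingleton B := subsingleton_of_homDim_self (R := R) (by omega)
    rw [homDim_eq_zero_of_subsingleton_left (A := B), homDim_eq_zero_of_subsingleton_left (A := B)]
    simpa using homDim_mono_right hj

end VirtualModule

/-! ### Positivity -/

section Positivity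

variable {m N : ℕ}

/-- A set of labelled colorings that is given by a condition on the label and the content. -/
abbrev ColorSet (m : ℕ) {N : ℕ} {T : Type} (Q : T → (Fin N →₀ ℕ) → Prop) : Type :=
  {x : T × (Fin m → Fin N) // Q x.1 (content x.2)}

/-- The permutation of the colorings. -/
def permuteColors {T : Type} (Q : T → (Fin N →₀ ℕ) → Prop) (τ : Equiv.Perm (Fin m))
    (x : ColorSet m Q) : ColorSet m Q :=
  ⟨(x.1.1, x.1.2 ∘ τ), by rw [content_comp_perm]; exact x.2⟩

/-- The permutation representation on a set of colorings. -/
def colorRep (m : ℕ) {T : Type} (Q : T → (Fin N →₀ ℕ) → Prop) :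
    Representation ℚ (Equiv.Perm (Fin m)) (ColorSet m Q → ℚ) where
  toFun τ := LinearMap.funLeft ℚ ℚ (permuteColors Q τ)
  map_one' := rfl
  map_mul' _ _ := rfl

theorem trace_funLeft {I : Type} [Fintype I] [DecidableEq I] (φ : I → I) :
    LinearMap.trace ℚ (I → ℚ) (LinearMap.funLeft ℚ ℚ φ)
      = (Finset.univ.filter fun x => φ x = x).card := by
  rw [LinearMap.trace_eq_matrix_trace ℚ (Pi.basisFun ℚ I), Matrix.trace, Finset.card_filter]
  push_cast
  refine Finset.sum_congr rfl fun x _ => ?_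
  rw [Matrix.diag_apply, LinearMap.toMatrix_apply]
  simp [LinearMap.funLeft_apply, Pi.single_apply]

theorem character_colorRep {T : Type} [Fintype T] (Q : T → (Fin N →₀ ℕ) → Prop)
    (τ : Equiv.Perm (Fin m)) [∀ t, DecidablePred (Q t)] : (colorRep m Q).character τ
      = ∑ t : T, ∑ g : Fin m → Fin N, if Q t (content g) ∧ g ∘ τ = g then 1 else 0 := by
  classical
  have h1 : (colorRep m Q).character τ
      = (Finset.univ.filter fun x : ColorSet m Q => permuteColors Q τ x = x).card :=
    trace_funLeft _
  rw [h1, ← Fintype.sum_prod_type']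
  simp only [ite_and]
  rw [← Finset.sum_filter, Finset.sum_subtype _
    (p := fun x : T × (Fin m → Fin N) => Q x.1 (content x.2)) (by simp), Finset.card_filter]
  push_cast
  refine Finset.sum_congr rfl fun x _ => if_congr ?_ rfl rfl
  rw [Subtype.ext_iff, Prod.ext_iff]
  exact and_iff_right rfl

theorem character_colorRep_inv {T : Type} (Q : T → (Fin N →₀ ℕ) → Prop)
    (τ : Equiv.Perm (Fin m)) :
    (colorRep m Q).character τ⁻¹ = (colorRep m Q).character τ :=
  character_eq_of_isConj _ _ _ (Equiv.Perm.isConj_iff_cycleType_eq.2 (Equiv.Perm.cycleType_inv τ))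

/-- The group algebra of the symmetric group. -/
abbrev PermAlgebra (m : ℕ) : Type := MonoidAlgebra ℚ (Equiv.Perm (Fin m))

/-- The scalar product of characters is the dimension of a space of intertwiners. The inverse in it
can be dropped, since a permutation is conjugate to its inverse. -/
theorem hall_ch_colorRep {V T : Type} [Finite T] [AddCommGroup V] [Module ℚ V]
    [FiniteDimensional ℚ V]
    (ρ : Representation ℚ (Equiv.Perm (Fin m)) V) (Q : T → (Fin N →₀ ℕ) → Prop) :
    hall (ch ρ.character) (ch (colorRep m Q).character)
      = homDim (PermAlgebra m) (colorRep m Q).asModule ρ.asModule := by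
  have : Invertible (Nat.card (Equiv.Perm (Fin m)) : ℚ) :=
    invertibleOfNonzero (by rw [Nat.cast_ne_zero]; exact Nat.card_pos.ne')
  have h1 := Representation.card_inv_mul_sum_char_mul_char_eq_finrank (colorRep m Q) ρ
  rw [(Representation.IntertwiningMap.equivLinearMapAsModule _ _).finrank_eq] at h1
  rw [homDim, ← h1, hall_ch (character_eq_of_isConj _), Nat.card_eq_fintype_card,
    Fintype.card_perm]
  congr 1
  refine Finset.sum_congr rfl fun τ _ => ?_
  rw [character_colorRep_inv, mul_comm]

theorem card_colorings_filter (d : Fin N →₀ ℕ) (τ : Equiv.Perm (Fin m)) :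
    (((colorings (Fin m) d).filter fun g => g ∘ τ = g).card : ℚ)
      = ∑ g : Fin m → Fin N, if content g = d ∧ g ∘ τ = g then 1 else 0 := by
  rw [Finset.sum_boole]
  refine congrArg (fun s : Finset (Fin m → Fin N) => (s.card : ℚ)) ?_
  ext g
  simp [mem_colorings]

/-- A product of `h_{d_i}` acts as the characteristic of the permutation module on the colorings of
content `d`. -/
theorem hall_ch_completeProd {V : Type} [AddCommGroup V] [Module ℚ V]
    (ρ : Representation ℚ (Equiv.Perm (Fin m)) V) (d : Fin N →₀ ℕ) :
    hall (ch ρ.character) (completeProd d)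
      = hall (ch ρ.character) (ch (colorRep m fun (_ : Unit) c => c = d).character) := by
  rw [hall_completeProd, hall_ch (character_eq_of_isConj _), ch, map_smul, map_smul, map_sum,
    map_sum, smul_eq_mul]
  congr 1
  refine Finset.sum_congr rfl fun τ _ => ?_
  rw [map_smul, map_smul, coeff_cyclePowerSum, card_colorings_filter, character_colorRep,
    smul_eq_mul, mul_comm, Finset.univ_unique (α := Unit), Finset.sum_singleton]

/-- The contents that occur in the expansion of the Jacobi–Trudi determinant. -/
def alternantContent (f : ℕ → ℕ) (N : ℕ) (ε : ℤˣ) :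
    {w : Equiv.Perm (Fin N) // Equiv.Perm.sign w = ε} → (Fin N →₀ ℕ) → Prop :=
  fun w d => ∀ i, (d i : ℤ) = f i - (i : ℕ) + (w.1 i : ℕ)

theorem hall_cyclePowerSum_prod_completeInt (τ : Equiv.Perm (Fin m)) (v : Fin N → ℤ) :
    hall (cyclePowerSum τ) (∏ i, completeInt (v i))
      = ∑ g : Fin m → Fin N, if (∀ i, (content g i : ℤ) = v i) ∧ g ∘ τ = g then 1 else 0 := by
  by_cases hv : ∀ i, 0 ≤ v i
  · have h1 : ∏ i, completeInt (v i)
        = completeProd (Finsupp.equivFunOnFinite.symm fun i => (v i).toNat) := by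
      rw [completeProd_eq _ Finset.univ (Finset.subset_univ _)]
      refine Finset.prod_congr rfl fun i _ => ?_
      rw [completeInt, if_pos (hv i)]
      rfl
    rw [h1, hall_completeProd, coeff_cyclePowerSum, card_colorings_filter]
    refine Finset.sum_congr rfl fun g _ => ?_
    refine if_congr (and_congr_left fun _ => ?_) rfl rfl
    rw [DFunLike.ext_iff]
    refine forall_congr' fun i => ?_
    have := hv i
    change content g i = (v i).toNat ↔ _
    omega
  · push Not at hv
    obtain ⟨i, hi⟩ := hv
    rw [Finset.prod_eq_zero (Finset.mem_univ i) (completeInt_of_neg hi), map_zero]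
    symm
    refine Finset.sum_eq_zero fun g _ => if_neg fun h => ?_
    have := h.1 i
    omega

theorem hall_cyclePowerSum_jacobiTrudi (f : ℕ → ℕ) (N : ℕ) (τ : Equiv.Perm (Fin m)) :
    hall (cyclePowerSum τ) (jacobiTrudi f N) = (colorRep m (alternantContent f N 1)).character τ
      - (colorRep m (alternantContent f N (-1))).character τ := by
  classical
  rw [jacobiTrudi, ← Matrix.det_transpose, Matrix.det_apply', map_sum, character_colorRep,
    character_colorRep]
  have h1 : ∀ w : Equiv.Perm (Fin N), hall (cyclePowerSum τ) (((Equiv.Perm.sign w : ℤ) : SymFun) *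
      ∏ i : Fin N, completeInt ((f i : ℤ) - (i : ℕ) + (w i : ℕ)))
      = ((Equiv.Perm.sign w : ℤ) : ℚ) * ∑ g : Fin m → Fin N,
        if (∀ i, (content g i : ℤ) = (f i : ℤ) - (i : ℕ) + (w i : ℕ)) ∧ g ∘ τ = g then 1 else 0 := by
    intro w
    rw [← zsmul_eq_mul, map_zsmul, zsmul_eq_mul, hall_cyclePowerSum_prod_completeInt]
  refine (Finset.sum_congr rfl fun w _ => h1 w).trans ?_
  have h2 : ∀ (ε : ℤˣ) (F : Equiv.Perm (Fin N) → ℚ),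
      ∑ w : {w : Equiv.Perm (Fin N) // Equiv.Perm.sign w = ε}, F w
      = ∑ w, if Equiv.Perm.sign w = ε then F w else 0 := by
    intro ε F
    rw [← Finset.sum_filter, Finset.sum_subtype _ (p := fun w => Equiv.Perm.sign w = ε) (by simp)]
  have h3 : ∀ ε : ℤˣ, (∑ w : {w : Equiv.Perm (Fin N) // Equiv.Perm.sign w = ε}, ∑ g : Fin m → Fin N,
      if alternantContent f N ε w (content g) ∧ g ∘ τ = g then (1 : ℚ) else 0)
      = ∑ w : Equiv.Perm (Fin N), if Equiv.Perm.sign w = ε then ∑ g : Fin m → Fin N,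
        if (∀ i, (content g i : ℤ) = (f i : ℤ) - (i : ℕ) + (w i : ℕ)) ∧ g ∘ τ = g then 1 else 0
        else 0 := by
    intro ε
    rw [← h2 ε fun w => ∑ g : Fin m → Fin N,
      if (∀ i, (content g i : ℤ) = (f i : ℤ) - (i : ℕ) + (w i : ℕ)) ∧ g ∘ τ = g then 1 else 0]
    refine Finset.sum_congr rfl fun w _ => Finset.sum_congr rfl fun g _ => ?_
    by_cases h : alternantContent f N ε w (content g) ∧ g ∘ τ = g
    · rw [if_pos h]
      exact (if_pos h).symm
    · rw [if_neg h]
      exact (if_neg h).symm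
  refine Eq.trans ?_ (congrArg₂ (· - ·) (h3 1).symm (h3 (-1)).symm)
  rw [← Finset.sum_sub_distrib]
  refine Finset.sum_congr rfl fun w _ => ?_
  rcases Int.units_eq_one_or (Equiv.Perm.sign w) with h | h
  · rw [h, if_pos rfl, if_neg (by decide)]
    simp
  · rw [h, if_pos rfl, if_neg (by decide)]
    simp

/-- Each Leibniz term of the Jacobi-Trudi determinant is a permutation module, or zero if an index
is negative; the even terms form one module and the odd terms the other. -/
theorem schur_eq_ch_sub (μ : m.Partition) :
    schur μ = ch (colorRep m (alternantContent (partsFn μ) m 1)).character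
      - ch (colorRep m (alternantContent (partsFn μ) m (-1))).character := by
  have h1 : schur μ ∈ homog (Fintype.card (Fin m)) := by
    rw [Fintype.card_fin]
    exact schur_mem_homog μ
  rw [← ch_sub]
  refine (eq_ch h1).trans (congrArg ch (funext fun τ => ?_))
  rw [schur_eq_jacobiTrudi, hall_cyclePowerSum_jacobiTrudi]
  rfl

/-- With `s_μ = A - B`, the pairing is an alternating sum of four dimensions of `Hom` spaces. It is
non-negative by `homDim_add_le_of_norm_one`: `hall_schur_schur` gives norm one, a positive
coefficient of `s_μ` gives the module `P`, and the inclusion of sign-isotypic parts is the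
injection. -/
theorem exists_hall_ch_signRep_eq_natCast (n a : ℕ) (μ : m.Partition) :
    ∃ k : ℕ, hall (ch (signRep n a m).character - ch (signRep n (a + 1) m).character) (schur μ)
      = k := by
  set QA := alternantContent (partsFn μ) m 1
  set QB := alternantContent (partsFn μ) m (-1)
  have hμ : schur μ = ch (colorRep m QA).character - ch (colorRep m QB).character :=
    schur_eq_ch_sub μ
  obtain ⟨d, hd⟩ := exists_hall_jacobiTrudi_pos (N := m) (partsFn_antitone μ)
  set QP : Unit → (Fin m →₀ ℕ) → Prop := fun _ c => c = d
  have hnorm := hall_schur_schur μ μ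
  rw [if_pos rfl, hμ] at hnorm
  simp only [map_sub, LinearMap.sub_apply, hall_ch_colorRep] at hnorm
  rw [← schur_eq_jacobiTrudi, hμ, map_sub, LinearMap.sub_apply, hall_ch_completeProd,
    hall_ch_completeProd, hall_comm (ch (colorRep m QA).character),
    hall_comm (ch (colorRep m QB).character), hall_ch_colorRep, hall_ch_colorRep] at hd
  let j := Representation.IntertwiningMap.equivLinearMapAsModule (signRep n (a + 1) m)
    (signRep n a m) ⟨Submodule.inclusion (signTensors_succ_le n a m), fun _ => rfl⟩
  have hj : Function.Injective j := Submodule.inclusion_injective (signTensors_succ_le n a m)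
  have h := homDim_add_le_of_norm_one (R := PermAlgebra m)
    (P := (colorRep m QP).asModule) (U := (signRep n a m).asModule)
    (U' := (signRep n (a + 1) m).asModule) (j := j) hj _ (colorRep m QA).asModule (colorRep m QB).asModule
    le_rfl (by
      have h1 : (homDim (PermAlgebra m) (colorRep m QA).asModule (colorRep m QA).asModule
          + homDim (PermAlgebra m) (colorRep m QB).asModule (colorRep m QB).asModule : ℚ)
          = homDim (PermAlgebra m) (colorRep m QA).asModule (colorRep m QB).asModule
            + homDim (PermAlgebra m) (colorRep m QB).asModule (colorRep m QA).asModule + 1 := by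
        linarith
      exact_mod_cast h1) (by exact_mod_cast sub_pos.1 hd)
  obtain ⟨k, hk⟩ := Nat.exists_eq_add_of_le h
  refine ⟨k, ?_⟩
  have hk' := congrArg (Nat.cast (R := ℚ)) hk
  push_cast at hk'
  rw [hμ]
  simp only [map_sub, LinearMap.sub_apply, hall_ch_colorRep]
  linarith

end Positivity

theorem SchurPositive.add {F G : SymFun} (hF : SchurPositive F) (hG : SchurPositive G) :
    SchurPositive (F + G) := by
  classical
  obtain ⟨c, hc⟩ := hF
  obtain ⟨d, hd⟩ := hG
  refine ⟨c + d, ?_⟩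
  rw [hc, hd]
  refine (Finsupp.sum_add_index' (h := fun (l : Σ m : ℕ, m.Partition) (k : ℕ) => k • schur l.2)
    (fun l => ?_) fun l b₁ b₂ => ?_).symm
  · exact zero_nsmul (schur l.2)
  · exact add_nsmul (schur l.2) b₁ b₂

theorem SchurPositive.sum {I : Type*} (s : Finset I) {F : I → SymFun}
    (h : ∀ i ∈ s, SchurPositive (F i)) : SchurPositive (∑ i ∈ s, F i) :=
  Finset.sum_induction F SchurPositive (fun _ _ => SchurPositive.add) ⟨0, by simp⟩ h

theorem schurPositive_nsmul_schur {m : ℕ} (μ : m.Partition) (k : ℕ) :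
    SchurPositive (k • schur μ) := by
  refine ⟨Finsupp.single ⟨m, μ⟩ k, ?_⟩
  rw [Finsupp.sum_single_index]
  exact zero_nsmul (schur μ)

theorem schurPositive_of_hall {m : ℕ} {F : SymFun} (hF : F ∈ homog m)
    (h : ∀ μ : m.Partition, ∃ k : ℕ, hall F (schur μ) = k) : SchurPositive F := by
  have h1 : ∀ μ : m.Partition, SchurPositive (hall F (schur μ) • schur μ) := by
    intro μ
    obtain ⟨k, hk⟩ := h μ
    have h2 : hall F (schur μ) • schur μ = k • schur μ := by
      rw [hk]
      exact Nat.cast_smul_eq_nsmul ℚ k (schur μ)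
    rw [h2]
    exact schurPositive_nsmul_schur μ k
  have h3 := SchurPositive.sum Finset.univ fun μ (_ : μ ∈ Finset.univ) => h1 μ
  rwa [← eq_sum_schur hF] at h3

theorem ch_mem_homog_fin {m : ℕ} (χ : Equiv.Perm (Fin m) → ℚ) : ch χ ∈ homog m := by
  simpa using ch_mem_homog χ

theorem schurPositive_alternant {n : ℕ} (hn : 0 < n) (a B : ℕ) :
    SchurPositive (alternant n (hookTensor n a B - hookTensor n (a + 1) B)) := by
  rw [alternant_sub, alternant_hookTensor hn, alternant_hookTensor hn, ← Finset.sum_sub_distrib]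
  refine SchurPositive.sum _ fun m _ => schurPositive_of_hall (m := m)
    (Submodule.sub_mem _ (ch_mem_homog_fin _) (ch_mem_homog_fin _)) fun μ => ?_
  exact exists_hall_ch_signRep_eq_natCast n a μ

theorem skew_elementary_alternant {n : ℕ} (hn : 0 < n) (a B k : ℕ) (hk : n ≤ k) :
    skew (elementary k) (alternant n (hookTensor n a B - hookTensor n (a + 1) B)) = 0 := by
  rw [alternant_sub, alternant_hookTensor hn, alternant_hookTensor hn, map_sub, map_sum, map_sum,
    Finset.sum_eq_zero fun m _ => skew_elementary_ch_signRep hn a m k hk,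
    Finset.sum_eq_zero fun m _ => skew_elementary_ch_signRep hn (a + 1) m k hk, sub_zero]

end

end HookHarmonics

theorem mainTheorem4 (n a : ℕ) (ha : a < n) :
    (∃! S : SymFun ⊗[ℚ] SymFun, IsHookCharacter n a S) ∧
    ∀ S : SymFun ⊗[ℚ] SymFun, IsHookCharacter n a S → HookComponents n S →
      (∃! d : n.Partition → SymFun, IsElementaryExpansion (shifted S) d) ∧
      ∀ d : n.Partition → SymFun, IsElementaryExpansion (shifted S) d →
        d (Nat.Partition.indiscrete n) = alternant n S ∧
        SchurPositive (d (Nat.Partition.indiscrete n)) := by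
  have hn : 0 < n := by omega
  -- One bound serves both modules, as the one for `a + 1` is contained in the one for `a`.
  obtain ⟨B, hB⟩ := exists_hookModule_le n a hn
  have hS := isHookCharacter_sub hn hB
  have huniq : ∀ S, IsHookCharacter n a S → S = hookTensor n a B - hookTensor n (a + 1) B :=
    fun S h => eq_of_qCoeff fun d => (h d).trans (hS d).symm
  refine ⟨⟨_, hS, huniq⟩, fun S h hH => ?_⟩
  obtain rfl := huniq S h
  refine ⟨existsUnique_expansion ?_, fun d hd => ?_⟩
  · rw [shifted, map_sub]
    exact Submodule.sub_mem _ (shifted_hookTensor_mem n a B) (shifted_hookTensor_mem n (a + 1) B)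
  · have h1 := expansion_indiscrete hn hH (skew_elementary_alternant hn a B) hd
    exact ⟨h1, h1 ▸ schurPositive_alternant hn a B⟩
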